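/- Graphs are finite and undirected and may have parallel edges and loops; a loop is a cycle of length $1$, and two parallel edges form a cycle of length $2$. A graph is an $\ell$-forest if at most $\ell$ edges can be deleted from it to obtain a forest, and a pseudoforest if each of its connected components contains at most one cycle. Consider the following two problems, where $k,\ell\ge 0$ are integers. * **Restricted Independent Almost Forest Deletion (RIAFD).** Given a graph $G$, a set $R\subseteq V(G)$, and $k,\ell$: find a set $S\subseteq V(G)\setminus R$ with $|S|\le k$ that is independent in $G$ (no edge, in particular no loop, has both ends in $S$) and such that $G-S$ is an $\ell$-forest, or report that there is none. * **Pseudoforest Deletion.** Given a graph $G$ and $k$: find a set $S\subseteq V(G)$ with $|S|\le k$ such that $G-S$ is a pseudoforest, or report that there is none. **Theorem.** For each of the two problems there is a Monte-Carlo algorithm which, given an instance together with a tree decomposition of $G$ of width $\mathbf{tw}$, solves the problem in time $\mathcal{O}^\star(3^{\mathbf{tw}})$ and (hence) exponential space. More precisely, there are a randomized algorithm and a polynomial $P$ such that on every input $x$ (the instance and the tree decomposition) of length $|x|$ the algorithm, running on a random access machine with fair coin tosses and logarithmic cost, has the following properties. 1. For all outcomes of the coin tosses, it halts within time $3^{\mathbf{tw}}\cdot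 P(|x|)$; the space used is at most the running time, in addition to the input. 2. For all outcomes of the coin tosses, if it returns a set, then this set is a solution (only false negatives are possible). 3. If there is a solution, then it returns a solution with probability at least $1-2^{-|x|}$. -/

import Mathlib

/-! ### Multigraphs: cycles, forests, `ℓ`-forests, pseudoforests

Graphs may have parallel edges and loops; Mathlib's `Graph α β` is used, with vertices in `α` and
edges in `β`. -/

namespace CutCount

/-- `C` is the edge set of a cycle of `G`: there are `k + 1 ≥ 1` distinct vertices `v 0, …, v k` and
distinct edges `e 0, …, e k` such that `e i` joins `v i` to `v (i + 1)`, indices being cyclic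
(addition in `Fin (k + 1)` wraps around). A loop is a cycle of length 1 and two parallel edges form
a cycle of length 2. -/
def IsCycle {α β : Type*} (G : Graph α β) (C : Set β) : Prop :=
  ∃ (k : ℕ) (v : Fin (k + 1) → α) (e : Fin (k + 1) → β),
    Function.Injective v ∧ Function.Injective e ∧
      (∀ i, G.IsLink (e i) (v i) (v (i + 1))) ∧ C = Set.range e

/-- A forest is a graph without cycles. -/
def IsForest {α β : Type*} (G : Graph α β) : Prop :=
  ∀ C : Set β, ¬ IsCycle G C

/-- An `ℓ`-forest is a graph from which at most `ℓ` edges can be deleted to get a forest. -/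
def IsAlmostForest {α β : Type*} (l : ℕ) (G : Graph α β) : Prop :=
  ∃ D : Finset β, (D : Set β) ⊆ G.edgeSet ∧ D.card ≤ l ∧ IsForest (G.deleteEdges (D : Set β))

/-- Two vertices lie in the same connected component. -/
def Connected {α β : Type*} (G : Graph α β) (x y : α) : Prop :=
  Relation.ReflTransGen G.Adj x y

/-- A pseudoforest is a graph in which every connected component has at most one cycle: two cycles
which pass through vertices of the same component are equal. -/
def IsPseudoforest {α β : Type*} (G : Graph α β) : Prop :=
  ∀ C C' : Set β, IsCycle G C → IsCycle G C' →
    (∃ e ∈ C, ∃ e' ∈ C', ∃ x y, G.Inc e x ∧ G.Inc e' y ∧ Connected G x y) → C = C'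

/-- `S` is independent: no edge (in particular no loop) has both ends in `S`. -/
def IsIndependent {α β : Type*} (G : Graph α β) (S : Set α) : Prop :=
  ∀ e x y, G.IsLink e x y → ¬ (x ∈ S ∧ y ∈ S)

/-- The multigraph on the vertices `0, …, n - 1` whose edges are given by a list of `m` pairs of
endpoints. -/
def graphOf {n m : ℕ} (ends : Fin m → Fin n × Fin n) : Graph (Fin n) (Fin m) where
  vertexSet := Set.univ
  IsLink e x y := s((ends e).1, (ends e).2) = s(x, y)
  edgeSet := Set.univ
  isLink_symm := by
    intro e _
    exact ⟨fun _ _ h => h.trans Sym2.eq_swap⟩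
  eq_or_eq_of_isLink_of_isLink := by
    intro e x y v w h h'
    rcases Sym2.eq_iff.1 (h.symm.trans h') with ⟨h1, _⟩ | ⟨h1, _⟩
    · exact Or.inl h1
    · exact Or.inr h1
  edge_mem_iff_exists_isLink := by
    intro e
    exact ⟨fun _ => ⟨_, _, rfl⟩, fun _ => trivial⟩
  left_mem_of_isLink := by
    intro e x y _
    trivial

/-! ### Tree decompositions -/

/-- A tree decomposition, with nodes `0, …, N - 1`, of a (multi)graph `G`. -/
structure TreeDecomposition {α β : Type*} (G : Graph α β) (N : ℕ) where
  /-- The tree of the decomposition. -/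
  tree : SimpleGraph (Fin N)
  isTree : tree.IsTree
  /-- The bags. -/
  bag : Fin N → Finset α
  bag_subset : ∀ x, (bag x : Set α) ⊆ G.vertexSet
  vertex_mem : ∀ v ∈ G.vertexSet, ∃ x, v ∈ bag x
  edge_mem : ∀ e u v, G.IsLink e u v → ∃ x, u ∈ bag x ∧ v ∈ bag x
  connected : ∀ v ∈ G.vertexSet, (tree.induce {x | v ∈ bag x}).Connected

/-- The width: the largest size of a bag, minus one (and `0` for the graph without vertices). -/
def TreeDecomposition.width {α β : Type*} {G : Graph α β} {N : ℕ}
    (D : TreeDecomposition G N) : ℕ :=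
  (Finset.univ.sup fun x => (D.bag x).card) - 1

/-! ### The two problems: sets of solutions -/

/-- The solutions of Restricted Independent Almost Forest Deletion on `(G, R, k, l)`. -/
def riafdSolutions {α β : Type*} (G : Graph α β) (R : Finset α) (k l : ℕ) : Set (Finset α) :=
  {S | (S : Set α) ⊆ G.vertexSet ∧ S.card ≤ k ∧ Disjoint S R ∧ IsIndependent G (S : Set α) ∧
    IsAlmostForest l (G.deleteVerts (S : Set α))}

/-- The solutions of Pseudoforest Deletion on `(G, k)`. -/
def pdSolutions {α β : Type*} (G : Graph α β) (k : ℕ) : Set (Finset α) :=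
  {S | (S : Set α) ⊆ G.vertexSet ∧ S.card ≤ k ∧ IsPseudoforest (G.deleteVerts (S : Set α))}

/-! ### The machine model

A random access machine with coin tosses and logarithmic cost, programmed in a structured
language. The memory consists of arrays of natural numbers of unbounded length; a program names its
arrays literally, so it uses finitely many of them. Operands are charged by their binary lengths
`Nat.size`. -/

/-- The memory: `μ x i` is the content of cell `i` of array `x`. -/
abbrev Mem : Type := ℕ → ℕ → ℕ

/-- The arithmetic operations of the machine. -/
inductive Op : Type
  | add | sub | mul | div | mod | lt | eq

/-- The value of an operation (subtraction is truncated, comparisons return `0` or `1`). -/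
def Op.eval : Op → ℕ → ℕ → ℕ
  | .add, a, b => a + b
  | .sub, a, b => a - b
  | .mul, a, b => a * b
  | .div, a, b => a / b
  | .mod, a, b => a % b
  | .lt, a, b => if a < b then 1 else 0
  | .eq, a, b => if a = b then 1 else 0

/-- Expressions: constants, reading cell `i` of array `x`, and binary operations. -/
inductive Expr : Type
  | const (c : ℕ)
  | get (x : ℕ) (i : Expr)
  | bin (o : Op) (a b : Expr)

/-- The value of an expression. -/
def Expr.eval (μ : Mem) : Expr → ℕ
  | .const c => c
  | .get x i => μ x (i.eval μ)
  | .bin o a b => o.eval (a.eval μ) (b.eval μ)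

/-- The time to evaluate an expression: a read is charged the lengths of the address and of the
value read, an arithmetic operation the product of the lengths of its operands. -/
def Expr.cost (μ : Mem) : Expr → ℕ
  | .const c => c.size + 1
  | .get x i => i.cost μ + (i.eval μ).size + (μ x (i.eval μ)).size + 1
  | .bin _ a b => a.cost μ + b.cost μ + ((a.eval μ).size + 1) * ((b.eval μ).size + 1)

/-- Programs. -/
inductive Prog : Type
  | skip
  /-- Write the value of `e` to cell `i` of array `x`. -/
  | assign (x : ℕ) (i e : Expr)
  /-- Toss a fair coin and write the result, `0` or `1`, to cell `i` of array `x`. -/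
  | flip (x : ℕ) (i : Expr)
  | seq (p q : Prog)
  /-- Run `p` if the value of `e` is not zero, and `q` otherwise. -/
  | ite (e : Expr) (p q : Prog)
  /-- Run `p` as long as the value of `e` is not zero. -/
  | loop (e : Expr) (p : Prog)

/-- A state: the memory and the outcomes of the coin tosses which are still to come. -/
structure State : Type where
  mem : Mem
  coins : List Bool

/-- The memory after writing `a` to cell `i` of array `x`. -/
def Mem.set (μ : Mem) (x i a : ℕ) : Mem :=
  Function.update μ x (Function.update (μ x) i a)

/-- `Run p s t s'`: started in `s`, the program `p` halts in `s'` after time `t`. A write is charged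
the lengths of the address and of the value, so the total length of everything that is ever written
to the memory, and thus the space used, is at most `t`. -/
inductive Run : Prog → State → ℕ → State → Prop
  | skip (s : State) : Run .skip s 1 s
  | assign (x : ℕ) (i e : Expr) (s : State) :
      Run (.assign x i e) s
        (i.cost s.mem + e.cost s.mem + (i.eval s.mem).size + (e.eval s.mem).size + 1)
        ⟨s.mem.set x (i.eval s.mem) (e.eval s.mem), s.coins⟩
  | flip (x : ℕ) (i : Expr) (μ : Mem) (b : Bool) (cs : List Bool) :
      Run (.flip x i) ⟨μ, b :: cs⟩ (i.cost μ + (i.eval μ).size + 2)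
        ⟨μ.set x (i.eval μ) b.toNat, cs⟩
  | seq {p q : Prog} {s s' s'' : State} {t t' : ℕ} :
      Run p s t s' → Run q s' t' s'' → Run (.seq p q) s (t + t') s''
  | ite_true {e : Expr} {p q : Prog} {s s' : State} {t : ℕ} :
      e.eval s.mem ≠ 0 → Run p s t s' → Run (.ite e p q) s (e.cost s.mem + t + 1) s'
  | ite_false {e : Expr} {p q : Prog} {s s' : State} {t : ℕ} :
      e.eval s.mem = 0 → Run q s t s' → Run (.ite e p q) s (e.cost s.mem + t + 1) s'
  | loop_true {e : Expr} {p : Prog} {s s' s'' : State} {t t' : ℕ} :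
      e.eval s.mem ≠ 0 → Run p s t s' → Run (.loop e p) s' t' s'' →
        Run (.loop e p) s (e.cost s.mem + t + t' + 1) s''
  | loop_false {e : Expr} {p : Prog} {s : State} :
      e.eval s.mem = 0 → Run (.loop e p) s (e.cost s.mem + 1) s

/-- The initial memory on an input consisting of finitely many tables of numbers: the `j`-th table
is in array `j + 1`, and everything else is zero. -/
def inputMem (x : List (List ℕ)) : Mem
  | 0, _ => 0
  | j + 1, i => (x.getD j []).getD i 0

/-- The length of an input: the total length of the binary representations of its entries, with one
separator for each entry. -/
def inputSize (x : List (List ℕ)) : ℕ :=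
  (x.map fun table => (table.map fun a => a.size + 1).sum).sum

/-- The answer left in array `0`: it is `none` (that is, "infeasible") if cell `0` is zero, and
otherwise the set of all `v` for which cell `v + 1` is not zero. -/
def output (n : ℕ) (s : State) : Option (Finset (Fin n)) :=
  if s.mem 0 0 = 0 then none else some (Finset.univ.filter fun v : Fin n => s.mem 0 (v + 1) ≠ 0)

/-- The probability of an event over `T` independent tosses of a fair coin. -/
noncomputable def coinProb (T : ℕ) (A : Set (Fin T → Bool)) : ℝ :=
  (A.ncard : ℝ) / 2 ^ T

/-- `p` is a Monte-Carlo algorithm with one-sided error which, on the input `x`, searches in time at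
most `T` for an element of the set `Sol` of subsets of `{0, …, n - 1}`: whatever the outcomes of the
coin tosses, it halts after time at most `T` (so that it tosses at most `T` coins) and any set which
it returns belongs to `Sol`; and if `Sol` is not empty, then it returns an element of `Sol` with
probability at least `1 - 2 ^ (- |x|)`, where `|x|` is the length of the input. -/
def FindsWithin (p : Prog) (x : List (List ℕ)) (T n : ℕ) (Sol : Set (Finset (Fin n))) : Prop :=
  (∀ r : Fin T → Bool, ∃ t ≤ T, ∃ s, Run p ⟨inputMem x, List.ofFn r⟩ t s ∧
    ∀ S, output n s = some S → S ∈ Sol) ∧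
  (Sol.Nonempty → 1 - (1 / 2 : ℝ) ^ inputSize x ≤
    coinProb T {r | ∃ t ≤ T, ∃ s, Run p ⟨inputMem x, List.ofFn r⟩ t s ∧
      ∃ S ∈ Sol, output n s = some S})

/-! ### Encoding of the inputs -/

/-- The tables that describe a graph and a tree decomposition of it: the first and the second
endpoints of the edges, the adjacency matrix of the tree, and the incidence matrix of nodes and
vertices (entry `x * n + v` tells whether `v` is in the bag of `x`). -/
noncomputable def encodeGraph {n m N : ℕ} (ends : Fin m → Fin n × Fin n)
    (D : TreeDecomposition (graphOf ends) N) : List (List ℕ) :=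
  open Classical in
  [List.ofFn fun e => ((ends e).1 : ℕ),
   List.ofFn fun e => ((ends e).2 : ℕ),
   List.ofFn fun i : Fin (N * N) => if D.tree.Adj i.divNat i.modNat then 1 else 0,
   List.ofFn fun i : Fin (N * n) => if i.modNat ∈ D.bag i.divNat then 1 else 0]

/-- The input of Restricted Independent Almost Forest Deletion. -/
noncomputable def encodeRIAFD {n m N : ℕ} (ends : Fin m → Fin n × Fin n) (R : Finset (Fin n))
    (k l : ℕ) (D : TreeDecomposition (graphOf ends) N) : List (List ℕ) :=
  [n, m, N, k, l] :: (List.ofFn fun v => if v ∈ R then 1 else 0) :: encodeGraph ends D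

/-- The input of Pseudoforest Deletion. -/
noncomputable def encodePD {n m N : ℕ} (ends : Fin m → Fin n × Fin n)
    (k : ℕ) (D : TreeDecomposition (graphOf ends) N) : List (List ℕ) :=
  [n, m, N, k] :: encodeGraph ends D

end CutCount

namespace CutCount
open Finset Polynomial

/-! ### Loops of the machine -/

/-! Both problems become counting problems. Each candidate set `S` owns a family of items: for
almost forests the two-colourings of `G - S` which are constant along edges, for pseudoforests the
choices of one end for every edge of `G - S`. The items are counted by a sum over all assignments of
values 0, 1, 2 to the vertices, where 0 means deletion, of a product of weights of vertices and
edges. Such a sum is evaluated along the tree decomposition with a table of `3 ^ |bag|` entries for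
each node, by merging leaves into their neighbours (`sum_prod_merge`, `mergeTables_spec`,
`partition_spec`). The weights combine to powers of a base `X` which exceeds the number of items, so
the base-`X` digits of one number give the counts for all indices at once (`sum_pow_digit`).

Almost forests. The number of colourings is `2 ^ c`, where `c` is the number of components of `G -
S`, and `G - S` is an `l`-forest iff `c + |E(G - S)| ≤ |V \ S| + l` (`card_cuts_eq_two_pow`). The
index records `|S|` and `|E(G - S)|`, which determine a `t` such that `2 ^ t` fails to divide the
count for an independent `S` disjoint from `R` iff `S` is a solution (`riafd_test_iff`). Modulo `2 ^
t` only solutions survive. Random weights of the vertices, also recorded in the index, give some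
solution an index of its own with probability at least 1/2 (`isolation`), and then its digit is not
divisible (`cutItems_complete`). Independent rounds, at least as many as the length of the input,
reduce the error (`le_coinProb`).

Pseudoforests. A graph is a pseudoforest iff one end can be chosen for each edge with no vertex
chosen twice; one direction is Hall's theorem (`IsPseudoforest.exists_orientation`), the other
follows arrows into a cycle (`IsOrientation.isPseudoforest`). So the chosen vertices must be as many
as the edges. They are counted by giving the values 1 (may be chosen) and 2 (is not chosen) the
weights `X ^ j` and `1 - X ^ j`: a chosen vertex gets `X ^ j`, any other vertex the sum 1
(`sum_choices_eq`). Nothing cancels between items, so a nonzero digit is enough and no randomness is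
needed.

From counts to a set. The vertices are decided one after the other such that the digit stays
indivisible. In the end a single set is compatible, and its own count is indivisible, so it is a
solution whatever the coins were (`descend_spec`, `rounds_spec`).

Running time. `Comp` and `CompS` are closed under the constructions of the algorithm. All table
entries are reduced modulo a number of polynomial length, so the memory stays small even in loops of
exponential length. Such loops run over table entries only and are never nested, which gives one
factor `K + 1`, where `K` is the sum of `3 ^ |bag|` over all nodes. -/

theorem Run.loop_iterate {e : Expr} {p : Prog} {C τ : ℕ} (n : ℕ) (I : ℕ → State → Prop)
    (step : ∀ i < n, ∀ s, I i s → e.eval s.mem ≠ 0 ∧ e.cost s.mem ≤ C ∧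
      ∃ t ≤ τ, ∃ s', Run p s t s' ∧ I (i + 1) s')
    (final : ∀ s, I n s → e.eval s.mem = 0 ∧ e.cost s.mem ≤ C) {s : State} (h0 : I 0 s) :
    ∃ t ≤ n * (C + τ + 1) + (C + 1), ∃ s', Run (.loop e p) s t s' ∧ I n s' := by
  have key : ∀ m i, i + m = n → ∀ s, I i s →
      ∃ t ≤ m * (C + τ + 1) + (C + 1), ∃ s', Run (.loop e p) s t s' ∧ I n s' := by
    intro m
    induction m with
    | zero =>
      intro i hi s hs
      obtain rfl : i = n := by omega
      obtain ⟨h1, h2⟩ := final s hs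
      exact ⟨_, by omega, s, Run.loop_false h1, hs⟩
    | succ m ih =>
      intro i hi s hs
      obtain ⟨h1, h2, t, ht, s', hr, hs'⟩ := step i (by omega) s hs
      obtain ⟨t', ht', s'', hr', hs''⟩ := ih (i + 1) (by omega) s' hs'
      refine ⟨_, ?_, s'', Run.loop_true h1 hr hr', hs''⟩
      rw [Nat.succ_mul]
      omega
  exact key n 0 (by omega) s h0

/-! ### Memories with a distinguished stack -/

/-- The memory `h` with the stack `ρ` in array `20`. -/
def withStack (h : Mem) (ρ : ℕ → ℕ) : Mem := Function.update h 20 ρ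

@[simp] theorem withStack_stack (h : Mem) (ρ : ℕ → ℕ) : withStack h ρ 20 = ρ := by
  simp [withStack]

theorem withStack_of_ne {x : ℕ} (hx : x ≠ 20) (h : Mem) (ρ : ℕ → ℕ) :
    withStack h ρ x = h x := by
  simp [withStack, hx]

theorem withStack_set_stack (h : Mem) (ρ : ℕ → ℕ) (i a : ℕ) :
    (withStack h ρ).set 20 i a = withStack h (Function.update ρ i a) := by
  simp [withStack, Mem.set]

theorem withStack_set {x : ℕ} (hx : x ≠ 20) (h : Mem) (ρ : ℕ → ℕ) (i a : ℕ) :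
    (withStack h ρ).set x i a = withStack (h.set x i a) ρ := by
  simp only [Mem.set, withStack, Function.update_of_ne hx]
  exact (Function.update_comm hx _ _ _).symm

theorem Mem.set_apply (μ : Mem) (x i a y j : ℕ) :
    μ.set x i a y j = if y = x ∧ j = i then a else μ y j := by
  unfold Mem.set
  by_cases hy : y = x
  · subst hy
    by_cases hj : j = i
    · subst hj; simp
    · simp [hj]
  · simp [hy]

theorem Mem.set_of_ne (μ : Mem) {x y : ℕ} (i a : ℕ) (hy : y ≠ x) : μ.set x i a y = μ y := by
  simp [Mem.set, hy]

theorem Run.assign_stack (d : ℕ) (e : Expr) (h : Mem) (ρ : ℕ → ℕ) (cs : List Bool) :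
    Run (.assign 20 (.const d) e) ⟨withStack h ρ, cs⟩
      (d.size + 1 + e.cost (withStack h ρ) + d.size + (e.eval (withStack h ρ)).size + 1)
      ⟨withStack h (Function.update ρ d (e.eval (withStack h ρ))), cs⟩ := by
  rw [← withStack_set_stack]
  exact Run.assign 20 (.const d) e ⟨withStack h ρ, cs⟩

/-! ### Contexts of small variables -/

/-- A type of tuples of natural numbers. -/
class Ctx (Γ : Type) where
  len : ℕ
  val : Γ → ℕ → ℕ

instance : Ctx Unit := ⟨0, fun _ _ => 0⟩

/-- The newest variable gets the highest number, so the numbers of the older ones do not change when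
a loop opens a new scope. -/
instance {Γ : Type} [Ctx Γ] : Ctx (Γ × ℕ) :=
  ⟨Ctx.len Γ + 1, fun γ j => if j < Ctx.len Γ then Ctx.val γ.1 j else γ.2⟩

/-- All numbers in memory have length at most `L`; the variables, the first three numbers of the
input and the numbers in array `8` are at most `L`. -/
structure Small {Γ : Type} [Ctx Γ] (L : ℕ) (γ : Γ) (h : Mem) : Prop where
  size : ∀ x i, (h x i).size ≤ L
  var : ∀ i < Ctx.len Γ, Ctx.val γ i ≤ L
  input : ∀ i < 3, h 1 i ≤ L
  reg : ∀ i, h 8 i ≤ L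

/-- The variable number `i` is stored in cell `loc i` of the stack, below `d`. -/
def Frame {Γ : Type} [Ctx Γ] (loc : ℕ → ℕ) (d : ℕ) (γ : Γ) (ρ : ℕ → ℕ) : Prop :=
  ∀ i < Ctx.len Γ, loc i < d ∧ ρ (loc i) = Ctx.val γ i

section
variable {Γ : Type} [Ctx Γ]

theorem Small.mono {L L' : ℕ} {γ : Γ} {h : Mem} (hs : Small L γ h) (hL : L ≤ L') : Small L' γ h :=
  ⟨fun x i => (hs.size x i).trans hL, fun i hi => (hs.var i hi).trans hL,
    fun i hi => (hs.input i hi).trans hL, fun i => (hs.reg i).trans hL⟩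

theorem Small.extend {L i : ℕ} {γ : Γ} {h : Mem} (hs : Small L γ h) (hi : i ≤ L) :
    Small L (γ, i) h := by
  refine ⟨hs.size, fun j hj => ?_, hs.input, hs.reg⟩
  change (if j < Ctx.len Γ then Ctx.val γ j else i) ≤ L
  split_ifs with hj'
  · exact hs.var j hj'
  · exact hi

theorem Small.restrict {L : ℕ} {γ : Γ × ℕ} {h : Mem} (hs : Small L γ h) : Small L γ.1 h := by
  refine ⟨hs.size, fun j hj => ?_, hs.input, hs.reg⟩
  have := hs.var j (Nat.lt_succ_of_lt hj)
  change (if j < Ctx.len Γ then Ctx.val γ.1 j else γ.2) ≤ L at this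
  rwa [if_pos hj] at this

theorem Small.last {L : ℕ} {γ : Γ × ℕ} {h : Mem} (hs : Small L γ h) : γ.2 ≤ L := by
  have := hs.var (Ctx.len Γ) (Nat.lt_succ_self _)
  change (if Ctx.len Γ < Ctx.len Γ then Ctx.val γ.1 _ else γ.2) ≤ L at this
  rwa [if_neg (lt_irrefl _)] at this

theorem Frame.mono {loc : ℕ → ℕ} {d d' : ℕ} {γ : Γ} {ρ ρ' : ℕ → ℕ} (hf : Frame loc d γ ρ)
    (hd : d ≤ d') (hρ : ∀ i < d, ρ' i = ρ i) : Frame loc d' γ ρ' := fun i hi =>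
  ⟨(hf i hi).1.trans_le hd, (hρ _ (hf i hi).1).trans (hf i hi).2⟩

theorem Frame.restrict {loc : ℕ → ℕ} {d : ℕ} {γ : Γ × ℕ} {ρ : ℕ → ℕ} (hf : Frame loc d γ ρ) :
    Frame loc d γ.1 ρ := by
  intro i hi
  obtain ⟨h1, h2⟩ := hf i (Nat.lt_succ_of_lt hi)
  refine ⟨h1, h2.trans ?_⟩
  change (if i < Ctx.len Γ then Ctx.val γ.1 i else γ.2) = _
  rw [if_pos hi]

/-- Used on entering the body of a loop: the cell `k` of the counter becomes the location of the new
variable, and the stack of the body starts above it. -/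
theorem Frame.extend {loc : ℕ → ℕ} {d k d' a : ℕ} {γ : Γ} {ρ ρ' : ℕ → ℕ} (hf : Frame loc d γ ρ)
    (hd : d ≤ d') (hk : k < d') (hρ : ∀ i < d, ρ' i = ρ i) (ha : ρ' k = a) :
    Frame (Function.update loc (Ctx.len Γ) k) d' (γ, a) ρ' := by
  intro i hi
  change _ ∧ _ = (if i < Ctx.len Γ then Ctx.val γ i else a)
  by_cases hi' : i < Ctx.len Γ
  · rw [Function.update_of_ne hi'.ne, if_pos hi']
    exact (hf.mono hd hρ) i hi'
  · obtain rfl : i = Ctx.len Γ := le_antisymm (Nat.lt_succ_iff.1 hi) (not_lt.1 hi')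
    simp [hk, ha]

/-! ### Binary lengths under the operations of the machine -/

theorem size_le_self (n : ℕ) : n.size ≤ n := Nat.size_le.2 Nat.lt_two_pow_self

theorem size_le_of_le_of_size {a b s : ℕ} (h : a ≤ b) (hb : b.size ≤ s) : a.size ≤ s :=
  (Nat.size_le_size h).trans hb

theorem size_add_le (a b : ℕ) : (a + b).size ≤ a.size + b.size + 1 := by
  rw [Nat.size_le]
  have ha := Nat.lt_size_self a
  have hb := Nat.lt_size_self b
  have h1 : 2 ^ a.size ≤ 2 ^ (a.size + b.size) := Nat.pow_le_pow_right (by norm_num) (by omega)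
  have h2 : 2 ^ b.size ≤ 2 ^ (a.size + b.size) := Nat.pow_le_pow_right (by norm_num) (by omega)
  rw [pow_succ]
  omega

theorem size_mul_le (a b : ℕ) : (a * b).size ≤ a.size + b.size := by
  rw [Nat.size_le, pow_add]
  exact Nat.mul_lt_mul'' (Nat.lt_size_self a) (Nat.lt_size_self b)

theorem size_eval_le (o : Op) (a b : ℕ) : (o.eval a b).size ≤ a.size + b.size + 1 := by
  cases o
  · exact size_add_le a b
  · exact (Nat.size_le_size (Nat.sub_le a b)).trans (by omega)
  · exact (size_mul_le a b).trans (by omega)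
  · exact (Nat.size_le_size (Nat.div_le_self a b)).trans (by omega)
  · exact (Nat.size_le_size (Nat.mod_le a b)).trans (by omega)
  · refine (size_le_self _).trans ?_
    simp only [Op.eval]
    split_ifs <;> omega
  · refine (size_le_self _).trans ?_
    simp only [Op.eval]
    split_ifs <;> omega

/-! ### Functions of the memory that are computable in polynomial time -/

/-- `f` is computed by a program which leaves the value on the stack, in time polynomial in `L`
if the memory is `Small L`. -/
def Comp (f : Γ → Mem → ℕ) : Prop :=
  ∃ (p : (ℕ → ℕ) → ℕ → Prog) (q : ℕ[X]), ∀ loc d L γ h ρ cs, Frame loc d γ ρ → d ≤ L →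
    Small L γ h → (f γ h).size ≤ q.eval L ∧ ∃ t ≤ q.eval L, ∃ ρ',
      Run (p loc d) ⟨withStack h ρ, cs⟩ t ⟨withStack h ρ', cs⟩ ∧ (∀ i < d, ρ' i = ρ i) ∧
      ρ' d = f γ h

/-- `g` is bounded by a polynomial in `L` if the memory is `Small L`. -/
def Num (g : Γ → Mem → ℕ) : Prop :=
  ∃ q : ℕ[X], ∀ L γ h, Small L γ h → g γ h ≤ q.eval L

theorem Comp.const (c : ℕ) : Comp fun (_ : Γ) _ => c := by
  refine ⟨fun _ d => .assign 20 (.const d) (.const c), 2 * X + 2 * Polynomial.C c.size + 4, ?_⟩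
  intro loc d L γ h ρ cs hf hd hs
  have hd' := (size_le_self d).trans hd
  simp only [eval_add, eval_mul, eval_X, eval_C, eval_ofNat]
  refine ⟨by omega, _, ?_, _, Run.assign_stack d _ h ρ cs, fun i hi => ?_, ?_⟩
  · simp only [Expr.cost, Expr.eval]
    omega
  · simp [hi.ne]
  · simp [Expr.eval]

theorem Comp.of_var {f : Γ → ℕ} {j : ℕ} (hj : j < Ctx.len Γ) (hf : ∀ γ, f γ = Ctx.val γ j) :
    Comp fun γ _ => f γ := by
  refine ⟨fun loc d => .assign 20 (.const d) (.get 20 (.const (loc j))), 6 * X + 4, ?_⟩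
  intro loc d L γ h ρ cs hfr hd hs
  have hd' := (size_le_self d).trans hd
  obtain ⟨h1, h2⟩ := hfr j hj
  have h3 := (size_le_self (loc j)).trans h1.le
  have h4 : (f γ).size ≤ L := (size_le_self _).trans ((hf γ).symm ▸ hs.var j hj)
  rw [← hf] at h2
  simp only [eval_add, eval_mul, eval_X, eval_ofNat]
  refine ⟨by omega, _, ?_, _, Run.assign_stack d _ h ρ cs, fun i hi => ?_, ?_⟩
  · simp only [Expr.cost, Expr.eval, withStack_stack, h2]
    omega
  · simp [hi.ne]
  · simp [Expr.eval, h2]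

theorem Comp.get {x : ℕ} (hx : x ≠ 20) {a : Γ → Mem → ℕ} (ha : Comp a) :
    Comp fun γ h => h x (a γ h) := by
  obtain ⟨p, q, ha⟩ := ha
  refine ⟨fun loc d => .seq (p loc d) (.assign 20 (.const d) (.get x (.get 20 (.const d)))),
    3 * q + 6 * X + 6, ?_⟩
  intro loc d L γ h ρ cs hf hd hs
  have hd' := (size_le_self d).trans hd
  obtain ⟨h1, t, ht, ρ', hr, h2, h3⟩ := ha loc d L γ h ρ cs hf hd hs
  have h4 := hs.size x (a γ h)
  simp only [eval_add, eval_mul, eval_X, eval_ofNat]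
  refine ⟨by omega, _, ?_, _, Run.seq hr (Run.assign_stack d _ h ρ' cs), fun i hi => ?_, ?_⟩
  · simp only [Expr.cost, Expr.eval, withStack_stack, h3, withStack_of_ne hx]
    omega
  · simp [hi.ne, h2 i hi]
  · simp [Expr.eval, h3, withStack_of_ne hx]

theorem Comp.op (o : Op) {a b : Γ → Mem → ℕ} (ha : Comp a) (hb : Comp b) :
    Comp fun γ h => o.eval (a γ h) (b γ h) := by
  obtain ⟨p, q, ha⟩ := ha
  obtain ⟨p', q', hb⟩ := hb
  -- The second operand is evaluated one cell higher, so that the first value in cell `d` survives;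
  -- its polynomial is therefore taken at `L + 1`.
  refine ⟨fun loc d => .seq (p loc d) (.seq (p' loc (d + 1)) (.assign 20 (.const d)
    (.bin o (.get 20 (.const d)) (.get 20 (.const (d + 1)))))),
    (q + 1) * (q'.comp (X + 1) + 1) + 4 * q + 4 * q'.comp (X + 1) + 6 * X + 20, ?_⟩
  intro loc d L γ h ρ cs hf hd hs
  have hd' := (size_le_self d).trans hd
  have hd'' := (size_le_self (d + 1)).trans (Nat.succ_le_succ hd)
  obtain ⟨h1, t, ht, ρ', hr, h2, h3⟩ := ha loc d L γ h ρ cs hf hd hs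
  obtain ⟨h1', t', ht', ρ'', hr', h2', h3'⟩ := hb loc (d + 1) (L + 1) γ h ρ' cs
    (hf.mono (by omega) h2) (by omega) (hs.mono (by omega))
  have h5 := size_eval_le o (a γ h) (b γ h)
  simp only [eval_add, eval_mul, eval_X, eval_ofNat, eval_comp, eval_one]
  have h4 : ((a γ h).size + 1) * ((b γ h).size + 1) ≤ (q.eval L + 1) * (q'.eval (L + 1) + 1) :=
    Nat.mul_le_mul (by omega) (by omega)
  have h6 : ρ'' d = a γ h := (h2' d (by omega)).trans h3
  refine ⟨by omega, _, ?_, _, Run.seq hr (Run.seq hr' (Run.assign_stack d _ h ρ'' cs)),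
    fun i hi => ?_, ?_⟩
  · simp only [Expr.cost, Expr.eval, withStack_stack, h3', h6]
    omega
  · simp [hi.ne, h2 i hi, h2' i (by omega)]
  · simp [Expr.eval, h6, h3']

/-- The same program works in the larger context, since the older variables keep their locations. -/
theorem Comp.wk {f : Γ → Mem → ℕ} (hf : Comp f) : Comp fun (γ : Γ × ℕ) h => f γ.1 h := by
  obtain ⟨p, q, H⟩ := hf
  exact ⟨p, q, fun loc d L γ h ρ cs hf hd hs => H loc d L γ.1 h ρ cs hf.restrict hd hs.restrict⟩

theorem Comp.last : Comp fun (γ : Γ × ℕ) _ => γ.2 :=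
  Comp.of_var (j := Ctx.len Γ) (Nat.lt_succ_self _) fun γ => by
    change _ = (if _ then _ else _)
    rw [if_neg (lt_irrefl _)]

theorem Num.last : Num fun (γ : Γ × ℕ) _ => γ.2 :=
  ⟨X, fun L γ h hs => by simpa using hs.last⟩

theorem Comp.ite_ne_zero {c a b : Γ → Mem → ℕ} (hc : Comp c) (ha : Comp a) (hb : Comp b) :
    Comp fun γ h => if c γ h ≠ 0 then a γ h else b γ h := by
  obtain ⟨p, q, hc⟩ := hc
  obtain ⟨p', q', ha⟩ := ha
  obtain ⟨p'', q'', hb⟩ := hb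
  refine ⟨fun loc d => .seq (p loc d) (.ite (.get 20 (.const d)) (p' loc d) (p'' loc d)),
    2 * q + q' + q'' + 3 * X + 10, ?_⟩
  intro loc d L γ h ρ cs hf hd hs
  have hd' := (size_le_self d).trans hd
  obtain ⟨h1, t, ht, ρ', hr, h2, h3⟩ := hc loc d L γ h ρ cs hf hd hs
  simp only [eval_add, eval_mul, eval_X, eval_ofNat]
  by_cases h0 : c γ h ≠ 0
  · obtain ⟨h1', t', ht', ρ'', hr', h2', h3'⟩ := ha loc d L γ h ρ' cs (hf.mono le_rfl h2) hd hs
    rw [if_pos h0]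
    refine ⟨by omega, _, ?_, _, Run.seq hr (Run.ite_true ?_ hr'),
      fun i hi => (h2' i hi).trans (h2 i hi), h3'⟩
    · simp only [Expr.cost, Expr.eval, withStack_stack, h3]
      omega
    · simpa only [Expr.eval, withStack_stack, h3] using h0
  · obtain ⟨h1', t', ht', ρ'', hr', h2', h3'⟩ := hb loc d L γ h ρ' cs (hf.mono le_rfl h2) hd hs
    rw [if_neg h0]
    refine ⟨by omega, _, ?_, _, Run.seq hr (Run.ite_false ?_ hr'),
      fun i hi => (h2' i hi).trans (h2 i hi), h3'⟩
    · simp only [Expr.cost, Expr.eval, withStack_stack, h3]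
      omega
    · simpa only [Expr.eval, withStack_stack, h3, not_not] using h0

/-- Bounded recursion `G 0 = z`, `G (i + 1) = o (G i) (F i)`. -/
theorem Comp.fold (o : Op) (z : ℕ) {g : Γ → Mem → ℕ} {F : Γ → ℕ → Mem → ℕ}
    {G : ℕ → Γ → Mem → ℕ} (hg : Comp g) (hgn : Num g)
    (hF : Comp fun (γ : Γ × ℕ) h => F γ.1 γ.2 h) (hG0 : ∀ γ h, G 0 γ h = z)
    (hG : ∀ i γ h, G (i + 1) γ h = o.eval (G i γ h) (F γ i h))
    (hsz : ∃ s : ℕ[X], ∀ L γ h, Small L γ h → ∀ i ≤ g γ h, (G i γ h).size ≤ s.eval L) :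
    Comp fun γ h => G (g γ h) γ h := by
  obtain ⟨p, q, hg⟩ := hg
  obtain ⟨r, hgn⟩ := hgn
  obtain ⟨p', q', hF⟩ := hF
  obtain ⟨s, hsz⟩ := hsz
  -- Cell `d` holds the number of iterations, `d + 1` the accumulator, `d + 2` the counter, and `d +
  -- 3` receives the value of `F`.
  refine ⟨fun loc d => .seq (p loc d) (.seq (.assign 20 (.const (d + 1)) (.const z))
    (.seq (.assign 20 (.const (d + 2)) (.const 0))
    (.seq (.loop (.bin .lt (.get 20 (.const (d + 2))) (.get 20 (.const d)))
      (.seq (p' (Function.update loc (Ctx.len Γ) (d + 2)) (d + 3))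
      (.seq (.assign 20 (.const (d + 1)) (.bin o (.get 20 (.const (d + 1)))
          (.get 20 (.const (d + 3)))))
        (.assign 20 (.const (d + 2)) (.bin .add (.get 20 (.const (d + 2))) (.const 1))))))
      (.assign 20 (.const d) (.get 20 (.const (d + 1))))))),
    s + q + (2 * X + 2 * Polynomial.C z.size + 20) + (2 * X + 20) + (r * (((r + 1) * (q + 1) + 10 * X + 4 * r + 4 * q + 60) +
      (q'.comp (X + r + 3) + ((s + 1) * (q'.comp (X + r + 3) + 1) + 20 * X + 4 * s +
        4 * q'.comp (X + r + 3) + (r + 1) * 2 + 6 * r + 150)) + 1) +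
        ((r + 1) * (q + 1) + 10 * X + 4 * r + 4 * q + 61))
       + (10 * X + 4 * s + 60), ?_⟩
  intro loc d L γ h ρ cs hf hd hs
  have z0 := (size_le_self d).trans hd
  have z1 : (d + 1).size ≤ L + 1 := (size_le_self (d + 1)).trans (by omega)
  have z2 : (d + 2).size ≤ L + 2 := (size_le_self (d + 2)).trans (by omega)
  have z3 : (d + 3).size ≤ L + 3 := (size_le_self (d + 3)).trans (by omega)
  obtain ⟨h1, t, ht, ρ1, hr, h2, h3⟩ := hg loc d L γ h ρ cs hf hd hs
  have hgL := hgn L γ h hs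
  have hGs := hsz L γ h hs
  set ρ2 := Function.update (Function.update ρ1 (d + 1) z) (d + 2) 0 with hρ2
  obtain ⟨t', ht', s', hr', ρ', rfl, h4, h5, h6, h7⟩ := Run.loop_iterate
    (e := .bin .lt (.get 20 (.const (d + 2))) (.get 20 (.const d)))
    (p := (.seq (p' (Function.update loc (Ctx.len Γ) (d + 2)) (d + 3))
      (.seq (.assign 20 (.const (d + 1)) (.bin o (.get 20 (.const (d + 1)))
          (.get 20 (.const (d + 3)))))
        (.assign 20 (.const (d + 2)) (.bin .add (.get 20 (.const (d + 2))) (.const 1))))))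
    (C := (r.eval L + 1) * (q.eval L + 1) + 10 * L + 4 * r.eval L + 4 * q.eval L + 60)
    (τ := q'.eval (L + r.eval L + 3) + ((s.eval L + 1) * (q'.eval (L + r.eval L + 3) + 1) +
      20 * L + 4 * s.eval L + 4 * q'.eval (L + r.eval L + 3) + (r.eval L + 1) * 2 + 6 * r.eval L
      + 150)) (g γ h)
    (fun i st => ∃ ρ', st = ⟨withStack h ρ', cs⟩ ∧ (∀ j < d, ρ' j = ρ j) ∧ ρ' d = g γ h ∧
      ρ' (d + 1) = G i γ h ∧ ρ' (d + 2) = i) (by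
        rintro i hi _ ⟨σ, rfl, k1, k2, k3, k4⟩
        have hir : i.size ≤ r.eval L := (size_le_self i).trans (by omega)
        refine ⟨by simp [Expr.eval, Op.eval, k2, k4, hi], ?_, ?_⟩
        · have : (i.size + 1) * ((g γ h).size + 1) ≤ (r.eval L + 1) * (q.eval L + 1) :=
            Nat.mul_le_mul (by omega) (by omega)
          simp only [Expr.eval, Expr.cost, withStack_stack, k2, k4]
          omega
        -- The body is run with the bound `L + r.eval L + 3`: its new variable, the counter, can be
        -- as large as `r.eval L`, and its stack starts three cells higher.
        · obtain ⟨m1, τ, hτ, σ', hσ, m2, m3⟩ := hF (Function.update loc (Ctx.len Γ) (d + 2)) (d + 3)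
            (L + r.eval L + 3) (γ, i) h σ cs (hf.extend (by omega) (by omega) k1 k4)
            (by omega) ((hs.mono (by omega)).extend (by omega))
          dsimp only at m1 m3
          have n1 : σ' (d + 1) = G i γ h := (m2 _ (by omega)).trans k3
          have n2 : σ' (d + 2) = i := (m2 _ (by omega)).trans k4
          have n3 : σ' d = g γ h := (m2 _ (by omega)).trans k2
          have n4 := hGs i (by omega)
          have n5 := hGs (i + 1) (by omega)
          rw [hG] at n5
          have n6 : ((G i γ h).size + 1) * ((F γ i h).size + 1) ≤
              (s.eval L + 1) * (q'.eval (L + r.eval L + 3) + 1) :=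
            Nat.mul_le_mul (by omega) (by omega)
          have n7 : (i + 1).size ≤ r.eval L + 1 := (size_le_self _).trans (by omega)
          have n8 : Op.eval .add i 1 = i + 1 := rfl
          refine ⟨_, ?_, _, Run.seq hσ (Run.seq (Run.assign_stack (d + 1) _ h σ' cs)
            (Run.assign_stack (d + 2) _ h _ cs)), _, rfl, ?_, ?_, ?_, ?_⟩
          · simp only [Expr.eval, Expr.cost, withStack_stack, n1, n2, m3, n8, Nat.size_one,
              Function.update_of_ne (show d + 2 ≠ d + 1 by omega)]
            omega
          · intro j hj
            rw [Function.update_of_ne (by omega), Function.update_of_ne (by omega),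
              m2 j (by omega), k1 j hj]
          · rw [Function.update_of_ne (by omega), Function.update_of_ne (by omega), n3]
          · simp [Expr.eval, hG, n1, m3]
          · simp [Expr.eval, Op.eval, n2])
      (by
        rintro _ ⟨σ, rfl, k1, k2, k3, k4⟩
        refine ⟨by simp [Expr.eval, Op.eval, k2, k4], ?_⟩
        have hir : (g γ h).size ≤ r.eval L := (size_le_self _).trans (by omega)
        have : ((g γ h).size + 1) * ((g γ h).size + 1) ≤ (r.eval L + 1) * (q.eval L + 1) :=
          Nat.mul_le_mul (by omega) (by omega)
        simp only [Expr.eval, Expr.cost, withStack_stack, k2, k4]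
        omega)
      (s := ⟨withStack h ρ2, cs⟩) ⟨ρ2, rfl, fun j hj => by
        rw [hρ2, Function.update_of_ne (by omega), Function.update_of_ne (by omega), h2 j hj], by
        rw [hρ2, Function.update_of_ne (by omega), Function.update_of_ne (by omega), h3], by
        simp [hρ2, hG0], by simp [hρ2]⟩
  have hGf := hGs (g γ h) le_rfl
  have hmul : g γ h * (((r.eval L + 1) * (q.eval L + 1) + 10 * L + 4 * r.eval L + 4 * q.eval L + 60)
      + (q'.eval (L + r.eval L + 3) + ((s.eval L + 1) * (q'.eval (L + r.eval L + 3) + 1) +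
      20 * L + 4 * s.eval L + 4 * q'.eval (L + r.eval L + 3) + (r.eval L + 1) * 2 + 6 * r.eval L
      + 150)) + 1) ≤ r.eval L * (((r.eval L + 1) * (q.eval L + 1) + 10 * L + 4 * r.eval L +
        4 * q.eval L + 60)
      + (q'.eval (L + r.eval L + 3) + ((s.eval L + 1) * (q'.eval (L + r.eval L + 3) + 1) +
      20 * L + 4 * s.eval L + 4 * q'.eval (L + r.eval L + 3) + (r.eval L + 1) * 2 + 6 * r.eval L
      + 150)) + 1) := Nat.mul_le_mul_right _ hgL
  have ht'' := ht'.trans (Nat.add_le_add_right hmul _)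
  simp only [eval_add, eval_mul, eval_X, eval_ofNat, eval_comp, eval_one, eval_C]
  refine ⟨by omega, _, ?_, _, Run.seq hr (Run.seq (Run.assign_stack (d + 1) (.const z) h ρ1 cs)
    (Run.seq (Run.assign_stack (d + 2) (.const 0) h _ cs) (Run.seq hr'
      (Run.assign_stack d (.get 20 (.const (d + 1))) h ρ' cs)))), ?_, ?_⟩
  · simp only [Expr.cost, Expr.eval, withStack_stack, h6, Nat.size_zero]
    omega
  · intro i hi
    rw [Function.update_of_ne hi.ne, h4 i hi]
  · simp [Expr.eval, h6]

end
end CutCount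

/-! ### Bounded sums and products, powers, binary length -/

namespace CutCount
open Finset Polynomial

section
variable {Γ : Type} [Ctx Γ]

theorem Comp.congr {f g : Γ → Mem → ℕ} (hf : Comp f) (h : ∀ γ m, g γ m = f γ m) : Comp g := by
  obtain rfl : g = f := by
    funext γ m
    exact h γ m
  exact hf

/-- The bound on the length inside `Comp` presupposes a frame. Storing variable `i` in cell `i` is
one, at the price of raising `L` by the number of variables. -/
theorem Comp.size_le {f : Γ → Mem → ℕ} (hf : Comp f) :
    ∃ q : ℕ[X], ∀ L γ h, Small L γ h → (f γ h).size ≤ q.eval L := by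
  obtain ⟨p, q, H⟩ := hf
  refine ⟨q.comp (X + Polynomial.C (Ctx.len Γ)), fun L γ h hs => ?_⟩
  have := (H id (Ctx.len Γ) (L + Ctx.len Γ) γ h (Ctx.val γ) [] (fun i hi => ⟨hi, rfl⟩) (by omega)
    (hs.mono (by omega))).1
  simpa [eval_comp] using this

theorem Num.of_le {f g : Γ → Mem → ℕ} (hf : Num f) (h : ∀ γ m, g γ m ≤ f γ m) : Num g := by
  obtain ⟨q, H⟩ := hf
  exact ⟨q, fun L γ m hs => (h γ m).trans (H L γ m hs)⟩

theorem Num.const (c : ℕ) : Num fun (_ : Γ) _ => c :=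
  ⟨Polynomial.C c, fun L γ h _ => by simp⟩

theorem Num.input {i : ℕ} (hi : i < 3) : Num fun (_ : Γ) h => h 1 i :=
  ⟨X, fun L γ h hs => by simpa using hs.input i hi⟩

theorem Num.reg (a : Γ → Mem → ℕ) : Num fun (γ : Γ) h => h 8 (a γ h) :=
  ⟨X, fun L γ h hs => by simpa using hs.reg _⟩

theorem Num.add {a b : Γ → Mem → ℕ} (ha : Num a) (hb : Num b) : Num fun γ h => a γ h + b γ h := by
  obtain ⟨q, ha⟩ := ha
  obtain ⟨r, hb⟩ := hb
  exact ⟨q + r, fun L γ h hs => by simpa using Nat.add_le_add (ha L γ h hs) (hb L γ h hs)⟩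

theorem Num.mul {a b : Γ → Mem → ℕ} (ha : Num a) (hb : Num b) : Num fun γ h => a γ h * b γ h := by
  obtain ⟨q, ha⟩ := ha
  obtain ⟨r, hb⟩ := hb
  exact ⟨q * r, fun L γ h hs => by simpa using Nat.mul_le_mul (ha L γ h hs) (hb L γ h hs)⟩

theorem Num.size {f : Γ → Mem → ℕ} (hf : Comp f) : Num fun γ h => (f γ h).size := hf.size_le

theorem Comp.add {a b : Γ → Mem → ℕ} (ha : Comp a) (hb : Comp b) :
    Comp fun γ h => a γ h + b γ h := Comp.op .add ha hb

theorem Comp.sub {a b : Γ → Mem → ℕ} (ha : Comp a) (hb : Comp b) :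
    Comp fun γ h => a γ h - b γ h := Comp.op .sub ha hb

theorem Comp.mul {a b : Γ → Mem → ℕ} (ha : Comp a) (hb : Comp b) :
    Comp fun γ h => a γ h * b γ h := Comp.op .mul ha hb

theorem Comp.div {a b : Γ → Mem → ℕ} (ha : Comp a) (hb : Comp b) :
    Comp fun γ h => a γ h / b γ h := Comp.op .div ha hb

theorem Comp.mod {a b : Γ → Mem → ℕ} (ha : Comp a) (hb : Comp b) :
    Comp fun γ h => a γ h % b γ h := Comp.op .mod ha hb

theorem Comp.sum {g : Γ → Mem → ℕ} {F : Γ → ℕ → Mem → ℕ} (hg : Comp g) (hgn : Num g)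
    (hF : Comp fun (γ : Γ × ℕ) h => F γ.1 γ.2 h) :
    Comp fun γ h => ∑ i ∈ range (g γ h), F γ i h := by
  refine Comp.fold .add 0 (G := fun k γ h => ∑ i ∈ range k, F γ i h) hg hgn hF (by simp)
    (fun i γ h => sum_range_succ _ _) ?_
  obtain ⟨q, hq⟩ := hF.size_le
  obtain ⟨r, hr⟩ := hgn
  refine ⟨q.comp (X + r) + r, fun L γ h hs i hi => ?_⟩
  have hi' := hi.trans (hr L γ h hs)
  -- `Comp.fold` needs short intermediate values: each new summand is below `2 ^ Q`, hence at most
  -- doubles the bound `2 ^ (Q + j)`.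
  have key : ∀ j ≤ i, ∑ k ∈ range j, F γ k h < 2 ^ (q.eval (L + r.eval L) + j) := by
    intro j
    induction j with
    | zero => simp
    | succ j ih =>
      intro hj
      rw [sum_range_succ, ← add_assoc, pow_succ]
      have h1 := ih (by omega)
      have h2 := Nat.size_le.1 (hq (L + r.eval L) (γ, j) h
        ((hs.mono (by omega)).extend (by omega)))
      have h3 : 2 ^ q.eval (L + r.eval L) ≤ 2 ^ (q.eval (L + r.eval L) + j) :=
        Nat.pow_le_pow_right (by norm_num) (by omega)
      dsimp only at h2
      omega
  refine (Nat.size_le.2 (key i le_rfl)).trans ?_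
  simp only [eval_add, eval_comp, eval_X]
  omega

theorem Comp.prod {g : Γ → Mem → ℕ} {F : Γ → ℕ → Mem → ℕ} (hg : Comp g) (hgn : Num g)
    (hF : Comp fun (γ : Γ × ℕ) h => F γ.1 γ.2 h) :
    Comp fun γ h => ∏ i ∈ range (g γ h), F γ i h := by
  refine Comp.fold .mul 1 (G := fun k γ h => ∏ i ∈ range k, F γ i h) hg hgn hF (by simp)
    (fun i γ h => prod_range_succ _ _) ?_
  obtain ⟨q, hq⟩ := hF.size_le
  obtain ⟨r, hr⟩ := hgn
  refine ⟨r * q.comp (X + r) + 1, fun L γ h hs i hi => ?_⟩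
  have hi' := hi.trans (hr L γ h hs)
  -- Lengths add up under multiplication, so polynomially many factors of polynomial length are
  -- allowed.
  have key : ∀ j ≤ i, (∏ k ∈ range j, F γ k h).size ≤ j * q.eval (L + r.eval L) + 1 := by
    intro j
    induction j with
    | zero => simp
    | succ j ih =>
      intro hj
      rw [prod_range_succ, Nat.succ_mul]
      have h1 := ih (by omega)
      have h2 := hq (L + r.eval L) (γ, j) h ((hs.mono (by omega)).extend (by omega))
      have h3 := size_mul_le (∏ k ∈ range j, F γ k h) (F γ j h)
      dsimp only at h2
      omega
  refine (key i le_rfl).trans ?_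
  simp only [eval_add, eval_mul, eval_comp, eval_X, eval_one]
  exact Nat.succ_le_succ (Nat.mul_le_mul_right _ hi')

/-- The exponent is a number of iterations, so its value and not only its length has to be
polynomially bounded. -/
theorem Comp.pow {a b : Γ → Mem → ℕ} (ha : Comp a) (hb : Comp b) (hbn : Num b) :
    Comp fun γ h => a γ h ^ b γ h :=
  (Comp.prod (F := fun γ _ h => a γ h) hb hbn ha.wk).congr fun γ h => by simp

/-- Halve the number until it is zero: the number of steps is the length to be computed, and it is
polynomially bounded. -/
theorem Comp.size {a : Γ → Mem → ℕ} (ha : Comp a) : Comp fun γ h => (a γ h).size := by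
  obtain ⟨p, q, ha⟩ := ha
  refine ⟨fun loc d => .seq (p loc d) (.seq (.assign 20 (.const (d + 1)) (.const 0))
    (.seq (.loop (.get 20 (.const d))
      (.seq (.assign 20 (.const d) (.bin .div (.get 20 (.const d)) (.const 2)))
        (.assign 20 (.const (d + 1)) (.bin .add (.get 20 (.const (d + 1))) (.const 1)))))
      (.assign 20 (.const d) (.get 20 (.const (d + 1)))))),
    q + (2 * X + 20) + (q * ((2 * X + q + 10) + (20 * X + 20 * q + 100) + 1)
      + (2 * X + q + 11)) + (10 * X + 3 * q + 60), ?_⟩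
  intro loc d L γ h ρ cs hf hd hs
  have z0 := (size_le_self d).trans hd
  have z1 : (d + 1).size ≤ L + 1 := (size_le_self (d + 1)).trans (by omega)
  obtain ⟨h1, t, ht, ρ1, hr, h2, h3⟩ := ha loc d L γ h ρ cs hf hd hs
  set A := a γ h with hA
  have hsz2 : Nat.size 2 = 2 := by decide
  obtain ⟨t', ht', s', hr', ρ', rfl, h4, h5, h6⟩ := Run.loop_iterate
    (e := .get 20 (.const d))
    (p := (.seq (.assign 20 (.const d) (.bin .div (.get 20 (.const d)) (.const 2)))
        (.assign 20 (.const (d + 1)) (.bin .add (.get 20 (.const (d + 1))) (.const 1)))))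
    (C := 2 * L + q.eval L + 10) (τ := 20 * L + 20 * q.eval L + 100) A.size
    (fun i st => ∃ ρ', st = ⟨withStack h ρ', cs⟩ ∧ (∀ j < d, ρ' j = ρ j) ∧ ρ' d = A / 2 ^ i ∧
      ρ' (d + 1) = i) (by
        rintro i hi _ ⟨σ, rfl, k1, k2, k3⟩
        have hir : i.size ≤ q.eval L := (size_le_self i).trans (by omega)
        have n1 : (A / 2 ^ i).size ≤ q.eval L := (Nat.size_le_size (Nat.div_le_self _ _)).trans h1
        have n2 : (A / 2 ^ i / 2).size ≤ q.eval L :=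
          (Nat.size_le_size (Nat.div_le_self _ _)).trans n1
        have n3 : (i + 1).size ≤ q.eval L + 1 := (size_le_self _).trans (by omega)
        have n4 : Op.eval .add i 1 = i + 1 := rfl
        have n5 : Op.eval .div (A / 2 ^ i) 2 = A / 2 ^ i / 2 := rfl
        refine ⟨?_, ?_, _, ?_, _, Run.seq (Run.assign_stack d _ h σ cs)
          (Run.assign_stack (d + 1) _ h _ cs), _, rfl, ?_, ?_, ?_⟩
        · have := Nat.lt_size.1 hi
          simp only [Expr.eval, withStack_stack, k2]
          exact (Nat.div_pos this (by positivity)).ne'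
        · simp only [Expr.eval, Expr.cost, withStack_stack, k2]
          omega
        · simp only [Expr.eval, Expr.cost, withStack_stack, k2, k3, n4, n5, hsz2, Nat.size_one,
            Function.update_of_ne (show d + 1 ≠ d by omega)]
          omega
        · intro j hj
          rw [Function.update_of_ne (by omega), Function.update_of_ne (by omega), k1 j hj]
        · simp only [Expr.eval, withStack_stack, k2, n5,
            Function.update_of_ne (show d ≠ d + 1 by omega), Function.update_self]
          rw [Nat.div_div_eq_div_mul, pow_succ]
        · simp [Expr.eval, Op.eval, k3])
      (by
        rintro _ ⟨σ, rfl, k1, k2, k3⟩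
        have : A / 2 ^ A.size = 0 := Nat.div_eq_of_lt (Nat.lt_size_self _)
        refine ⟨by simp [Expr.eval, k2, this], ?_⟩
        simp only [Expr.eval, Expr.cost, withStack_stack, k2, this, Nat.size_zero]
        omega)
      (s := ⟨withStack h (Function.update ρ1 (d + 1) 0), cs⟩) ⟨_, rfl, fun j hj => by
        rw [Function.update_of_ne (by omega), h2 j hj], by
        rw [Function.update_of_ne (by omega), h3]; simp, by simp⟩
  have hmul := Nat.mul_le_mul_right ((2 * L + q.eval L + 10) + (20 * L + 20 * q.eval L + 100) + 1) h1
  have h7 := size_le_self A.size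
  have ht'' := ht'.trans (Nat.add_le_add_right hmul _)
  simp only [eval_add, eval_mul, eval_X, eval_ofNat, eval_one]
  refine ⟨show A.size.size ≤ _ by omega, _, ?_, _,
    Run.seq hr (Run.seq (Run.assign_stack (d + 1) (.const 0) h ρ1 cs) (Run.seq hr' (Run.assign_stack d (.get 20 (.const (d + 1))) h ρ' cs))), ?_, ?_⟩
  · simp only [Expr.cost, Expr.eval, withStack_stack, h6, Nat.size_zero]
    omega
  · intro i hi
    rw [Function.update_of_ne hi.ne, h4 i hi]
  · simp [Expr.eval, h6, hA]

/-! ### Conditions -/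

open Classical in
/-- A condition that can be decided in polynomial time. -/
def CompP (P : Γ → Mem → Prop) : Prop := Comp fun γ h => if P γ h then 1 else 0

theorem CompP.congr {P Q : Γ → Mem → Prop} (hP : CompP P) (h : ∀ γ m, Q γ m ↔ P γ m) :
    CompP Q := by
  obtain rfl : Q = P := by
    funext γ m
    exact propext (h γ m)
  exact hP

theorem Comp.ite {P : Γ → Mem → Prop} [∀ γ h, Decidable (P γ h)] {a b : Γ → Mem → ℕ}
    (hP : CompP P) (ha : Comp a) (hb : Comp b) :
    Comp fun γ h => if P γ h then a γ h else b γ h :=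
  (Comp.ite_ne_zero hP ha hb).congr fun γ h => by
    by_cases hp : P γ h <;> simp [hp]

theorem CompP.of_ite {P : Γ → Mem → Prop} [∀ γ h, Decidable (P γ h)]
    (hP : Comp fun γ h => if P γ h then 1 else 0) : CompP P :=
  hP.congr fun γ h => by split_ifs <;> rfl

theorem CompP.lt {a b : Γ → Mem → ℕ} (ha : Comp a) (hb : Comp b) :
    CompP fun γ h => a γ h < b γ h := CompP.of_ite (Comp.op .lt ha hb)

theorem CompP.eq {a b : Γ → Mem → ℕ} (ha : Comp a) (hb : Comp b) :
    CompP fun γ h => a γ h = b γ h := CompP.of_ite (Comp.op .eq ha hb)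

theorem CompP.not {P : Γ → Mem → Prop} (hP : CompP P) : CompP fun γ h => ¬ P γ h := by
  classical
  exact CompP.of_ite ((Comp.ite hP (Comp.const 0) (Comp.const 1)).congr fun γ h => by
    by_cases hp : P γ h <;> simp [hp])

theorem CompP.le {a b : Γ → Mem → ℕ} (ha : Comp a) (hb : Comp b) :
    CompP fun γ h => a γ h ≤ b γ h := (CompP.lt hb ha).not.congr fun _ _ => not_lt.symm

theorem CompP.and {P Q : Γ → Mem → Prop} (hP : CompP P) (hQ : CompP Q) :
    CompP fun γ h => P γ h ∧ Q γ h := by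
  classical
  exact CompP.of_ite ((Comp.ite hP (Comp.ite hQ (Comp.const 1) (Comp.const 0))
    (Comp.const 0)).congr fun γ h => by
      by_cases hp : P γ h <;> by_cases hq : Q γ h <;> simp [hp, hq])

theorem CompP.or {P Q : Γ → Mem → Prop} (hP : CompP P) (hQ : CompP Q) :
    CompP fun γ h => P γ h ∨ Q γ h :=
  (hP.not.and hQ.not).not.congr fun γ h => by tauto

/-- A bounded universal quantifier is a product of zeros and ones. -/
theorem CompP.ball {g : Γ → Mem → ℕ} {P : Γ → ℕ → Mem → Prop} (hg : Comp g) (hgn : Num g)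
    (hP : CompP fun (γ : Γ × ℕ) h => P γ.1 γ.2 h) :
    CompP fun γ h => ∀ i < g γ h, P γ i h := by
  classical
  refine CompP.of_ite ((Comp.prod (F := fun γ i h => if P γ i h then 1 else 0) hg hgn hP).congr ?_)
  intro γ h
  by_cases H : ∀ i < g γ h, P γ i h
  · rw [if_pos H, prod_eq_one]
    intro i hi
    rw [if_pos (H i (mem_range.1 hi))]
  · rw [if_neg H]
    push Not at H
    obtain ⟨i, hi, hi'⟩ := H
    exact (prod_eq_zero (mem_range.2 hi) (by rw [if_neg hi'])).symm

/-! ### Transformations of the memory -/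

/-- Run `F 0, …, F (n - 1)` one after the other. -/
def floop (F : ℕ → Mem → Mem) : ℕ → Mem → Mem
  | 0, h => h
  | n + 1, h => F n (floop F n h)

/-- `F` is carried out by a program in time `(K + 1) ^ lev` times a polynomial in `L`, where `K` is
the number in cell `1` of array `9`; arrays `1`, `8`, `9` are not changed and the memory
stays small. -/
def CompS (lev : ℕ) (F : Γ → Mem → Mem) : Prop :=
  (∀ γ h, F γ h 1 = h 1 ∧ F γ h 8 = h 8 ∧ F γ h 9 = h 9) ∧
  (∀ γ h s, (∀ x i, (h x i).size ≤ s) → ∀ x i, (F γ h x i).size ≤ s) ∧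
  ∃ (p : (ℕ → ℕ) → ℕ → Prog) (q : ℕ[X]), ∀ loc d L γ h ρ cs, Frame loc d γ ρ → d ≤ L →
    Small L γ h → ∃ t ≤ (h 9 1 + 1) ^ lev * q.eval L, ∃ ρ',
      Run (p loc d) ⟨withStack h ρ, cs⟩ t ⟨withStack (F γ h) ρ', cs⟩ ∧ ∀ i < d, ρ' i = ρ i

/-- The bound after the transformation is the same `L` as before. This exact preservation, rather
than polynomial growth, is what allows loops of exponential length. -/
theorem Small.of_protected {L : ℕ} {γ : Γ} {h h' : Mem} (hs : Small L γ h)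
    (h1 : h' 1 = h 1 ∧ h' 8 = h 8 ∧ h' 9 = h 9)
    (h2 : ∀ s, (∀ x i, (h x i).size ≤ s) → ∀ x i, (h' x i).size ≤ s) : Small L γ h' :=
  ⟨h2 L hs.size, hs.var, fun i hi => h1.1 ▸ hs.input i hi, fun i => h1.2.1 ▸ hs.reg i⟩

theorem CompS.up {lev lev' : ℕ} {F : Γ → Mem → Mem} (hF : CompS lev F) (hl : lev ≤ lev') :
    CompS lev' F := by
  obtain ⟨h1, h2, p, q, H⟩ := hF
  refine ⟨h1, h2, p, q, fun loc d L γ h ρ cs hf hd hs => ?_⟩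
  obtain ⟨t, ht, R⟩ := H loc d L γ h ρ cs hf hd hs
  exact ⟨t, ht.trans (Nat.mul_le_mul_right _ (Nat.pow_le_pow_right (by omega) hl)), R⟩

theorem CompS.skip : CompS 0 fun (_ : Γ) h => h :=
  ⟨fun _ _ => ⟨rfl, rfl, rfl⟩, fun _ _ _ h => h, fun _ _ => .skip, 1,
    fun loc d L γ h ρ cs _ _ _ => ⟨1, by simp, ρ, Run.skip _, fun _ _ => rfl⟩⟩

theorem CompS.seq {lev : ℕ} {F G : Γ → Mem → Mem} (hF : CompS lev F) (hG : CompS lev G) :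
    CompS lev fun γ h => G γ (F γ h) := by
  obtain ⟨f1, f2, p, q, hF⟩ := hF
  obtain ⟨g1, g2, p', q', hG⟩ := hG
  refine ⟨fun γ h => ⟨(g1 _ _).1.trans (f1 _ _).1, (g1 _ _).2.1.trans (f1 _ _).2.1,
    (g1 _ _).2.2.trans (f1 _ _).2.2⟩, fun γ h s hs => g2 _ _ s (f2 _ _ s hs),
    fun loc d => .seq (p loc d) (p' loc d), q + q', ?_⟩
  intro loc d L γ h ρ cs hf hd hs
  obtain ⟨t, ht, ρ', hr, h1⟩ := hF loc d L γ h ρ cs hf hd hs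
  obtain ⟨t', ht', ρ'', hr', h1'⟩ := hG loc d L γ _ ρ' cs (hf.mono le_rfl h1) hd
    (hs.of_protected (f1 γ h) (f2 γ h))
  rw [(f1 γ h).2.2] at ht'
  refine ⟨_, ?_, _, Run.seq hr hr', fun i hi => (h1' i hi).trans (h1 i hi)⟩
  rw [eval_add, mul_add]
  omega

theorem CompS.ite {lev : ℕ} {P : Γ → Mem → Prop} [∀ γ h, Decidable (P γ h)] {F G : Γ → Mem → Mem}
    (hP : CompP P) (hF : CompS lev F) (hG : CompS lev G) :
    CompS lev fun γ h => if P γ h then F γ h else G γ h := by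
  obtain ⟨f1, f2, p, q, hF⟩ := hF
  obtain ⟨g1, g2, p', q', hG⟩ := hG
  obtain ⟨pc, qc, hP⟩ := hP
  refine ⟨fun γ h => ?_, fun γ h s hs => ?_,
    fun loc d => .seq (pc loc d) (.ite (.get 20 (.const d)) (p loc d) (p' loc d)),
    2 * qc + q + q' + 3 * X + 10, ?_⟩
  · dsimp only
    split_ifs
    exacts [f1 γ h, g1 γ h]
  · dsimp only
    split_ifs
    exacts [f2 γ h s hs, g2 γ h s hs]
  intro loc d L γ h ρ cs hf hd hs
  have hd' := (size_le_self d).trans hd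
  obtain ⟨h1, t, ht, ρ', hr, h2, h3⟩ := hP loc d L γ h ρ cs hf hd hs
  have hK : 1 ≤ (h 9 1 + 1) ^ lev := Nat.one_le_pow _ _ (by omega)
  have hov : 2 * qc.eval L + 3 * L + 10 ≤ (h 9 1 + 1) ^ lev * (2 * qc.eval L + 3 * L + 10) :=
    Nat.le_mul_of_pos_left _ hK
  have hsplit : ∀ Q Q' : ℕ, (h 9 1 + 1) ^ lev * (2 * qc.eval L + Q + Q' + 3 * L + 10) =
      (h 9 1 + 1) ^ lev * (2 * qc.eval L + 3 * L + 10) + (h 9 1 + 1) ^ lev * Q +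
        (h 9 1 + 1) ^ lev * Q' := fun Q Q' => by ring
  simp only [eval_add, eval_mul, eval_X, eval_ofNat, hsplit]
  by_cases h0 : P γ h
  · obtain ⟨t', ht', ρ'', hr', h2'⟩ := hF loc d L γ h ρ' cs (hf.mono le_rfl h2) hd hs
    simp only [if_pos h0] at h3 h1 ⊢
    refine ⟨_, ?_, _, Run.seq hr (Run.ite_true ?_ hr'), fun i hi => (h2' i hi).trans (h2 i hi)⟩
    · simp only [Expr.cost, Expr.eval, withStack_stack, h3]
      omega
    · simp [Expr.eval, h3]
  · obtain ⟨t', ht', ρ'', hr', h2'⟩ := hG loc d L γ h ρ' cs (hf.mono le_rfl h2) hd hs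
    simp only [if_neg h0] at h3 h1 ⊢
    refine ⟨_, ?_, _, Run.seq hr (Run.ite_false ?_ hr'), fun i hi => (h2' i hi).trans (h2 i hi)⟩
    · simp only [Expr.cost, Expr.eval, withStack_stack, h3]
      omega
    · simp [Expr.eval, h3]

/-- Write a number, reduced modulo the modulus which array `9` provides, to an array. -/
theorem CompS.write {x : ℕ} (hx : x ≠ 1 ∧ x ≠ 8 ∧ x ≠ 9 ∧ x ≠ 20) {a b : Γ → Mem → ℕ}
    (ha : Comp a) (hb : Comp b) :
    CompS 0 fun γ h => h.set x (a γ h) (b γ h % (h 9 0 + 1)) := by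
  obtain ⟨pa, qa, ha⟩ := ha
  obtain ⟨pb, qb, hb⟩ := (hb.mod ((Comp.get (x := 9) (by decide) (Comp.const 0)).add (Comp.const 1)))
  refine ⟨fun γ h => ⟨?_, ?_, ?_⟩, fun γ h s hs y i => ?_,
    fun loc d => .seq (pa loc d) (.seq (pb loc (d + 1)) (.assign x (.get 20 (.const d))
      (.get 20 (.const (d + 1))))), 6 * qa + 6 * qb.comp (X + 1) + 12 * X + 30, ?_⟩
  · exact Mem.set_of_ne _ _ _ hx.1.symm
  · exact Mem.set_of_ne _ _ _ hx.2.1.symm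
  · exact Mem.set_of_ne _ _ _ hx.2.2.1.symm
  · dsimp only
    rw [Mem.set_apply]
    split_ifs
    -- The remainder is at most the number in cell `0` of array `9`, which is stored in memory
    -- already and so obeys the bound.
    · exact size_le_of_le_of_size (Nat.lt_succ_iff.1 (Nat.mod_lt _ (Nat.succ_pos _))) (hs 9 0)
    · exact hs y i
  · intro loc d L γ h ρ cs hf hd hs
    have z0 := (size_le_self d).trans hd
    have z1 : (d + 1).size ≤ L + 1 := (size_le_self (d + 1)).trans (by omega)
    obtain ⟨h1, t, ht, ρ', hr, h2, h3⟩ := ha loc d L γ h ρ cs hf hd hs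
    obtain ⟨h1', t', ht', ρ'', hr', h2', h3'⟩ := hb loc (d + 1) (L + 1) γ h ρ' cs
      (hf.mono (by omega) h2) (by omega) (hs.mono (by omega))
    have h6 : ρ'' d = a γ h := (h2' d (by omega)).trans h3
    dsimp only at h1' h3'
    have hr'' := Run.assign x (.get 20 (.const d)) (.get 20 (.const (d + 1)))
      ⟨withStack h ρ'', cs⟩
    simp only [Expr.eval, withStack_stack, h6, h3', withStack_set hx.2.2.2] at hr''
    refine ⟨_, ?_, _, Run.seq hr (Run.seq hr' hr''), fun i hi => (h2' i (by omega)).trans (h2 i hi)⟩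
    simp only [eval_add, eval_mul, eval_X, eval_ofNat, eval_comp, eval_one, pow_zero, one_mul]
    simp only [Expr.cost, Expr.eval, withStack_stack, h6, h3']
    omega

theorem floop_protected {F : ℕ → Mem → Mem}
    (hF : ∀ i h, F i h 1 = h 1 ∧ F i h 8 = h 8 ∧ F i h 9 = h 9) (n : ℕ) (h : Mem) :
    floop F n h 1 = h 1 ∧ floop F n h 8 = h 8 ∧ floop F n h 9 = h 9 := by
  induction n with
  | zero => exact ⟨rfl, rfl, rfl⟩
  | succ n ih => exact ⟨(hF _ _).1.trans ih.1, (hF _ _).2.1.trans ih.2.1, (hF _ _).2.2.trans ih.2.2⟩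

theorem floop_size {F : ℕ → Mem → Mem} {n s : ℕ}
    (hF : ∀ i < n, ∀ h, (∀ x i, (h x i).size ≤ s) → ∀ x j, (F i h x j).size ≤ s) (h : Mem)
    (hs : ∀ x i, (h x i).size ≤ s) : ∀ k ≤ n, ∀ x i, (floop F k h x i).size ≤ s
  | 0, _ => hs
  | k + 1, hk => hF k (by omega) _ (floop_size hF h hs k (by omega))

/-- Overheads without the factor `K ≥ 1` are absorbed into it: a loop whose body takes time `Q * K +
C` again takes `K` times a polynomial. -/
theorem loop_time {K A r C Q m t : ℕ} (hK : 1 ≤ K) (hm : m ≤ r)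
    (ht : t ≤ A + (m * (C + (Q * K + C) + 1) + (C + 1))) :
    t ≤ K * (A + (r * (C + (Q + C) + 1) + (C + 1))) := by
  have h1 : m * (C + (Q * K + C) + 1) ≤ r * (C + (Q * K + C) + 1) := Nat.mul_le_mul_right _ hm
  obtain ⟨k, rfl⟩ : ∃ k, K = k + 1 := ⟨K - 1, by omega⟩
  have h2 : (k + 1) * (A + (r * (C + (Q + C) + 1) + (C + 1))) =
      A + (r * (C + (Q * (k + 1) + C) + 1) + (C + 1)) +
      k * (A + r * (C + C + 1) + (C + 1)) := by ring
  rw [h2]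
  exact (ht.trans (by omega)).trans (Nat.le_add_right _ _)

/-- Loops with a polynomial number of iterations. -/
theorem CompS.loop {lev : ℕ} {g : Γ → Mem → ℕ} {F : Γ → ℕ → Mem → Mem} (hg : Comp g)
    (hgn : Num g) (hF : CompS lev fun (γ : Γ × ℕ) h => F γ.1 γ.2 h) :
    CompS lev fun γ h => floop (F γ) (g γ h) h := by
  obtain ⟨f1, f2, p', q', hF⟩ := hF
  obtain ⟨p, q, hg⟩ := hg
  obtain ⟨r, hgn⟩ := hgn
  have e1 : ∀ γ n h, floop (F γ) n h 1 = h 1 ∧ floop (F γ) n h 8 = h 8 ∧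
      floop (F γ) n h 9 = h 9 := fun γ n h => floop_protected (fun i h => f1 (γ, i) h) n h
  have e2 : ∀ γ n h s, (∀ x i, (h x i).size ≤ s) → ∀ x i, (floop (F γ) n h x i).size ≤ s :=
    fun γ n h s hs => floop_size (fun i _ h hs => f2 (γ, i) h s hs) h hs n le_rfl
  let B : ℕ[X] := (r + 1) * (q + 1) + 20 * X + 10 * r + 10 * q + 100
  refine ⟨fun γ h => e1 γ _ h, fun γ h s hs => e2 γ _ h s hs,
    fun loc d => .seq (p loc d) (.seq (.assign 20 (.const (d + 1)) (.const 0))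
      (.loop (.bin .lt (.get 20 (.const (d + 1))) (.get 20 (.const d)))
      (.seq (p' (Function.update loc (Ctx.len Γ) (d + 1)) (d + 2))
        (.assign 20 (.const (d + 1)) (.bin .add (.get 20 (.const (d + 1))) (.const 1)))))),
    (q + (2 * X + 20)) + (r * (B + (q'.comp (X + r + 2) + B) + 1) + (B + 1)), ?_⟩
  intro loc d L γ h ρ cs hf hd hs
  have hB : B.eval L = (r.eval L + 1) * (q.eval L + 1) + 20 * L + 10 * r.eval L + 10 * q.eval L
      + 100 := by simp [B]
  have z0 := (size_le_self d).trans hd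
  have z1 : (d + 1).size ≤ L + 1 := (size_le_self (d + 1)).trans (by omega)
  obtain ⟨h1, t, ht, ρ1, hr, h2, h3⟩ := hg loc d L γ h ρ cs hf hd hs
  have hgL := hgn L γ h hs
  obtain ⟨t', ht', s', hr', ρ', rfl, h4, h5, h6⟩ := Run.loop_iterate
    (e := .bin .lt (.get 20 (.const (d + 1))) (.get 20 (.const d)))
    (p := (.seq (p' (Function.update loc (Ctx.len Γ) (d + 1)) (d + 2))
        (.assign 20 (.const (d + 1)) (.bin .add (.get 20 (.const (d + 1))) (.const 1)))))
    (C := B.eval L) (τ := q'.eval (L + r.eval L + 2) * (h 9 1 + 1) ^ lev + B.eval L) (g γ h)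
    (fun i st => ∃ ρ', st = ⟨withStack (floop (F γ) i h) ρ', cs⟩ ∧ (∀ j < d, ρ' j = ρ j) ∧
      ρ' d = g γ h ∧ ρ' (d + 1) = i) (by
        rintro i hi _ ⟨σ, rfl, k1, k2, k3⟩
        have hir : i.size ≤ r.eval L := (size_le_self i).trans (by omega)
        have hir' : (i + 1).size ≤ r.eval L + 1 := (size_le_self _).trans (by omega)
        refine ⟨by simp [Expr.eval, Op.eval, k2, k3, hi], ?_, ?_⟩
        · have : (i.size + 1) * ((g γ h).size + 1) ≤ (r.eval L + 1) * (q.eval L + 1) :=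
            Nat.mul_le_mul (by omega) (by omega)
          simp only [Expr.eval, Expr.cost, withStack_stack, k2, k3, hB]
          omega
        · obtain ⟨τ, hτ, σ', hσ, m2⟩ := hF (Function.update loc (Ctx.len Γ) (d + 1)) (d + 2)
            (L + r.eval L + 2) (γ, i) (floop (F γ) i h) σ cs
            (hf.extend (by omega) (by omega) k1 k3) (by omega)
            (((hs.of_protected (e1 γ i h) (e2 γ i h)).mono (by omega)).extend (by omega))
          rw [(e1 γ i h).2.2] at hτ
          have n2 : σ' (d + 1) = i := (m2 _ (by omega)).trans k3
          have n3 : σ' d = g γ h := (m2 _ (by omega)).trans k2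
          have n8 : Op.eval .add i 1 = i + 1 := rfl
          refine ⟨_, ?_, _, Run.seq hσ (Run.assign_stack (d + 1) _ _ σ' cs), _, rfl, ?_, ?_, ?_⟩
          · simp only [Expr.eval, Expr.cost, withStack_stack, n2, n8, Nat.size_one, hB]
            rw [mul_comm] at hτ
            omega
          · intro j hj
            rw [Function.update_of_ne (by omega), m2 j (by omega), k1 j hj]
          · rw [Function.update_of_ne (by omega), n3]
          · simp [Expr.eval, Op.eval, n2])
      (by
        rintro _ ⟨σ, rfl, k1, k2, k3⟩
        refine ⟨by simp [Expr.eval, Op.eval, k2, k3], ?_⟩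
        have hir : (g γ h).size ≤ r.eval L := (size_le_self _).trans (by omega)
        have : ((g γ h).size + 1) * ((g γ h).size + 1) ≤ (r.eval L + 1) * (q.eval L + 1) :=
          Nat.mul_le_mul (by omega) (by omega)
        simp only [Expr.eval, Expr.cost, withStack_stack, k2, k3, hB]
        omega)
      (s := ⟨withStack h (Function.update ρ1 (d + 1) 0), cs⟩) ⟨_, rfl, fun j hj => by
        rw [Function.update_of_ne (by omega), h2 j hj], by
        rw [Function.update_of_ne (by omega), h3], by simp⟩
  refine ⟨_, ?_, _, Run.seq hr (Run.seq (Run.assign_stack (d + 1) (.const 0) h ρ1 cs) hr'), h4⟩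
  simp only [eval_add, eval_mul, eval_X, eval_ofNat, eval_comp, eval_one]
  refine loop_time (Nat.one_le_pow _ _ (by omega)) hgL ?_
  simp only [Expr.cost, Expr.eval, Nat.size_zero]
  omega

/-- Loops with as many iterations as the number `K` in cell `1` of array `9` tells; the loop variable
is kept in cell `0` of array `16`. -/
theorem CompS.bigLoop {lev : ℕ} {F : Γ → Mem → Mem} (hF : CompS lev F) :
    CompS (lev + 1) fun γ h => floop (fun i h => F γ (h.set 16 0 i)) (h 9 1) h := by
  obtain ⟨f1, f2, p', q', hF⟩ := hF
  have s1 : ∀ (h : Mem) i, h.set 16 0 i 1 = h 1 ∧ h.set 16 0 i 8 = h 8 ∧ h.set 16 0 i 9 = h 9 :=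
    fun h i => ⟨Mem.set_of_ne _ _ _ (by decide), Mem.set_of_ne _ _ _ (by decide),
      Mem.set_of_ne _ _ _ (by decide)⟩
  have s2 : ∀ (h : Mem) s i, i.size ≤ s → (∀ x i, (h x i).size ≤ s) →
      ∀ x j, (h.set 16 0 i x j).size ≤ s := fun h s i hi hs x j => by
    rw [Mem.set_apply]
    split_ifs
    exacts [hi, hs x j]
  have e1 : ∀ γ n h, floop (fun i h => F γ (h.set 16 0 i)) n h 1 = h 1 ∧
      floop (fun i h => F γ (h.set 16 0 i)) n h 8 = h 8 ∧
      floop (fun i h => F γ (h.set 16 0 i)) n h 9 = h 9 := fun γ n h =>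
    floop_protected (fun i h => ⟨(f1 _ _).1.trans (s1 _ _).1, (f1 _ _).2.1.trans (s1 _ _).2.1,
      (f1 _ _).2.2.trans (s1 _ _).2.2⟩) n h
  -- The loop variable is written without reduction. It is short because it stays below `h 9 1`,
  -- which is itself in memory.
  have e2 : ∀ γ n h s, n ≤ h 9 1 → (∀ x i, (h x i).size ≤ s) →
      ∀ x i, (floop (fun i h => F γ (h.set 16 0 i)) n h x i).size ≤ s :=
    fun γ n h s hn hs => floop_size (fun i hi h' hs' => f2 _ _ s (s2 _ s i
      (size_le_of_le_of_size (hi.le.trans hn) (hs 9 1)) hs')) h hs n le_rfl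
  let B : ℕ[X] := (X + 2) * (X + 1) + 40 * X + 100
  refine ⟨fun γ h => e1 γ _ h, fun γ h s hs => e2 γ _ h s le_rfl hs,
    fun loc d => .seq (.assign 20 (.const d) (.const 0))
      (.loop (.bin .lt (.get 20 (.const d)) (.get 9 (.const 1)))
      (.seq (.assign 16 (.const 0) (.get 20 (.const d))) (.seq (p' loc (d + 1))
        (.assign 20 (.const d) (.bin .add (.get 20 (.const d)) (.const 1)))))),
    (2 * X + 20) + ((B + (q'.comp (X + 1) + B) + 1) + (B + 1)), ?_⟩
  intro loc d L γ h ρ cs hf hd hs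
  have hB : B.eval L = (L + 2) * (L + 1) + 40 * L + 100 := by simp [B]
  have z0 := (size_le_self d).trans hd
  have z1 : (d + 1).size ≤ L + 1 := (size_le_self (d + 1)).trans (by omega)
  have hKL := hs.size 9 1
  have hn20 : ∀ (h : Mem) ρ, withStack h ρ 9 = h 9 := fun h ρ => withStack_of_ne (by decide) h ρ
  obtain ⟨t', ht', s', hr', ρ', rfl, h4, h5⟩ := Run.loop_iterate
    (e := .bin .lt (.get 20 (.const d)) (.get 9 (.const 1)))
    (p := (.seq (.assign 16 (.const 0) (.get 20 (.const d))) (.seq (p' loc (d + 1))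
        (.assign 20 (.const d) (.bin .add (.get 20 (.const d)) (.const 1))))))
    (C := B.eval L) (τ := q'.eval (L + 1) * (h 9 1 + 1) ^ lev + B.eval L) (h 9 1)
    (fun i st => ∃ ρ', st = ⟨withStack (floop (fun i h => F γ (h.set 16 0 i)) i h) ρ', cs⟩ ∧
      (∀ j < d, ρ' j = ρ j) ∧ ρ' d = i) (by
        rintro i hi _ ⟨σ, rfl, k1, k3⟩
        have hir : i.size ≤ L := (Nat.size_le_size hi.le).trans hKL
        have hir' : (i + 1).size ≤ L := (Nat.size_le_size hi).trans hKL
        have k9 := (e1 γ i h).2.2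
        refine ⟨by simp [Expr.eval, Op.eval, k3, hn20, k9, hi], ?_, ?_⟩
        · have : (i.size + 1) * ((h 9 1).size + 1) ≤ (L + 2) * (L + 1) :=
            Nat.mul_le_mul (by omega) (by omega)
          simp only [Expr.eval, Expr.cost, withStack_stack, k3, hn20, k9, hB, Nat.size_one]
          omega
        · set hc := floop (fun i h => F γ (h.set 16 0 i)) i h with hhc
          have hsc : Small L γ (hc.set 16 0 i) :=
            (hs.of_protected (e1 γ i h) (fun s hs => e2 γ i h s hi.le hs)).of_protected (s1 _ _)
              (fun s hs' => s2 _ s i (size_le_of_le_of_size (b := h 9 1) hi.le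
                (by rw [← k9]; exact hs' 9 1)) hs')
          obtain ⟨τ, hτ, σ', hσ, m2⟩ := hF loc (d + 1)
            (L + 1) γ (hc.set 16 0 i) σ cs (hf.mono (by omega) k1) (by omega)
            (hsc.mono (by omega))
          rw [(s1 _ _).2.2, k9] at hτ
          have n2 : σ' d = i := (m2 _ (by omega)).trans k3
          have n8 : Op.eval .add i 1 = i + 1 := rfl
          have hr'' := Run.assign 16 (.const 0) (.get 20 (.const d)) ⟨withStack hc σ, cs⟩
          simp only [Expr.eval, withStack_stack, k3,
            withStack_set (show 16 ≠ 20 by decide)] at hr''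
          refine ⟨_, ?_, _, Run.seq hr'' (Run.seq hσ (Run.assign_stack d _ _ σ' cs)), _, rfl,
            ?_, ?_⟩
          · simp only [Expr.eval, Expr.cost, withStack_stack, k3, n2, n8, Nat.size_one,
              Nat.size_zero, hB]
            rw [mul_comm] at hτ
            omega
          · intro j hj
            rw [Function.update_of_ne (by omega), m2 j (by omega), k1 j hj]
          · simp [Expr.eval, Op.eval, n2])
      (by
        rintro _ ⟨σ, rfl, k1, k3⟩
        have k9 := (e1 γ (h 9 1) h).2.2
        refine ⟨by simp [Expr.eval, Op.eval, k3, hn20, k9], ?_⟩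
        have : ((h 9 1).size + 1) * ((h 9 1).size + 1) ≤ (L + 2) * (L + 1) :=
          Nat.mul_le_mul (by omega) (by omega)
        simp only [Expr.eval, Expr.cost, withStack_stack, k3, hn20, k9, hB, Nat.size_one]
        omega)
      (s := ⟨withStack h (Function.update ρ d 0), cs⟩) ⟨_, rfl, fun j hj => by
        rw [Function.update_of_ne (by omega)], by simp⟩
  refine ⟨_, ?_, _, Run.seq (Run.assign_stack d (.const 0) h ρ cs) hr', h4⟩
  simp only [eval_add, eval_mul, eval_X, eval_ofNat, eval_comp, eval_one]
  have := loop_time (K := (h 9 1 + 1) ^ lev) (A := 2 * L + 20) (r := h 9 1) (C := B.eval L)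
    (Q := q'.eval (L + 1)) (t := 2 * L + 20 + t') (Nat.one_le_pow _ _ (by omega)) le_rfl
    (by omega)
  -- One of the factors `h 9 1 + 1` pays for the iterations, the other `lev` factors pay for the
  -- body.
  rw [pow_succ, mul_assoc]
  refine le_trans ?_ (this.trans (Nat.mul_le_mul_left _ ?_))
  · simp only [Expr.cost, Expr.eval, Nat.size_zero]
    omega
  · generalize B.eval L + (q'.eval (L + 1) + B.eval L) + 1 = u
    have : (h 9 1 + 1) * (2 * L + 20 + (u + (B.eval L + 1))) = (2 * L + 20 + (h 9 1 * u +
      (B.eval L + 1))) + (h 9 1 * (2 * L + 20 + B.eval L + 1) + u) := by ring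
    omega

end
end CutCount

namespace CutCount
open Finset

section
variable {α β : Type*} {G : Graph α β}

/-! ### Connectivity by a set of edges, and cycles -/

/-- `x` and `y` are connected by edges in `F`. -/
def ConnBy (G : Graph α β) (F : Set β) (x y : α) : Prop :=
  Relation.ReflTransGen (fun a b => ∃ e ∈ F, G.IsLink e a b) x y

theorem ConnBy.symm {F : Set β} {x y : α} (h : ConnBy G F x y) : ConnBy G F y x := by
  induction h with
  | refl => exact Relation.ReflTransGen.refl
  | tail _ h ih =>
    obtain ⟨e, he, hl⟩ := h
    exact ih.head ⟨e, he, hl.symm⟩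

theorem ConnBy.mono {F F' : Set β} (hF : F ⊆ F') {x y : α} (h : ConnBy G F x y) :
    ConnBy G F' x y :=
  Relation.ReflTransGen.mono (fun _ _ ⟨e, he, hl⟩ => ⟨e, hF he, hl⟩) _ _ h

theorem ConnBy.connected {F : Set β} {x y : α} (h : ConnBy G F x y) : Connected G x y :=
  Relation.ReflTransGen.mono (fun _ _ ⟨e, _, hl⟩ => ⟨e, hl⟩) _ _ h

theorem ConnBy.apply_eq {γ : Type*} {F : Set β} {c : α → γ}
    (hc : ∀ e ∈ F, ∀ x y, G.IsLink e x y → c x = c y) {x y : α} (h : ConnBy G F x y) :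
    c x = c y := by
  induction h with
  | refl => rfl
  | tail _ h ih =>
    obtain ⟨e, he, hl⟩ := h
    exact ih.trans (hc e he _ _ hl)

theorem ConnBy.exists_walk {F : Set β} {x y : α} (h : ConnBy G F x y) :
    ∃ (k : ℕ) (p : ℕ → α), p 0 = x ∧ p k = y ∧ ∀ i < k, ∃ e ∈ F, G.IsLink e (p i) (p (i + 1)) := by
  induction h with
  | refl => exact ⟨0, fun _ => x, rfl, rfl, fun i hi => absurd hi (Nat.not_lt_zero _)⟩
  | @tail b c _ h ih =>
    obtain ⟨k, p, h0, hk, hp⟩ := ih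
    refine ⟨k + 1, fun i => if i ≤ k then p i else c, by simp [h0], by simp, fun i hi => ?_⟩
    rcases Nat.lt_succ_iff_lt_or_eq.1 hi with hi | rfl
    · simpa [hi.le, Nat.succ_le_iff.2 hi] using hp i hi
    · simpa [hk] using h

/-- A walk of minimal length repeats no vertex: the part between two visits could be cut out. -/
theorem ConnBy.exists_path {F : Set β} {x y : α} (h : ConnBy G F x y) :
    ∃ (k : ℕ) (p : ℕ → α), p 0 = x ∧ p k = y ∧ (∀ i < k, ∃ e ∈ F, G.IsLink e (p i) (p (i + 1))) ∧
      ∀ i ≤ k, ∀ j ≤ k, p i = p j → i = j := by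
  classical
  have hex := h.exists_walk
  obtain ⟨p, h0, hk, hp⟩ := Nat.find_spec hex
  set k := Nat.find hex with hkdef
  refine ⟨k, p, h0, hk, hp, ?_⟩
  have key : ∀ i j, i < j → j ≤ k → p i ≠ p j := by
    intro i j hij hj heq
    refine Nat.find_min hex (m := k - (j - i)) (by omega)
      ⟨fun t => if t ≤ i then p t else p (t + (j - i)), by simp [h0], ?_, fun t ht => ?_⟩
    · by_cases hc : k - (j - i) ≤ i
      · obtain rfl : j = k := by omega
        dsimp only
        rw [if_pos hc, show k - (k - i) = i by omega, heq, hk]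
      · dsimp only
        rw [if_neg hc, show k - (j - i) + (j - i) = k by omega, hk]
    · rcases lt_trichotomy t i with hti | rfl | hti
      · simpa [hti.le, Nat.succ_le_iff.2 hti] using hp t (by omega)
      · have := hp j (by omega)
        rw [← heq] at this
        simpa [show t + 1 + (j - t) = j + 1 by omega] using this
      · have := hp (t + (j - i)) (by omega)
        simpa [show ¬ t ≤ i by omega, show ¬ t + 1 ≤ i by omega,
          show t + 1 + (j - i) = t + (j - i) + 1 by omega] using this
  intro i hi j hj heq
  rcases lt_trichotomy i j with hij | hij | hij
  · exact absurd heq (key i j hij hj)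
  · exact hij
  · exact absurd heq.symm (key j i hij hi)

/-- A path through `F` between the ends of `e` is closed by `e`. A path of length 0 is included and
gives a loop. -/
theorem exists_cycle_of_connBy {F : Set β} {e : β} {x y : α} (h : ConnBy G F x y) (he : e ∉ F)
    (hl : G.IsLink e x y) : ∃ C, IsCycle G C ∧ e ∈ C ∧ C ⊆ insert e F := by
  obtain ⟨k, p, h0, hk, hp, hinj⟩ := h.exists_path
  have hed : ∀ i, ∃ f, i < k → f ∈ F ∧ G.IsLink f (p i) (p (i + 1)) := fun i => by
    by_cases hi : i < k
    · obtain ⟨f, hf⟩ := hp i hi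
      exact ⟨f, fun _ => hf⟩
    · exact ⟨e, fun h => absurd h hi⟩
  choose d hd using hed
  have dinj : ∀ i j, i < j → j < k → d i ≠ d j := by
    intro i j hij hj heq
    have h1 := (hd i (by omega)).2
    have h2 := (hd j hj).2
    rw [heq] at h1
    rcases h1.left_eq_or_eq h2 with h3 | h3
    · have := hinj i (by omega) j (by omega) h3
      omega
    · have := hinj i (by omega) (j + 1) (by omega) h3
      omega
  -- The last edge leads from vertex `k` back to vertex `0`, since `Fin.last k + 1 = 0`; this is the
  -- place of `e`.
  let E : Fin (k + 1) → β := fun i => if (i : ℕ) < k then d i else e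
  refine ⟨Set.range E, ⟨k, fun i => p i, E, ?_, ?_, ?_, rfl⟩, ⟨Fin.last k, by simp [E]⟩, ?_⟩
  · intro i j hij
    exact Fin.ext (hinj i (by omega) j (by omega) hij)
  · intro i j hij
    by_contra hne
    have hne' : (i : ℕ) ≠ j := fun h => hne (Fin.ext h)
    simp only [E] at hij
    split_ifs at hij with h1 h2 h2
    · rcases lt_or_gt_of_ne hne' with h | h
      · exact dinj _ _ h h2 hij
      · exact dinj _ _ h h1 hij.symm
    · exact he (hij ▸ (hd i h1).1)
    · exact he (hij.symm ▸ (hd j h2).1)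
    · omega
  · intro i
    by_cases hi : (i : ℕ) < k
    · have : ((i + 1 : Fin (k + 1)) : ℕ) = i + 1 :=
        Fin.val_add_one_of_lt (Fin.lt_def.2 (by simpa using hi))
      simpa [E, hi, this] using (hd i hi).2
    · obtain rfl : i = Fin.last k := Fin.ext (by simp; omega)
      simpa [E, h0, hk] using hl.symm
  · rintro _ ⟨i, rfl⟩
    by_cases hi : (i : ℕ) < k
    · simpa [E, hi] using Or.inr (hd i hi).1
    · simp [E, hi]

-- Adding 1 repeatedly in `Fin (k + 1)` reaches every index from `i`; this is how arguments travel
-- around a cycle.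
open scoped Fin.CommRing in
theorem fin_cyclic_induction {k : ℕ} {P : Fin (k + 1) → Prop} {i : Fin (k + 1)} (hi : P i)
    (hP : ∀ j, P j → P (j + 1)) (j : Fin (k + 1)) : P j := by
  have key : ∀ t : ℕ, P (i + (t : Fin (k + 1))) := by
    intro t
    induction t with
    | zero => simpa using hi
    | succ t ih =>
      have := hP _ ih
      rwa [add_assoc, ← Nat.cast_succ] at this
  simpa using key ((j - i : Fin (k + 1)) : ℕ)

-- Starting behind the edge number `i`, the other `k` edges lead once around the cycle, from `v (i +
-- 1)` back to `v i`.
open scoped Fin.CommRing in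
theorem IsCycle.connBy {C : Set β} (hC : IsCycle G C) {e : β} (he : e ∈ C) {x y : α}
    (hl : G.IsLink e x y) : ConnBy G (C \ {e}) x y := by
  obtain ⟨k, v, d, hv, hd, hvd, rfl⟩ := hC
  obtain ⟨i, rfl⟩ := he
  have key : ∀ t : ℕ, t ≤ k → ConnBy G (Set.range d \ {d i}) (v (i + 1)) (v (i + 1 + (t : Fin (k + 1)))) := by
    intro t
    induction t with
    | zero =>
      intro _
      rw [Nat.cast_zero, add_zero]
      exact Relation.ReflTransGen.refl
    | succ t ih =>
      intro ht
      refine (ih (by omega)).tail ⟨d (i + 1 + (t : Fin (k + 1))), ⟨⟨_, rfl⟩, fun h => ?_⟩, ?_⟩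
      · have h1 : i + 1 + (t : Fin (k + 1)) = i := hd h
        have h2 : (((t + 1 : ℕ) : Fin (k + 1)) : ℕ) = 0 := by
          have : ((t + 1 : ℕ) : Fin (k + 1)) = 0 := by
            rw [add_assoc, add_eq_left] at h1
            rw [Nat.cast_succ]
            exact (add_comm _ _).trans h1
          rw [this]
          rfl
        rw [Fin.val_natCast, Nat.mod_eq_of_lt (by omega)] at h2
        omega
      · have := hvd (i + 1 + (t : Fin (k + 1)))
        rwa [add_assoc _ _ (1 : Fin (k + 1)), ← Nat.cast_succ] at this
  have h1 := key k le_rfl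
  have h2 : i + 1 + (k : Fin (k + 1)) = i := by
    have : ((k : Fin (k + 1)) + 1) = 0 := by
      rw [← Nat.cast_succ, Fin.natCast_self]
    rw [add_assoc, add_comm 1, this, add_zero]
  rw [h2] at h1
  rcases (hvd i).eq_and_eq_or_eq_and_eq hl with ⟨h3, h4⟩ | ⟨h3, h4⟩
  · rw [← h3, ← h4]
    exact h1.symm
  · rwa [← h3, ← h4]

/-! ### Counting cuts -/

section
variable [Fintype α]

open Classical in
/-- The two-colourings of `V` which are constant on the edges in `F`. -/
noncomputable def cuts (G : Graph α β) (V : Finset α) (F : Set β) : Finset (α → Bool) :=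
  univ.filter fun c => (∀ x ∉ V, c x = false) ∧ ∀ e ∈ F, ∀ x y, G.IsLink e x y → c x = c y

theorem mem_cuts {V : Finset α} {F : Set β} {c : α → Bool} : c ∈ cuts G V F ↔
    (∀ x ∉ V, c x = false) ∧ ∀ e ∈ F, ∀ x y, G.IsLink e x y → c x = c y := by
  simp [cuts]

theorem cuts_anti {V : Finset α} {F F' : Set β} (h : F ⊆ F') : cuts G V F' ⊆ cuts G V F := by
  intro c hc
  rw [mem_cuts] at hc ⊢
  exact ⟨hc.1, fun e he => hc.2 e (h he)⟩

theorem card_cuts_empty (V : Finset α) : (cuts G V ∅).card = 2 ^ V.card := by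
  classical
  have : cuts G V ∅ = Fintype.piFinset fun v => if v ∈ V then univ else {false} := by
    ext c
    rw [mem_cuts, Fintype.mem_piFinset]
    simp only [Set.mem_empty_iff_false, false_imp_iff, implies_true, and_true]
    refine forall_congr' fun v => ?_
    by_cases hv : v ∈ V <;> simp [hv]
  rw [this, Fintype.card_piFinset, ← prod_subset (subset_univ V) (fun v _ hv => by simp [hv]),
    prod_congr rfl (g := fun _ => 2) (fun v hv => by simp [hv]), prod_const]

/-- All ends of edges in `F` are in `V`. -/
def Within (G : Graph α β) (V : Finset α) (F : Set β) : Prop :=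
  ∀ e ∈ F, ∀ x y, G.IsLink e x y → x ∈ V

omit [Fintype α] in
theorem ConnBy.mem_within {V : Finset α} {F : Set β} (hF : Within G V F) {x y : α}
    (h : ConnBy G F x y) (hx : x ∈ V) : y ∈ V := by
  induction h with
  | refl => exact hx
  | tail _ h _ =>
    obtain ⟨e, he, hl⟩ := h
    exact hF e he _ _ hl.symm

/-- The indicator of the component of `x` is itself a cut, and it separates `x` from everything
outside of the component. -/
theorem connBy_iff_cuts {V : Finset α} {F : Set β} (hF : Within G V F) {x y : α} (hx : x ∈ V) :
    ConnBy G F x y ↔ ∀ c ∈ cuts G V F, c x = c y := by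
  classical
  refine ⟨fun h c hc => h.apply_eq (mem_cuts.1 hc).2, fun h => ?_⟩
  have := h (fun z => decide (ConnBy G F x z)) (mem_cuts.2 ⟨fun z hz => ?_, fun e he a b hl => ?_⟩)
  · have h1 : ConnBy G F x x := Relation.ReflTransGen.refl
    simpa [h1] using this
  · simpa using fun h => hz (ConnBy.mem_within hF h hx)
  · have : ConnBy G F x a ↔ ConnBy G F x b :=
      ⟨fun h => h.tail ⟨e, he, hl⟩, fun h => h.tail ⟨e, he, hl.symm⟩⟩
    simp [this]

theorem mem_cuts_insert {V : Finset α} {F : Set β} {e : β} {x y : α} (hl : G.IsLink e x y)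
    {c : α → Bool} : c ∈ cuts G V (insert e F) ↔ c ∈ cuts G V F ∧ c x = c y := by
  rw [mem_cuts, mem_cuts, and_assoc, Set.forall_mem_insert]
  refine and_congr_right fun _ => and_comm.trans (and_congr_right fun _ =>
    ⟨fun h => h _ _ hl, fun h a b hab => ?_⟩)
  rcases hl.eq_and_eq_or_eq_and_eq hab with ⟨rfl, rfl⟩ | ⟨rfl, rfl⟩
  · exact h
  · exact h.symm

/-- Flipping the colours on the component of `x` is an involution of the cuts. It changes the colour
of `x` but not that of `y`, so it exchanges the cuts with `c x = c y`, which are those for `insert e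
F`, and the remaining ones. -/
theorem two_mul_card_cuts_insert {V : Finset α} {F : Set β} (hF : Within G V F) {e : β} {x y : α}
    (hl : G.IsLink e x y) (hx : x ∈ V) (h : ¬ ConnBy G F x y) :
    2 * (cuts G V (insert e F)).card = (cuts G V F).card := by
  classical
  have h1 : (cuts G V F).filter (fun c => c x = c y) = cuts G V (insert e F) := by
    ext c
    rw [mem_filter, mem_cuts_insert hl]
  have h2 : ((cuts G V F).filter (fun c => c x = c y)).card =
      ((cuts G V F).filter (fun c => ¬ c x = c y)).card := by
    let fl : (α → Bool) → α → Bool := fun c z => xor (c z) (decide (ConnBy G F x z))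
    have hfl : ∀ c, fl (fl c) = c := fun c => by
      funext z
      simp [fl]
    have hflc : ∀ c ∈ cuts G V F, fl c ∈ cuts G V F := by
      intro c hc
      rw [mem_cuts] at hc ⊢
      refine ⟨fun z hz => ?_, fun e he a b hl => ?_⟩
      · have : ¬ ConnBy G F x z := fun h => hz (ConnBy.mem_within hF h hx)
        simp [fl, this, hc.1 z hz]
      · have : ConnBy G F x a ↔ ConnBy G F x b :=
          ⟨fun h => h.tail ⟨e, he, hl⟩, fun h => h.tail ⟨e, he, hl.symm⟩⟩
        simp [fl, this, hc.2 e he a b hl]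
    have hxx : ConnBy G F x x := Relation.ReflTransGen.refl
    have hflx : ∀ c, fl c x = fl c y ↔ ¬ c x = c y := fun c => by
      simp only [fl, hxx, h, decide_true, decide_false]
      cases c x <;> cases c y <;> simp
    refine card_bij' (fun c _ => fl c) (fun c _ => fl c) ?_ ?_ (fun c _ => hfl c) (fun c _ => hfl c)
    · intro c hc
      rw [mem_filter] at hc ⊢
      exact ⟨hflc c hc.1, fun h => (hflx c).1 h hc.2⟩
    · intro c hc
      rw [mem_filter] at hc ⊢
      exact ⟨hflc c hc.1, (hflx c).2 hc.2⟩
  have h3 := card_filter_add_card_filter_not (s := cuts G V F) (fun c => c x = c y)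
  rw [← h1]
  omega

/-- No cycle consists of edges in `F`. -/
def Acyclic (G : Graph α β) (F : Set β) : Prop := ∀ C ⊆ F, ¬ IsCycle G C

/-- Of the `2 ^ |V|` colourings each edge leaves one half, because it joins two components of the
edges inserted before; otherwise it would close a cycle. -/
theorem card_cuts_of_acyclic {V : Finset α} {F : Finset β} (hV : Within G V F)
    (hE : (F : Set β) ⊆ G.edgeSet) (hF : Acyclic G F) :
    (cuts G V F).card * 2 ^ F.card = 2 ^ V.card := by
  classical
  induction F using Finset.induction with
  | empty => simpa using card_cuts_empty V
  | insert e F he ih =>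
    have h1 := ih (fun d hd => hV d (by simp [mem_coe.1 hd])) (fun d hd => hE (by simp [mem_coe.1 hd]))
      (fun C hC => hF C (hC.trans (by simp)))
    obtain ⟨x, y, hl⟩ := G.exists_isLink_of_mem_edgeSet (hE (mem_coe.2 (mem_insert_self e F)))
    have h2 := two_mul_card_cuts_insert (V := V) (F := F) (fun d hd => hV d (by simp [mem_coe.1 hd]))
      hl (hV e (by simp) x y hl) (fun hc => by
        obtain ⟨C, hC, _, hCF⟩ := exists_cycle_of_connBy hc (by simpa using he) hl
        exact hF C (by simpa using hCF) hC)
    rw [card_insert_of_notMem he, coe_insert, pow_succ, ← h1, ← h2]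
    ring

/-- This is the greedy construction of a spanning forest: an edge within a component imposes no new
condition on cuts and is dropped. -/
theorem exists_acyclic_cuts_eq {V : Finset α} {F : Finset β} (hV : Within G V F)
    (hE : (F : Set β) ⊆ G.edgeSet) :
    ∃ F₀ ⊆ F, Acyclic G F₀ ∧ cuts G V F₀ = cuts G V F := by
  classical
  induction F using Finset.induction with
  | empty =>
    refine ⟨∅, subset_rfl, fun C hC h => ?_, rfl⟩
    obtain ⟨k, v, d, -, -, -, rfl⟩ := h
    exact absurd (hC ⟨0, rfl⟩) (by simp)
  | insert e F he ih =>
    have hVF : Within G V F := fun d hd => hV d (by simp [mem_coe.1 hd])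
    obtain ⟨F₀, h1, h2, h3⟩ := ih hVF (fun d hd => hE (by simp [mem_coe.1 hd]))
    obtain ⟨x, y, hl⟩ := G.exists_isLink_of_mem_edgeSet (hE (mem_coe.2 (mem_insert_self e F)))
    have hx : x ∈ V := hV e (by simp) x y hl
    have hV0 : Within G V F₀ := fun d hd => hVF d (h1 hd)
    by_cases hc : ConnBy G F₀ x y
    · refine ⟨F₀, h1.trans (subset_insert _ _), h2, ?_⟩
      ext c
      rw [coe_insert, mem_cuts_insert hl, ← h3]
      exact ⟨fun h => ⟨h, (connBy_iff_cuts hV0 hx).1 hc c h⟩, fun h => h.1⟩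
    · refine ⟨insert e F₀, insert_subset_insert _ h1, fun C hC hcyc => ?_, ?_⟩
      · by_cases heC : e ∈ C
        · refine hc ((hcyc.connBy heC hl).mono ?_)
          rintro d ⟨hd, hde⟩
          have := hC hd
          simp only [coe_insert, Set.mem_insert_iff] at this
          exact this.resolve_left hde
        · refine h2 C (fun d hd => ?_) hcyc
          have := hC hd
          simp only [coe_insert, Set.mem_insert_iff] at this
          exact this.resolve_left fun h => heC (h ▸ hd)
      · ext c
        rw [coe_insert, coe_insert, mem_cuts_insert hl, mem_cuts_insert hl, h3]

omit [Fintype α] in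
theorem isCycle_deleteEdges {D C : Set β} :
    IsCycle (G.deleteEdges D) C ↔ IsCycle G C ∧ Disjoint C D := by
  constructor
  · rintro ⟨k, v, d, hv, hd, hvd, rfl⟩
    simp only [Graph.deleteEdges_isLink] at hvd
    refine ⟨⟨k, v, d, hv, hd, fun i => (hvd i).1, rfl⟩, Set.disjoint_left.2 ?_⟩
    rintro _ ⟨i, rfl⟩
    exact (hvd i).2
  · rintro ⟨⟨k, v, d, hv, hd, hvd, rfl⟩, hD⟩
    refine ⟨k, v, d, hv, hd, fun i => ?_, rfl⟩
    rw [Graph.deleteEdges_isLink]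
    exact ⟨hvd i, Set.disjoint_left.1 hD ⟨i, rfl⟩⟩

omit [Fintype α] in
theorem IsCycle.subset_edgeSet {C : Set β} (hC : IsCycle G C) : C ⊆ G.edgeSet := by
  obtain ⟨k, v, d, -, -, hvd, rfl⟩ := hC
  rintro _ ⟨i, rfl⟩
  exact (hvd i).edge_mem

/-- The number of cuts tells whether the graph is an `l`-forest. -/
theorem card_cuts_eq_two_pow {V : Finset α} {E : Finset β} (hV : (V : Set α) = G.vertexSet)
    (hE : (E : Set β) = G.edgeSet) : ∃ a, (cuts G V E).card = 2 ^ a ∧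
      ∀ l, IsAlmostForest l G ↔ a + E.card ≤ V.card + l := by
  classical
  have hW : Within G V E := fun e _ x y hl => by
    have := hl.left_mem
    rwa [← hV] at this
  obtain ⟨F₀, h1, h2, h3⟩ := exists_acyclic_cuts_eq hW hE.subset
  have h4 := card_cuts_of_acyclic (fun d hd => hW d (h1 hd))
    ((coe_subset.2 h1).trans hE.subset) h2
  have hle : F₀.card ≤ V.card := by
    refine (Nat.pow_le_pow_iff_right (a := 2) (by norm_num)).1 (h4 ▸ Nat.le_mul_of_pos_left _ ?_)
    refine Nat.pos_of_ne_zero fun h => ?_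
    rw [h, zero_mul] at h4
    exact absurd h4.symm (by positivity)
  -- The exponent `|V| - |F₀|` is the number of components, as `F₀` is a spanning forest.
  have h5 : (cuts G V E).card = 2 ^ (V.card - F₀.card) := by
    rw [← h3]
    refine Nat.eq_of_mul_eq_mul_right (m := 2 ^ F₀.card) (by positivity) ?_
    rw [h4, ← pow_add, Nat.sub_add_cancel hle]
  refine ⟨_, h5, fun l => ⟨?_, fun h => ?_⟩⟩
  -- `E \ D` is acyclic and has at least as many cuts as `E`. Comparing the two powers of two gives
  -- `|E \ D| ≤ |F₀|`.
  · rintro ⟨D, hD, hDl, hf⟩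
    have h6 : (cuts G V (E \ D : Finset β)).card * 2 ^ (E \ D).card = 2 ^ V.card := by
      refine card_cuts_of_acyclic (fun d hd => hW d (mem_sdiff.1 hd).1)
        ((coe_subset.2 sdiff_subset).trans hE.subset) fun C hC hcyc => hf C ?_
      rw [isCycle_deleteEdges]
      exact ⟨hcyc, Set.disjoint_left.2 fun d hd => (mem_sdiff.1 (hC hd)).2⟩
    have h7 := card_le_card (cuts_anti (G := G) (V := V) (coe_subset.2 (sdiff_subset (s := E) (t := D))))
    rw [h5] at h7
    have h8 : 2 ^ (V.card - F₀.card) * 2 ^ (E \ D).card ≤ 2 ^ V.card :=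
      h6 ▸ Nat.mul_le_mul_right _ h7
    rw [← pow_add, Nat.pow_le_pow_iff_right (by norm_num)] at h8
    have h9 := card_sdiff_add_card_eq_card (s := D) (t := E)
      (coe_subset.1 (hD.trans hE.symm.subset))
    omega
  -- Conversely, keep the spanning forest only; the inequality says that at most `l` edges are
  -- deleted.
  · refine ⟨E \ F₀, (coe_subset.2 sdiff_subset).trans hE.subset, ?_, fun C hC => ?_⟩
    · have := card_sdiff_add_card_eq_card h1
      omega
    · rw [isCycle_deleteEdges] at hC
      refine h2 C (fun d hd => ?_) hC.1
      have h6 : d ∈ (E : Set β) := by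
        rw [hE]
        exact hC.1.subset_edgeSet hd
      by_contra h7
      exact Set.disjoint_left.1 hC.2 hd (mem_coe.2 (mem_sdiff.2 ⟨h6, h7⟩))

end

/-! ### Orientations of pseudoforests -/

/-- The vertices from which the orientation `f` leads to `W`: an edge `e` which joins `x = f e` and
`y` is an arrow from `x` to `y`. -/
inductive Leads (G : Graph α β) (f : β → α) (W : Set α) : α → Prop
  | base {x : α} : x ∈ W → Leads G f W x
  | step {e : β} {y : α} : G.IsLink e (f e) y → Leads G f W y → Leads G f W (f e)

/-- An orientation chooses an end of each edge, such that no vertex is chosen twice. -/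
def IsOrientation (G : Graph α β) (f : β → α) : Prop :=
  Set.InjOn f G.edgeSet ∧ ∀ e ∈ G.edgeSet, G.Inc e (f e)

/-- Around a cycle the orientation has a constant direction. If `d (i + 1)` chooses `v (i + 1)`,
then its predecessor `d i` cannot choose this vertex too and must choose `v i`; this propagates
around the cycle. -/
theorem IsOrientation.exists_edge {f : β → α} (hf : IsOrientation G f) {k : ℕ}
    {v : Fin (k + 1) → α} {d : Fin (k + 1) → β}
    (hd : Function.Injective d) (hl : ∀ i, G.IsLink (d i) (v i) (v (i + 1))) :
    (∀ i, f (d i) = v i) ∨ ∀ i, f (d i) = v (i + 1) := by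
  by_cases h : ∃ j, f (d j) = v j
  · obtain ⟨j, hj⟩ := h
    left
    have key : ∀ i, f (d (i + 1)) = v (i + 1) → f (d i) = v i := by
      intro i hi
      rcases (hf.2 _ (hl i).edge_mem).eq_or_eq_of_isLink (hl i) with h | h
      · exact h
      · have h1 : i = i + 1 := hd (hf.1 (hl i).edge_mem (hl (i + 1)).edge_mem (h.trans hi.symm))
        rwa [← h1] at hi
    by_contra hne
    push Not at hne
    obtain ⟨i, hi⟩ := hne
    exact fin_cyclic_induction (P := fun i => ¬ f (d i) = v i) hi (fun i h h' => h (key i h')) j hj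
  · push Not at h
    exact Or.inr fun i =>
      ((hf.2 _ (hl i).edge_mem).eq_or_eq_of_isLink (hl i)).resolve_left (h i)

/-- An edge which chooses a vertex of a cycle is an edge of this cycle, because the cycle already
has an edge choosing that vertex. Hence following arrows from a common vertex never leaves the
second cycle, while it runs through all of the first. -/
theorem IsOrientation.subset_of_common {f : β → α} (hf : IsOrientation G f) {k k' : ℕ}
    {v : Fin (k + 1) → α} {d : Fin (k + 1) → β}
    (hd : Function.Injective d) (hl : ∀ i, G.IsLink (d i) (v i) (v (i + 1)))
    {v' : Fin (k' + 1) → α} {d' : Fin (k' + 1) → β}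
    (hd' : Function.Injective d') (hl' : ∀ i, G.IsLink (d' i) (v' i) (v' (i + 1)))
    {i : Fin (k + 1)} (hi : v i ∈ Set.range v') : Set.range d ⊆ Set.range d' := by
  have hedge : ∀ e ∈ G.edgeSet, f e ∈ Set.range v' → e ∈ Set.range d' := by
    rintro e he ⟨j, hj⟩
    rcases hf.exists_edge hd' hl' with h | h
    · exact ⟨j, hf.1 (hl' j).edge_mem he ((h j).trans hj)⟩
    · refine ⟨j - 1, hf.1 (hl' _).edge_mem he ((h (j - 1)).trans ?_)⟩
      rw [sub_add_cancel, hj]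
  have hends : ∀ e ∈ Set.range d', ∀ x y, G.IsLink e x y → y ∈ Set.range v' := by
    rintro _ ⟨j, rfl⟩ x y hxy
    rcases (hl' j).eq_and_eq_or_eq_and_eq hxy with ⟨-, rfl⟩ | ⟨rfl, -⟩
    · exact ⟨_, rfl⟩
    · exact ⟨_, rfl⟩
  have hall : ∀ j, v j ∈ Set.range v' := by
    rcases hf.exists_edge hd hl with h | h
    · exact fin_cyclic_induction hi fun j hj =>
        hends _ (hedge _ (hl j).edge_mem (by rwa [h j])) _ _ (hl j)
    -- Here the arrows run against the indices, so it is the property of lying outside the second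
    -- cycle that is carried forward, up to the common vertex.
    · by_contra hne
      push Not at hne
      obtain ⟨j, hj⟩ := hne
      refine fin_cyclic_induction (P := fun j => v j ∉ Set.range v') hj (fun j hj hj' => hj ?_) i hi
      exact hends _ (hedge _ (hl j).edge_mem (by rwa [h j])) _ _ (hl j).symm
  rintro _ ⟨j, rfl⟩
  refine hedge _ (hl j).edge_mem ?_
  rcases hf.exists_edge hd hl with h | h
  · rw [h]; exact hall _
  · rw [h]; exact hall _

/-- At most one arrow leaves each vertex. Every vertex in the component of a cycle leads into it,
since this property passes along edges in both directions. Arrows that start on another cycle stay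
on it, so a second cycle in the component meets the first, and then the two are equal. -/
theorem IsOrientation.isPseudoforest {f : β → α} (hf : IsOrientation G f) : IsPseudoforest G := by
  rintro _ _ ⟨k, v, d, -, hd, hl, rfl⟩ ⟨k', v', d', -, hd', hl', rfl⟩
    ⟨_, ⟨i, rfl⟩, _, ⟨j, rfl⟩, x, y, hx, hy, hxy⟩
  have hends : ∀ {k : ℕ} {v : Fin (k + 1) → α} {d : Fin (k + 1) → β},
      (∀ i, G.IsLink (d i) (v i) (v (i + 1))) → ∀ i x, G.Inc (d i) x → x ∈ Set.range v := by
    intro k v d hl i x hx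
    rcases hx.eq_or_eq_of_isLink (hl i) with rfl | rfl
    exacts [⟨_, rfl⟩, ⟨_, rfl⟩]
  have hcyc : ∀ {k : ℕ} {v : Fin (k + 1) → α} {d : Fin (k + 1) → β},
      Function.Injective d → (∀ i, G.IsLink (d i) (v i) (v (i + 1))) → ∀ e y, G.IsLink e (f e) y →
      f e ∈ Set.range v → y ∈ Set.range v := by
    rintro k v d hd hl e y hey ⟨i, hi⟩
    rcases hf.exists_edge hd hl with h | h
    · obtain rfl := hf.1 (hl i).edge_mem hey.edge_mem ((h i).trans hi)
      exact hends hl i y hey.inc_right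
    · have := (h (i - 1)).trans ((congrArg v (sub_add_cancel i 1)).trans hi)
      obtain rfl := hf.1 (hl (i - 1)).edge_mem hey.edge_mem this
      exact hends hl _ y hey.inc_right
  have hadj : ∀ a b, G.Adj a b → Leads G f (Set.range v) a → Leads G f (Set.range v) b := by
    rintro a b ⟨e, hab⟩ ha
    rcases (hf.2 e hab.edge_mem).eq_or_eq_of_isLink hab with h | h
    · subst h
      -- The arrow out of `a` is unique. Either `a` lies on the cycle, which the arrow cannot leave,
      -- or the way from `a` to the cycle continues through `b`.
      generalize hz : f e = z at ha
      cases ha with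
      | base ha =>
        subst hz
        exact Leads.base (hcyc hd hl e b hab ha)
      | @step e' y' h1 h2 =>
        obtain rfl := hf.1 hab.edge_mem h1.edge_mem hz
        rwa [hab.right_unique h1]
    · subst h
      exact Leads.step hab.symm ha
  have hy' : ∀ z, Connected G x z → Leads G f (Set.range v) z := by
    intro z hz
    induction hz with
    | refl => exact Leads.base (hends hl i x hx)
    | tail _ hab ih => exact hadj _ _ hab ih
  have hcommon : ∀ z, Leads G f (Set.range v) z → z ∈ Set.range v' →
      ∃ w, w ∈ Set.range v ∧ w ∈ Set.range v' := by
    intro z hz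
    induction hz with
    | base h => exact fun h' => ⟨_, h, h'⟩
    | @step e y hey _ ih => exact fun h' => ih (hcyc hd' hl' e y hey h')
  obtain ⟨w, ⟨a, rfl⟩, ⟨b, hb⟩⟩ := hcommon y (hy' y hxy) (hends hl' j y hy)
  exact (hf.subset_of_common hd hl hd' hl' (i := a) ⟨b, hb⟩).antisymm
    (hf.subset_of_common hd' hl' hd hl (i := b) ⟨a, hb.symm⟩)

-- This is Hall's condition. Let `F₀` be a spanning forest of `A`. Each edge of `A \ F₀` closes a
-- cycle with `F₀`, and in a pseudoforest different edges do so in different components of `F₀`. So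
-- the subsets `D` of `A \ F₀` are told apart by the cuts `col D` which mark the components touched
-- by `D`, and `2 ^ |A \ F₀| ≤ 2 ^ (|V| - |F₀|)`.
open Classical in
theorem IsPseudoforest.card_le [Fintype α] (hG : IsPseudoforest G) {V : Finset α} {A : Finset β}
    (hA : (A : Set β) ⊆ G.edgeSet) (hV : Within G V A) : A.card ≤ V.card := by
  obtain ⟨F₀, h1, h2, h3⟩ := exists_acyclic_cuts_eq hV hA
  have hV0 : Within G V F₀ := fun d hd => hV d (h1 hd)
  have h4 := card_cuts_of_acyclic hV0 ((coe_subset.2 h1).trans hA) h2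
  have hcycle : ∀ d ∈ A \ F₀, ∃ C, IsCycle G C ∧ d ∈ C ∧ C ⊆ insert d (F₀ : Set β) := by
    intro d hd
    rw [mem_sdiff] at hd
    obtain ⟨x, y, hl⟩ := G.exists_isLink_of_mem_edgeSet (hA hd.1)
    refine exists_cycle_of_connBy ((connBy_iff_cuts hV0 (hV d hd.1 x y hl)).2 fun c hc => ?_)
      (by simpa using hd.2) hl
    rw [h3] at hc
    exact (mem_cuts.1 hc).2 d hd.1 x y hl
  let col : Finset β → α → Bool := fun D z => decide (∃ d ∈ D, ∃ x, G.Inc d x ∧ ConnBy G F₀ x z)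
  have hinj : Set.InjOn col ((A \ F₀).powerset : Set (Finset β)) := by
    have key : ∀ D ∈ (A \ F₀).powerset, ∀ D' ∈ (A \ F₀).powerset, col D = col D' → D ⊆ D' := by
      intro D hD D' hD' heq d hd
      have hdA := mem_powerset.1 hD hd
      obtain ⟨x, y, hl⟩ := G.exists_isLink_of_mem_edgeSet (hA (mem_sdiff.1 hdA).1)
      have hx : col D x = true := by
        simp only [col, decide_eq_true_eq]
        exact ⟨d, hd, x, hl.inc_left, Relation.ReflTransGen.refl⟩
      rw [heq] at hx
      simp only [col, decide_eq_true_eq] at hx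
      obtain ⟨d', hd', x', hx', hc⟩ := hx
      obtain ⟨C, hC, hdC, hCF⟩ := hcycle d hdA
      obtain ⟨C', hC', hdC', hCF'⟩ := hcycle d' (mem_powerset.1 hD' hd')
      -- Both cycles lie in one component and therefore coincide. Each has only one edge outside of
      -- `F₀`, so `d = d'`.
      have := hG C C' hC hC' ⟨d, hdC, d', hdC', x, x', hl.inc_left, hx', hc.symm.connected⟩
      rw [this] at hdC
      rcases hCF' hdC with rfl | h
      · exact hd'
      · exact absurd h (mem_sdiff.1 hdA).2
    intro D hD D' hD' heq
    exact (key D hD D' hD' heq).antisymm (key D' hD' D hD heq.symm)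
  have hmaps : ∀ D ∈ (A \ F₀).powerset, col D ∈ cuts G V F₀ := by
    intro D hD
    rw [mem_cuts]
    refine ⟨fun z hz => ?_, fun e he a b hl => ?_⟩
    · simp only [col, decide_eq_false_iff_not]
      rintro ⟨d, hd, x, ⟨y, hx⟩, hc⟩
      exact hz (hc.mem_within hV0 (hV d (mem_sdiff.1 (mem_powerset.1 hD hd)).1 _ _ hx))
    · have : ∀ x, ConnBy G F₀ x a ↔ ConnBy G F₀ x b := fun x =>
        ⟨fun h => h.tail ⟨e, he, hl⟩, fun h => h.tail ⟨e, he, hl.symm⟩⟩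
      simp [col, this]
  have h5 := card_le_card_of_injOn col hmaps hinj
  rw [card_powerset] at h5
  have h6 : 2 ^ (A \ F₀).card * 2 ^ F₀.card ≤ 2 ^ V.card := h4 ▸ Nat.mul_le_mul_right _ h5
  rwa [← pow_add, Nat.pow_le_pow_iff_right (by norm_num), card_sdiff_add_card_eq_card h1] at h6

/-- Hall's marriage theorem matches edges with incident vertices. The condition for a set of edges
is `IsPseudoforest.card_le`, with the set of their ends as `V`. -/
theorem IsPseudoforest.exists_orientation [Fintype α] [Nonempty α] (hG : IsPseudoforest G) {E : Finset β}
    (hE : (E : Set β) = G.edgeSet) : ∃ f, IsOrientation G f := by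
  classical
  have hall := (Finset.all_card_le_biUnion_card_iff_exists_injective
    (fun e : E => univ.filter fun v => G.Inc e v)).1 (fun s => by
      have := hG.card_le (V := s.biUnion fun e : E => univ.filter fun v => G.Inc e v)
        (A := s.map (Function.Embedding.subtype _)) (fun e he => by
          simp only [coe_map, Set.mem_image, mem_coe, Function.Embedding.coe_subtype] at he
          obtain ⟨e, -, rfl⟩ := he
          exact hE.subset e.2) (fun e he x y hl => by
          simp only [coe_map, Set.mem_image, mem_coe, Function.Embedding.coe_subtype] at he
          obtain ⟨e, he, rfl⟩ := he
          simp only [mem_biUnion, mem_filter, mem_univ, true_and]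
          exact ⟨e, he, hl.inc_left⟩)
      rwa [card_map] at this)
  obtain ⟨f, hf, hf'⟩ := hall
  obtain ⟨a⟩ := ‹Nonempty α›
  refine ⟨fun e => if h : e ∈ E then f ⟨e, h⟩ else a, fun e he e' he' heq => ?_, fun e he => ?_⟩
  · rw [← hE, mem_coe] at he he'
    simp only [he, he', dif_pos] at heq
    simpa using hf heq
  · rw [← hE, mem_coe] at he
    simpa [he] using hf' ⟨e, he⟩

end
end CutCount

namespace CutCount
open Finset

/-! ### The isolation lemma -/

section
variable {n : ℕ} {Ω : Type*} [Fintype Ω]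

/-- The weight of a set of vertices. -/
def weight (wt : Ω → ℕ) (w : Fin n → Ω) (S : Finset (Fin n)) : ℕ := ∑ v ∈ S, wt (w v)

/-- Some member of the family has a weight which no other member has. -/
def Isolates (wt : Ω → ℕ) (F : Set (Finset (Fin n))) (w : Fin n → Ω) : Prop :=
  ∃ S ∈ F, ∀ S' ∈ F, weight wt w S' = weight wt w S → S' = S

-- If isolation fails, two minimum sets differ at some vertex `v`. Then the weight of `v` is
-- determined by the weights of the other vertices, so this happens for at most a fraction `1 / |Ω|`
-- of all weightings. Summing over the vertices gives at most `n / |Ω| ≤ 1 / 2`.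
open Classical in
theorem isolation {wt : Ω → ℕ} (hwt : Function.Injective wt) (hn : 2 * n ≤ Fintype.card Ω)
    {F : Set (Finset (Fin n))} (hF : F.Nonempty) :
    2 * (univ.filter fun w => ¬ Isolates wt F w).card ≤ Fintype.card (Fin n → Ω) := by
  let IsMin : (Fin n → Ω) → Finset (Fin n) → Prop := fun w S =>
    S ∈ F ∧ ∀ S' ∈ F, weight wt w S ≤ weight wt w S'
  let Bad : Fin n → Finset (Fin n → Ω) := fun v =>
    univ.filter fun w => ∃ S S', IsMin w S ∧ IsMin w S' ∧ v ∈ S ∧ v ∉ S'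
  have hsub : (univ.filter fun w => ¬ Isolates wt F w) ⊆ univ.biUnion Bad := by
    intro w hw
    rw [mem_filter] at hw
    obtain ⟨S, hS, hmin⟩ := Set.exists_min_image F (weight wt w) (Set.toFinite F) hF
    have h1 : ∃ S' ∈ F, weight wt w S' = weight wt w S ∧ S' ≠ S := by
      by_contra hne
      push Not at hne
      exact hw.2 ⟨S, hS, hne⟩
    obtain ⟨S', hS', h2, h3⟩ := h1
    have m1 : IsMin w S := ⟨hS, hmin⟩
    have m2 : IsMin w S' := ⟨hS', fun T hT => h2 ▸ hmin T hT⟩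
    simp only [mem_biUnion, mem_univ, true_and, Bad, mem_filter]
    by_contra hne
    push Not at hne
    refine h3 (Subset.antisymm (fun v hv => ?_) fun v hv => ?_)
    · exact hne v S' S m2 m1 hv
    · exact hne v S S' m1 m2 hv
  have hBad : ∀ v, (Bad v).card * Fintype.card Ω ≤ Fintype.card (Fin n → Ω) := by
    intro v
    rw [← card_univ (α := Ω), ← card_product, ← card_univ]
    -- The weight of `v` is overwritten by an arbitrary element of `Ω`; it can be recovered from the
    -- others when the weighting is bad at `v`.
    refine card_le_card_of_injOn (fun p => Function.update p.1 v p.2) (fun _ _ => mem_univ _) ?_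
    rintro ⟨w₁, a₁⟩ h₁ ⟨w₂, a₂⟩ h₂ heq
    simp only [coe_product, Set.mem_prod, mem_coe, Bad, mem_filter, mem_univ, true_and,
      and_true] at h₁ h₂
    dsimp only at heq
    have hoff : ∀ u ≠ v, w₁ u = w₂ u := fun u hu => by
      simpa [hu] using congrFun heq u
    have ha : a₁ = a₂ := by simpa using congrFun heq v
    obtain ⟨S₁, T₁, ⟨s1, s1'⟩, ⟨t1, t1'⟩, hv1, hv1'⟩ := h₁
    obtain ⟨S₂, T₂, ⟨s2, s2'⟩, ⟨t2, t2'⟩, hv2, hv2'⟩ := h₂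
    have hout : ∀ T : Finset (Fin n), v ∉ T → weight wt w₁ T = weight wt w₂ T := fun T hT =>
      sum_congr rfl fun u hu => by rw [hoff u fun h => hT (h ▸ hu)]
    have hin : ∀ (w : Fin n → Ω) (T : Finset (Fin n)), v ∈ T →
        weight wt w T = wt (w v) + weight wt w (T.erase v) := fun w T hT =>
      (add_sum_erase T (fun u => wt (w u)) hT).symm
    have e1 := hout T₁ hv1'
    have e2 := hout T₂ hv2'
    have e3 := hout (S₁.erase v) (notMem_erase v _)
    have e4 := hout (S₂.erase v) (notMem_erase v _)
    have f1 := hin w₁ S₁ hv1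
    have f2 := hin w₁ S₂ hv2
    have f3 := hin w₂ S₁ hv1
    have f4 := hin w₂ S₂ hv2
    have g1 := s1' S₂ s2
    have g2 := s2' S₁ s1
    have g3 := t1' T₂ t2
    have g4 := t2' T₁ t1
    have g5 := s1' T₁ t1
    have g6 := t1' S₁ s1
    have g7 := s2' T₂ t2
    have g8 := t2' S₂ s2
    -- In both weightings this is the minimum over sets avoiding `v`, less the minimum over sets
    -- containing `v` of the weight of the rest; both minima depend on the other vertices only.
    have hwv : wt (w₁ v) = wt (w₂ v) := by omega
    refine Prod.ext (funext fun u => ?_) ha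
    by_cases hu : u = v
    · subst hu
      exact hwt hwv
    · exact hoff u hu
  have h1 := (card_le_card hsub).trans card_biUnion_le
  have h2 : (univ.filter fun w => ¬ Isolates wt F w).card * Fintype.card Ω ≤
      n * Fintype.card (Fin n → Ω) := by
    refine (Nat.mul_le_mul_right _ h1).trans ?_
    rw [sum_mul]
    refine (sum_le_sum fun v _ => hBad v).trans ?_
    simp
  rcases Nat.eq_zero_or_pos n with rfl | hpos
  · simp only [univ_eq_empty, sum_empty, Nat.le_zero] at h1
    rw [h1]
    exact Nat.zero_le _
  · refine Nat.le_of_mul_le_mul_left ?_ hpos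
    calc n * (2 * (univ.filter fun w => ¬ Isolates wt F w).card)
        = (univ.filter fun w => ¬ Isolates wt F w).card * (2 * n) := by ring
      _ ≤ _ := (Nat.mul_le_mul_left _ hn).trans h2

end

/-- The number with the given binary digits. -/
def bitsVal {b : ℕ} (ω : Fin b → Bool) : ℕ := ∑ j, (ω j).toNat * 2 ^ (j : ℕ)

theorem bitsVal_succ {b : ℕ} (ω : Fin (b + 1) → Bool) :
    bitsVal ω = (ω 0).toNat + 2 * bitsVal fun j => ω j.succ := by
  simp only [bitsVal, Fin.sum_univ_succ, mul_sum]
  refine congrArg₂ (· + ·) (by simp) (sum_congr rfl fun j _ => ?_)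
  rw [Fin.val_succ, pow_succ]
  ring

theorem bitsVal_injective : ∀ b : ℕ, Function.Injective (bitsVal (b := b))
  | 0, _, _, _ => Subsingleton.elim _ _
  | b + 1, ω, ω', h => by
    rw [bitsVal_succ, bitsVal_succ] at h
    have h0 : ω 0 = ω' 0 := by
      cases h1 : ω 0 <;> cases h2 : ω' 0 <;> simp [h1, h2] at h ⊢ <;> omega
    rw [h0] at h
    have h1 := bitsVal_injective b (show bitsVal (fun j => ω j.succ) = bitsVal fun j => ω' j.succ by
      omega)
    funext j
    refine Fin.cases h0 (fun j => ?_) j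
    exact congrFun h1 j

theorem bitsVal_lt : ∀ {b : ℕ} (ω : Fin b → Bool), bitsVal ω < 2 ^ b
  | 0, _ => by simp [bitsVal]
  | b + 1, ω => by
    rw [bitsVal_succ, pow_succ]
    have h1 := bitsVal_lt fun j => ω j.succ
    have h2 := Bool.toNat_le (ω 0)
    omega

/-! ### Independent repetitions -/

/-- A sequence of coins is determined by the outcomes of the `r` rounds and by the coins which no
round uses. Since at most half of the outcomes are bad, each round contributes a factor 1/2. -/
theorem card_all_rounds_bad {r T : ℕ} {κ : Type*} [Fintype κ] {emb : Fin r × κ → Fin T}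
    (hemb : Function.Injective emb) (Bad : Set (κ → Bool))
    (hBad : 2 * Bad.ncard ≤ 2 ^ Fintype.card κ) :
    {x : Fin T → Bool | ∀ i, (fun k => x (emb (i, k))) ∈ Bad}.ncard * 2 ^ r ≤ 2 ^ T := by
  classical
  have hC : Fintype.card {t : Fin T // t ∉ Set.range emb} + r * Fintype.card κ = T := by
    have h1 := Fintype.card_subtype_compl (fun t : Fin T => t ∈ Set.range emb)
    have h2 : Fintype.card {t : Fin T // t ∈ Set.range emb} = r * Fintype.card κ := by
      rw [← Fintype.card_congr (Equiv.ofInjective emb hemb)]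
      simp
    have h3 := Fintype.card_subtype_le (fun t : Fin T => t ∈ Set.range emb)
    rw [Fintype.card_fin] at h1 h3
    omega
  have h1 : {x : Fin T → Bool | ∀ i, (fun k => x (emb (i, k))) ∈ Bad}.ncard ≤
      Bad.ncard ^ r * 2 ^ Fintype.card {t : Fin T // t ∉ Set.range emb} := by
    have := Nat.card_le_card_of_injective
      (α := {x : Fin T → Bool | ∀ i, (fun k => x (emb (i, k))) ∈ Bad})
      (β := (Fin r → Bad) × ({t : Fin T // t ∉ Set.range emb} → Bool))
      (fun x => (fun i => ⟨_, x.2 i⟩, fun t => x.1 t)) (by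
        rintro ⟨x, hx⟩ ⟨y, hy⟩ h
        simp only [Prod.mk.injEq] at h
        refine Subtype.ext (funext fun t => ?_)
        by_cases ht : t ∈ Set.range emb
        · obtain ⟨⟨i, k⟩, rfl⟩ := ht
          exact congrFun (congrArg Subtype.val (congrFun h.1 i)) k
        · exact congrFun h.2 ⟨t, ht⟩)
    rw [Nat.card_prod, Nat.card_fun, Nat.card_fun, Nat.card_eq_fintype_card (α := Fin r),
      Nat.card_eq_fintype_card (α := Bool), Nat.card_coe_set_eq, Nat.card_coe_set_eq,
      Nat.card_eq_fintype_card (α := {t : Fin T // t ∉ Set.range emb}), Fintype.card_fin, Fintype.card_bool] at this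
    exact this
  calc _ ≤ Bad.ncard ^ r * 2 ^ Fintype.card {t : Fin T // t ∉ Set.range emb} * 2 ^ r :=
        Nat.mul_le_mul_right _ h1
    _ = (2 * Bad.ncard) ^ r * 2 ^ Fintype.card {t : Fin T // t ∉ Set.range emb} := by
        rw [mul_pow]; ring
    _ ≤ (2 ^ Fintype.card κ) ^ r * 2 ^ Fintype.card {t : Fin T // t ∉ Set.range emb} :=
        Nat.mul_le_mul_right _ (Nat.pow_le_pow_left hBad r)
    _ = 2 ^ T := by
        rw [← pow_mul, ← pow_add]
        congr 1
        rw [mul_comm, add_comm]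
        exact hC

theorem le_coinProb {r T s : ℕ} {κ : Type*} [Fintype κ] {emb : Fin r × κ → Fin T}
    (hemb : Function.Injective emb) (Good : Set (κ → Bool))
    (hGood : 2 * Goodᶜ.ncard ≤ 2 ^ Fintype.card κ) {A : Set (Fin T → Bool)}
    (hA : ∀ x i, (fun k => x (emb (i, k))) ∈ Good → x ∈ A) (hs : s ≤ r) :
    1 - (1 / 2 : ℝ) ^ s ≤ coinProb T A := by
  have h1 := card_all_rounds_bad hemb _ hGood
  have h2 : Aᶜ.ncard ≤ {x : Fin T → Bool | ∀ i, (fun k => x (emb (i, k))) ∈ Goodᶜ}.ncard := by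
    refine Set.ncard_le_ncard (fun x hx i hi => hx (hA x i hi)) (Set.toFinite _)
  have h3 := Set.ncard_add_ncard_compl A
  rw [Nat.card_fun, Nat.card_eq_fintype_card, Nat.card_eq_fintype_card, Fintype.card_bool,
    Fintype.card_fin] at h3
  have h4 : Aᶜ.ncard * 2 ^ s ≤ 2 ^ T :=
    (Nat.mul_le_mul h2 (Nat.pow_le_pow_right (by norm_num) hs)).trans h1
  have h5 : (A.ncard : ℝ) + Aᶜ.ncard = 2 ^ T := by exact_mod_cast h3
  have h6 : (Aᶜ.ncard : ℝ) * 2 ^ s ≤ 2 ^ T := by exact_mod_cast h4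
  have hT : (0 : ℝ) < 2 ^ T := by positivity
  have hS : (0 : ℝ) < 2 ^ s := by positivity
  rw [coinProb, le_div_iff₀ hT, one_div, inv_pow, sub_mul, one_mul, sub_le_iff_le_add, ← h5,
    add_le_add_iff_left, h5, inv_mul_eq_div, le_div_iff₀ hS]
  exact h6

end CutCount

namespace CutCount
open Finset

/-! ### Merging the leaves of a tree decomposition -/

section
variable {N : ℕ} {T : SimpleGraph (Fin N)}

/-- `x` is a leaf of the subgraph induced by `Q`, and `y` is its neighbour. -/
def IsLeafAt (T : SimpleGraph (Fin N)) (Q : Finset (Fin N)) (x y : Fin N) : Prop :=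
  x ∈ Q ∧ y ∈ Q ∧ T.Adj x y ∧ ∀ z ∈ Q, T.Adj x z → z = y

theorem exists_isLeafAt (hT : T.IsAcyclic) {Q : Finset (Fin N)}
    (hQ : (T.induce (Q : Set (Fin N))).Connected) (hcard : 2 ≤ Q.card) : ∃ x y, IsLeafAt T Q x y := by
  classical
  have htree : (T.induce (Q : Set (Fin N))).IsTree := ⟨hQ, hT.induce _⟩
  have : Nontrivial (Q : Set (Fin N)) := by
    obtain ⟨a, ha, b, hb, hab⟩ := one_lt_card.1 hcard
    exact ⟨⟨a, ha⟩, ⟨b, hb⟩, fun h => hab (congrArg Subtype.val h)⟩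
  obtain ⟨⟨x, hx⟩, hdeg⟩ := htree.exists_vert_degree_one_of_nontrivial
  rw [SimpleGraph.degree_eq_one_iff_existsUnique_adj] at hdeg
  obtain ⟨⟨y, hy⟩, hxy, huniq⟩ := hdeg
  exact ⟨x, y, hx, hy, hxy, fun z hz hxz => congrArg Subtype.val (huniq ⟨z, hz⟩ hxz)⟩

theorem IsLeafAt.connected_erase {Q : Finset (Fin N)} {x y : Fin N} (h : IsLeafAt T Q x y)
    (hQ : (T.induce (Q : Set (Fin N))).Connected) :
    (T.induce ((Q.erase x : Finset (Fin N)) : Set (Fin N))).Connected := by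
  obtain ⟨hx, hy, hxy, huniq⟩ := h
  have h1 := hQ.preconnected.induce_of_degree_eq_one (s := {z | z.1 ≠ x}) (by
    rintro ⟨v, hv⟩ hvx ⟨a, ha⟩ haa ⟨b, hb⟩ hbb
    obtain rfl : v = x := by simpa using hvx
    exact Subtype.ext ((huniq a ha haa).trans (huniq b hb hbb).symm))
  have hyx : y ≠ x := fun h => hxy.ne h.symm
  refine (SimpleGraph.connected_iff _).2 ⟨?_, ⟨y, by simp [hyx, hy]⟩⟩
  rintro ⟨a, ha⟩ ⟨b, hb⟩
  rw [mem_coe, mem_erase] at ha hb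
  have h2 := h1 ⟨⟨a, ha.2⟩, ha.1⟩ ⟨⟨b, hb.2⟩, hb.1⟩
  let f : (T.induce (Q : Set (Fin N))).induce {z | z.1 ≠ x} →g
      T.induce ((Q.erase x : Finset (Fin N)) : Set (Fin N)) :=
    ⟨fun z => ⟨z.1.1, by
      rw [mem_coe, mem_erase]
      exact ⟨z.2, z.1.2⟩⟩, fun h => h⟩
  exact h2.map f

/-- The unique path from `x` to `z` runs inside both `Q` and `P`, and its second vertex is a
neighbour of `x` in `Q`, that is `y`. With `P` the set of nodes whose bags contain a given vertex,
this shows that whatever the bag of a leaf shares with another remaining bag lies in the bag of its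
neighbour. -/
theorem IsLeafAt.mem_of_connected {Q : Finset (Fin N)} {x y : Fin N} (h : IsLeafAt T Q x y)
    (hT : T.IsAcyclic) (hQ : (T.induce (Q : Set (Fin N))).Connected) {P : Set (Fin N)}
    (hP : (T.induce P).Connected) {z : Fin N} (hz : z ∈ Q) (hzx : z ≠ x) (hxP : x ∈ P)
    (hzP : z ∈ P) : y ∈ P := by
  classical
  have key : ∀ A : Set (Fin N), (T.induce A).Connected → x ∈ A → z ∈ A →
      ∃ p : T.Path x z, ∀ w ∈ p.1.support, w ∈ A := by
    intro A hA hx hz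
    obtain ⟨p⟩ := hA.preconnected ⟨x, hx⟩ ⟨z, hz⟩
    refine ⟨(p.map (SimpleGraph.Embedding.induce A).toHom).toPath, fun w hw => ?_⟩
    have h1 := SimpleGraph.Walk.support_toPath_subset_support _ hw
    have h2 : w ∈ p.support.map (SimpleGraph.Embedding.induce A).toHom :=
      (congrArg (w ∈ ·) (SimpleGraph.Walk.support_map (SimpleGraph.Embedding.induce A).toHom p)).mp h1
    obtain ⟨u, -, rfl⟩ := List.mem_map.1 h2
    exact u.2
  obtain ⟨p, hp⟩ := key Q hQ h.1 hz
  obtain ⟨q, hq⟩ := key P hP hxP hzP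
  obtain rfl := (hT.subsingleton_path x z).elim p q
  have hnil : ¬ p.1.Nil := SimpleGraph.Walk.not_nil_of_ne hzx.symm
  have hadj := p.1.adj_snd hnil
  have hmem := SimpleGraph.Walk.snd_mem_tail_support hnil
  have hmem' := List.mem_of_mem_tail hmem
  have := h.2.2.2 _ (hp _ hmem') hadj
  rw [← this]
  exact hq _ hmem'

end

/-! ### Eliminating one bag from a sum of products -/

section
variable {n N : ℕ} {A : Type*} [CommSemiring A]

/-- The functions with values in `{0, 1, 2}` which vanish outside of `U`. -/
def assignments (U : Finset (Fin n)) : Finset (Fin n → ℕ) :=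
  Fintype.piFinset fun v => if v ∈ U then range 3 else {0}

theorem mem_assignments {U : Finset (Fin n)} {σ : Fin n → ℕ} :
    σ ∈ assignments U ↔ (∀ v, σ v < 3) ∧ ∀ v ∉ U, σ v = 0 := by
  rw [assignments, Fintype.mem_piFinset, ← forall_and]
  refine forall_congr' fun v => ?_
  by_cases hv : v ∈ U
  · simp [hv]
  · simp only [hv, if_false, mem_singleton, not_false_eq_true, true_imp_iff]
    omega

/-- The restriction of an assignment to `U`. -/
def restrictTo (U : Finset (Fin n)) (σ : Fin n → ℕ) : Fin n → ℕ := fun v => if v ∈ U then σ v else 0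

theorem restrictTo_mem {U : Finset (Fin n)} {σ : Fin n → ℕ} (h : ∀ v, σ v < 3) :
    restrictTo U σ ∈ assignments U := by
  rw [mem_assignments]
  refine ⟨fun v => ?_, fun v hv => if_neg hv⟩
  unfold restrictTo
  split_ifs
  · exact h v
  · norm_num

/-- This is distributivity. An assignment for all bags is an assignment `σ` for the other bags
together with an assignment `τ` for the bag of `x` which agrees with `σ` on the overlap. By `hsep`
the overlap lies in the bag of `y`, so the sum over `τ` can be moved into the factor of `y`. -/
theorem sum_prod_merge {Q : Finset (Fin N)} {bag : Fin N → Finset (Fin n)} {x y : Fin N}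
    (hx : x ∈ Q) (hy : y ∈ Q) (hxy : x ≠ y)
    (hsep : ∀ z ∈ Q, z ≠ x → ∀ v, v ∈ bag x → v ∈ bag z → v ∈ bag y)
    {f f' : Fin N → (Fin n → ℕ) → A}
    (hloc : ∀ z ∈ Q, ∀ σ τ, (∀ v ∈ bag z, σ v = τ v) → f z σ = f z τ)
    (hf : ∀ z ∈ Q, z ≠ y → ∀ σ, f' z σ = f z σ)
    (hf' : ∀ σ, (∀ v, σ v < 3) → f' y σ = f y σ * ∑ τ ∈ assignments (bag x) with
      ∀ v ∈ bag x, v ∈ bag y → τ v = σ v, f x τ) :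
    ∑ σ ∈ assignments (Q.biUnion bag), ∏ z ∈ Q, f z σ =
      ∑ σ ∈ assignments ((Q.erase x).biUnion bag), ∏ z ∈ Q.erase x, f' z σ := by
  classical
  set U := (Q.erase x).biUnion bag with hU
  have hU' : Q.biUnion bag = U ∪ bag x := by
    rw [hU, ← insert_erase hx, biUnion_insert, erase_insert (by simp)]
    exact union_comm _ _
  have hint : ∀ v ∈ U, v ∈ bag x → v ∈ bag y := by
    intro v hv hvx
    rw [hU, mem_biUnion] at hv
    obtain ⟨z, hz, hvz⟩ := hv
    exact hsep z (mem_of_mem_erase hz) (ne_of_mem_erase hz) v hvx hvz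
  have hyU : ∀ v ∈ bag y, v ∈ U := fun v hv =>
    mem_biUnion.2 ⟨y, mem_erase.2 ⟨hxy.symm, hy⟩, hv⟩
  have hR : ∀ σ ∈ assignments U, ∏ z ∈ Q.erase x, f' z σ =
      ∑ τ ∈ assignments (bag x) with ∀ v ∈ bag x, v ∈ bag y → τ v = σ v,
        (∏ z ∈ Q.erase x, f z σ) * f x τ := by
    intro σ hσ
    have hye : y ∈ Q.erase x := mem_erase.2 ⟨hxy.symm, hy⟩
    rw [← mul_prod_erase _ _ hye, hf' σ (mem_assignments.1 hσ).1, ← mul_sum,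
      ← mul_prod_erase _ (fun z => f z σ) hye, prod_congr rfl (g := fun z => f z σ) fun z hz => ?_]
    · ring
    · exact hf z (mem_of_mem_erase (mem_of_mem_erase hz)) (ne_of_mem_erase hz) σ
  rw [sum_congr rfl hR, hU', sum_sigma']
  refine sum_bij' (fun ρ _ => ⟨restrictTo U ρ, restrictTo (bag x) ρ⟩)
    (fun p _ v => if v ∈ U then p.1 v else p.2 v) ?_ ?_ ?_ ?_ ?_
  · intro ρ hρ
    rw [mem_assignments] at hρ
    rw [mem_sigma, mem_filter]
    refine ⟨restrictTo_mem hρ.1, restrictTo_mem hρ.1, fun v hv hv' => ?_⟩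
    simp [restrictTo, hv, hyU v hv']
  · rintro ⟨σ, τ⟩ hp
    rw [mem_sigma, mem_filter, mem_assignments, mem_assignments] at hp
    rw [mem_assignments]
    refine ⟨fun v => ?_, fun v hv => ?_⟩
    · dsimp only
      split_ifs
      exacts [hp.1.1 v, hp.2.1.1 v]
    · rw [mem_union, not_or] at hv
      rw [if_neg hv.1]
      exact hp.2.1.2 v hv.2
  · intro ρ hρ
    rw [mem_assignments] at hρ
    funext v
    by_cases h1 : v ∈ U
    · simp [h1, restrictTo]
    · by_cases h2 : v ∈ bag x
      · simp [h1, h2, restrictTo]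
      · simp [h1, h2, restrictTo, hρ.2 v (by simp [h1, h2])]
  · rintro ⟨σ, τ⟩ hp
    rw [mem_sigma, mem_filter, mem_assignments, mem_assignments] at hp
    obtain ⟨h1, h2, h3⟩ := hp
    dsimp only at h1 h2 h3
    have e1 : restrictTo U (fun v => if v ∈ U then σ v else τ v) = σ := by
      funext v
      by_cases hv : v ∈ U <;> simp [restrictTo, hv]
      exact (h1.2 v hv).symm
    have e2 : restrictTo (bag x) (fun v => if v ∈ U then σ v else τ v) = τ := by
      funext v
      by_cases hv : v ∈ bag x
      · by_cases hv' : v ∈ U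
        · simp [restrictTo, hv, hv', h3 v hv (hint v hv' hv)]
        · simp [restrictTo, hv, hv']
      · simp [restrictTo, hv, h2.2 v hv]
    simp only [e1, e2]
  · intro ρ hρ
    dsimp only
    rw [← mul_prod_erase _ _ hx, mul_comm]
    congr 1
    · refine prod_congr rfl fun z hz => hloc z (mem_of_mem_erase hz) _ _ fun v hv => ?_
      have : v ∈ U := mem_biUnion.2 ⟨z, hz, hv⟩
      simp [restrictTo, this]
    · exact hloc x hx _ _ fun v hv => by simp [restrictTo, hv]

/-- The node at which an object is taken into account: the first one which satisfies `P`. -/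
def IsFirst (P : Fin N → Prop) (x : Fin N) : Prop := P x ∧ ∀ z < x, ¬ P z

-- A vertex or an edge may occur in many bags but has to contribute exactly once, and exactly one
-- node is the first.
open Classical in
theorem prod_isFirst {P : Fin N → Prop} (hP : ∃ x, P x) (g : Fin N → A) (a : A)
    (hg : ∀ x, IsFirst P x → g x = a) : (∏ x, if IsFirst P x then g x else 1) = a := by
  obtain ⟨x₀, h0⟩ : ∃ x, IsFirst P x := by
    obtain ⟨x, hx, hmin⟩ := exists_minimal_of_wellFoundedLT P hP
    exact ⟨x, hx, fun z hz h => absurd (hmin h hz.le) (not_le.2 hz)⟩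
  have huniq : ∀ x, IsFirst P x → x = x₀ := by
    intro x h
    rcases lt_trichotomy x x₀ with h' | h' | h'
    · exact absurd h.1 (h0.2 x h')
    · exact h'
    · exact absurd h0.1 (h.2 x₀ h')
  rw [prod_eq_single x₀ (fun x _ hx => if_neg fun h => hx (huniq x h)) (by simp), if_pos h0, hg x₀ h0]

end
end CutCount

namespace CutCount
open Finset

/-! ### The algorithm -/

section Defs

/-- The vertex `v` is in the bag of `x`. -/
def inB (o : ℕ) (h : Mem) (x v : ℕ) : Prop := h (o + 3) (x * h 1 0 + v) ≠ 0

instance (o : ℕ) (h : Mem) (x v : ℕ) : Decidable (inB o h x v) := by unfold inB; infer_instance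

/-- The number of vertices below `v` in the bag of `x`. -/
def rk (o : ℕ) (h : Mem) (x v : ℕ) : ℕ :=
  ∑ u ∈ range (h 1 0), if u < v ∧ inB o h x u then 1 else 0

/-- The number of assignments for the bag of `x`. -/
def asgCount (o : ℕ) (h : Mem) (x : ℕ) : ℕ := 3 ^ rk o h x (h 1 0)

/-- The value at `v` of the assignment number `j` for the bag of `x`. -/
def dg (o : ℕ) (h : Mem) (x j v : ℕ) : ℕ := j / 3 ^ rk o h x v % 3

/-- The code of the restriction of the assignment number `j` for the bag of `x` to the bag of `y`. -/
def code (o : ℕ) (h : Mem) (x y j : ℕ) : ℕ :=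
  ∑ v ∈ range (h 1 0), if inB o h x v ∧ inB o h y v then dg o h x j v * 3 ^ v else 0

/-- `x` is the first node whose bag contains `v`. -/
def ownV (o : ℕ) (h : Mem) (x v : ℕ) : Prop := inB o h x v ∧ ∀ z < h 1 2, z < x → ¬ inB o h z v

/-- The bag of `x` contains the ends of the edge `e`. -/
def hasE (o : ℕ) (h : Mem) (x e : ℕ) : Prop := inB o h x (h o e) ∧ inB o h x (h (o + 1) e)

/-- `x` is the first node whose bag contains the ends of the edge `e`. -/
def ownE (o : ℕ) (h : Mem) (x e : ℕ) : Prop := hasE o h x e ∧ ∀ z < h 1 2, z < x → ¬ hasE o h z e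

open Classical in
/-- The contribution of the node `x`, for the assignment number `j` for its bag. -/
noncomputable def localFactor (o : ℕ) (aF : ℕ → ℕ → ℕ → Mem → ℕ) (bF : ℕ → ℕ → Mem → ℕ) (r x j : ℕ)
    (h : Mem) : ℕ :=
  (∏ v ∈ range (h 1 0), if ownV o h x v then aF r v (dg o h x j v) h else 1) *
    ∏ e ∈ range (h 1 1), if ownE o h x e then
      bF (dg o h x j (h o e)) (dg o h x j (h (o + 1) e)) h else 1

/-- Write `a`, reduced modulo the modulus. -/
def put (x i a : ℕ) (h : Mem) : Mem := h.set x i (a % (h 9 0 + 1))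

/-- Run `F j` for all assignments `j` for the bag of `x`. -/
def forAsg (o x : ℕ) (F : ℕ → Mem → Mem) (h : Mem) : Mem :=
  floop (fun i h => (fun h => if h 16 0 < asgCount o h x then F (h 16 0) h else h) (h.set 16 0 i))
    (h 9 1) h

/-- All tables share array `12`: entry `j` of the table of `x` is in cell `j * N + x`, where `N` is
the number of nodes. Array `14` marks the nodes which have not been merged yet. -/
noncomputable def initTables (o : ℕ) (aF : ℕ → ℕ → ℕ → Mem → ℕ) (bF : ℕ → ℕ → Mem → ℕ) (r : ℕ)
    (h : Mem) : Mem :=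
  floop (fun x h => forAsg o x (fun j h => put 12 (j * h 1 2 + x) (localFactor o aF bF r x j h) h)
    (put 14 x 1 h)) (h 1 2) h

/-- Merge the table of `x` into the table of `y`. -/
def mergeTables (o x y : ℕ) (h : Mem) : Mem :=
  -- Evaluation is from the bottom up: clear the cells of array `13` which `y` will read, collect
  -- the entries of `x` by their restriction to the common vertices, and multiply them into the
  -- table of `y`. The two tables are scanned one after the other, not against each other.
  forAsg o y (fun j h => put 12 (j * h 1 2 + y) (h 12 (j * h 1 2 + y) * h 13 (code o h y x j)) h)
    (forAsg o x (fun j h => put 13 (code o h x y j) (h 13 (code o h x y j) + h 12 (j * h 1 2 + x)) h)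
      (forAsg o y (fun j h => put 13 (code o h y x j) 0 h) h))

/-- `y` is a neighbour of `x` in the remaining tree. -/
def nbr (o : ℕ) (h : Mem) (x y : ℕ) : Prop := h 14 y ≠ 0 ∧ h (o + 2) (x * h 1 2 + y) ≠ 0

open Classical in
/-- `x` is a leaf of the remaining tree. -/
def isLeaf (o : ℕ) (h : Mem) (x : ℕ) : Prop :=
  h 14 x ≠ 0 ∧ (∑ y ∈ range (h 1 2), if nbr o h x y then 1 else 0) = 1

open Classical in
/-- If `x` is a leaf, then merge it into its neighbour. -/
noncomputable def leafStep (o x : ℕ) (h : Mem) : Mem :=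
  if isLeaf o h x then
    put 14 x 0 (floop (fun y h => if nbr o h x y then mergeTables o x y h else h) (h 1 2) h)
  else h

/-- As many passes as there are nodes suffice, because each pass merges at least one leaf while two
nodes remain. -/
noncomputable def mergeAll (o : ℕ) (h : Mem) : Mem :=
  floop (fun _ h => floop (fun x h => leafStep o x h) (h 1 2) h) (h 1 2) h

def sumTables (o : ℕ) (h : Mem) : Mem :=
  (fun h => floop (fun x h => if h 14 x ≠ 0 then
    forAsg o x (fun j h => put 15 0 (h 15 0 + h 12 (j * h 1 2 + x)) h) h else h) (h 1 2) h)
    (put 15 0 0 h)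

/-- Compute the partition function. -/
noncomputable def partition (o : ℕ) (aF : ℕ → ℕ → ℕ → Mem → ℕ) (bF : ℕ → ℕ → Mem → ℕ) (r : ℕ)
    (h : Mem) : Mem :=
  sumTables o (mergeAll o (initTables o aF bF r h))

/-- The coefficient with the given index passes the test. -/
def accept (tF : ℕ → Mem → ℕ) (i : ℕ) (h : Mem) : Prop :=
  -- The index is also taken from memory, where nothing bounds it a priori; the cap keeps the power
  -- at polynomial length.
  h 15 0 / h 9 2 ^ (if i < h 8 4 then i else 0) % 2 ^ tF i h ≠ 0

-- Cell `1` of array `17` tells whether some index was accepted, and cell `2` keeps the last such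
-- index.
open Classical in
noncomputable def search (tF : ℕ → Mem → ℕ) (h : Mem) : Mem :=
  (fun h => floop (fun i h => if accept tF i h then put 17 2 i (put 17 1 1 h) else h) (h 8 4) h)
    (put 17 1 0 h)

open Classical in
/-- Decide for the vertices, one after the other, whether they belong to the solution. -/
noncomputable def descend (o : ℕ) (aF : ℕ → ℕ → ℕ → Mem → ℕ) (bF : ℕ → ℕ → Mem → ℕ)
    (tF : ℕ → Mem → ℕ) (r : ℕ) (h : Mem) : Mem :=
  -- In array `11` the value 0 means undecided, 1 means in the solution, and 2 means outside.
  -- Membership is tried first; exclusion needs no test of its own.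
  floop (fun v h => (fun h => if accept tF (h 17 2) h then h else put 11 v 2 h)
    (partition o aF bF r (put 11 v 1 h))) (h 1 0) h

def report (h : Mem) : Mem :=
  (fun h => floop (fun v h => put 0 (v + 1) (if h 11 v = 1 then 1 else 0) h) (h 1 0) h) (put 0 0 1 h)

-- A round without an accepted index does not touch array `0`, so an answer found earlier survives.
open Classical in
noncomputable def round (o : ℕ) (aF : ℕ → ℕ → ℕ → Mem → ℕ) (bF : ℕ → ℕ → Mem → ℕ) (tF : ℕ → Mem → ℕ)
    (r : ℕ) (h : Mem) : Mem :=
  (fun h => if h 17 1 ≠ 0 then report (descend o aF bF tF r h) else h)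
    (search tF (partition o aF bF r (floop (fun v h => put 11 v 0 h) (h 1 0) h)))

noncomputable def rounds (o : ℕ) (aF : ℕ → ℕ → ℕ → Mem → ℕ) (bF : ℕ → ℕ → Mem → ℕ)
    (tF : ℕ → Mem → ℕ) (h : Mem) : Mem :=
  floop (fun r h => round o aF bF tF r h) (h 8 1) h

end Defs

/-! ### Its running time -/

/-- Closure of computability under a function of three numbers and the memory. -/
def CompFun3 (f : ℕ → ℕ → ℕ → Mem → ℕ) : Prop :=
  ∀ {Γ : Type} [Ctx Γ] {a b c : Γ → Mem → ℕ}, Comp a → Comp b → Comp c →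
    Comp fun γ h => f (a γ h) (b γ h) (c γ h) h

def CompFun2 (f : ℕ → ℕ → Mem → ℕ) : Prop :=
  ∀ {Γ : Type} [Ctx Γ] {a b : Γ → Mem → ℕ}, Comp a → Comp b → Comp fun γ h => f (a γ h) (b γ h) h

def CompFun1 (f : ℕ → Mem → ℕ) : Prop :=
  ∀ {Γ : Type} [Ctx Γ] {a : Γ → Mem → ℕ}, Comp a → Comp fun γ h => f (a γ h) h

def NumFun1 (f : ℕ → Mem → ℕ) : Prop :=
  ∀ {Γ : Type} [Ctx Γ] {a : Γ → Mem → ℕ}, Num fun γ h => f (a γ h) h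

section
variable {Γ : Type} [Ctx Γ]

theorem Comp.cell (x i : ℕ) (hx : x ≠ 20) : Comp fun (_ : Γ) h => h x i := Comp.get hx (Comp.const i)

theorem Comp.numV : Comp fun (_ : Γ) h => h 1 0 := Comp.cell 1 0 (by decide)
theorem Comp.numE : Comp fun (_ : Γ) h => h 1 1 := Comp.cell 1 1 (by decide)
theorem Comp.numN : Comp fun (_ : Γ) h => h 1 2 := Comp.cell 1 2 (by decide)
theorem Num.numV : Num fun (_ : Γ) h => h 1 0 := Num.input (by decide)
theorem Num.numE : Num fun (_ : Γ) h => h 1 1 := Num.input (by decide)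
theorem Num.numN : Num fun (_ : Γ) h => h 1 2 := Num.input (by decide)

variable {o : ℕ} (ho : o ≤ 3)
include ho

theorem CompP.inB {x v : Γ → Mem → ℕ} (hx : Comp x) (hv : Comp v) :
    CompP fun γ h => inB o h (x γ h) (v γ h) :=
  (CompP.eq (Comp.get (by omega) ((hx.mul Comp.numV).add hv)) (Comp.const 0)).not

theorem Comp.rk {x v : Γ → Mem → ℕ} (hx : Comp x) (hv : Comp v) :
    Comp fun γ h => rk o h (x γ h) (v γ h) :=
  Comp.sum Comp.numV Num.numV
    (Comp.ite ((CompP.lt Comp.last hv.wk).and (CompP.inB ho hx.wk Comp.last)) (Comp.const 1)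
      (Comp.const 0))

omit ho in
theorem Num.rk (x v : Γ → Mem → ℕ) : Num fun γ h => rk o h (x γ h) (v γ h) :=
  Num.numV.of_le fun γ h => by
    refine (sum_le_card_nsmul _ _ 1 fun i _ => ?_).trans (by simp)
    split_ifs <;> simp

theorem Comp.asgCount {x : Γ → Mem → ℕ} (hx : Comp x) : Comp fun γ h => asgCount o h (x γ h) :=
  Comp.pow (Comp.const 3) (Comp.rk ho hx Comp.numV) (Num.rk _ _)

theorem Comp.dg {x j v : Γ → Mem → ℕ} (hx : Comp x) (hj : Comp j) (hv : Comp v) :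
    Comp fun γ h => dg o h (x γ h) (j γ h) (v γ h) :=
  (hj.div (Comp.pow (Comp.const 3) (Comp.rk ho hx hv) (Num.rk _ _))).mod (Comp.const 3)

theorem Comp.code {x y j : Γ → Mem → ℕ} (hx : Comp x) (hy : Comp y) (hj : Comp j) :
    Comp fun γ h => code o h (x γ h) (y γ h) (j γ h) :=
  Comp.sum Comp.numV Num.numV
    (Comp.ite ((CompP.inB ho hx.wk Comp.last).and (CompP.inB ho hy.wk Comp.last))
      ((Comp.dg ho hx.wk hj.wk Comp.last).mul (Comp.pow (Comp.const 3) Comp.last Num.last))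
      (Comp.const 0))

omit ho in
theorem CompP.imp {P Q : Γ → Mem → Prop} (hP : CompP P) (hQ : CompP Q) :
    CompP fun γ h => P γ h → Q γ h :=
  (hP.not.or hQ).congr fun γ h => by tauto

theorem CompP.ownV {x v : Γ → Mem → ℕ} (hx : Comp x) (hv : Comp v) :
    CompP fun γ h => ownV o h (x γ h) (v γ h) :=
  (CompP.inB ho hx hv).and (CompP.ball Comp.numN Num.numN
    ((CompP.lt Comp.last hx.wk).imp (CompP.inB ho Comp.last hv.wk).not))

theorem CompP.hasE {x e : Γ → Mem → ℕ} (hx : Comp x) (he : Comp e) :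
    CompP fun γ h => hasE o h (x γ h) (e γ h) :=
  (CompP.inB ho hx (Comp.get (by omega) he)).and (CompP.inB ho hx (Comp.get (by omega) he))

theorem CompP.ownE {x e : Γ → Mem → ℕ} (hx : Comp x) (he : Comp e) :
    CompP fun γ h => ownE o h (x γ h) (e γ h) :=
  (CompP.hasE ho hx he).and (CompP.ball Comp.numN Num.numN
    ((CompP.lt Comp.last hx.wk).imp (CompP.hasE ho Comp.last he.wk).not))

variable {aF : ℕ → ℕ → ℕ → Mem → ℕ} {bF : ℕ → ℕ → Mem → ℕ} {tF : ℕ → Mem → ℕ}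

theorem Comp.localFactor (ha : CompFun3 aF) (hb : CompFun2 bF) {r x j : Γ → Mem → ℕ} (hr : Comp r)
    (hx : Comp x) (hj : Comp j) :
    Comp fun γ h => localFactor o aF bF (r γ h) (x γ h) (j γ h) h := by
  classical
  refine Comp.mul (Comp.prod Comp.numV Num.numV (Comp.ite (CompP.ownV ho hx.wk Comp.last)
    (ha hr.wk Comp.last (Comp.dg ho hx.wk hj.wk Comp.last)) (Comp.const 1)))
    (Comp.prod Comp.numE Num.numE (Comp.ite (CompP.ownE ho hx.wk Comp.last)
      (hb (Comp.dg ho hx.wk hj.wk (Comp.get (by omega) Comp.last))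
        (Comp.dg ho hx.wk hj.wk (Comp.get (by omega) Comp.last))) (Comp.const 1)))

omit ho in
theorem CompS.put {x : ℕ} (hx : x ≠ 1 ∧ x ≠ 8 ∧ x ≠ 9 ∧ x ≠ 20) {a b : Γ → Mem → ℕ}
    (ha : Comp a) (hb : Comp b) : CompS 0 fun γ h => put x (a γ h) (b γ h) h :=
  CompS.write hx ha hb

omit ho in
theorem CompS.comp {lev : ℕ} {F G : Γ → Mem → Mem} (hG : CompS lev G) (hF : CompS lev F) :
    CompS lev fun γ h => G γ (F γ h) := hF.seq hG

/-- Only here does the level rise. As these loops are never nested, the whole algorithm stays at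
level 1. -/
theorem CompS.forAsg {lev : ℕ} {x : Γ → ℕ} (hx : Comp fun γ _ => x γ) {F : Γ → ℕ → Mem → Mem}
    (hF : CompS lev fun γ h => F γ (h 16 0) h) :
    CompS (lev + 1) fun γ h => forAsg o (x γ) (F γ) h :=
  CompS.bigLoop (F := fun γ h => if h 16 0 < asgCount o h (x γ) then F γ (h 16 0) h else h)
    (CompS.ite (CompP.lt (Comp.cell 16 0 (by decide)) (Comp.asgCount ho hx)) hF
      (CompS.skip.up (Nat.zero_le _)))

omit ho in
theorem Comp.addr {j x : Γ → Mem → ℕ} (hj : Comp j) (hx : Comp x) :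
    Comp fun γ h => j γ h * h 1 2 + x γ h := (hj.mul Comp.numN).add hx

omit ho in
theorem Comp.loopVar : Comp fun (_ : Γ) h => h 16 0 := Comp.cell 16 0 (by decide)

theorem CompS.initTables (ha : CompFun3 aF) (hb : CompFun2 bF) {r : Γ → ℕ}
    (hr : Comp fun γ _ => r γ) : CompS 1 fun γ h => initTables o aF bF (r γ) h :=
  CompS.loop Comp.numN Num.numN (CompS.comp
    (CompS.forAsg ho Comp.last (F := fun γ j h => CutCount.put 12 (j * h 1 2 + γ.2)
      (CutCount.localFactor o aF bF (r γ.1) γ.2 j h) h)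
      (CompS.put (x := 12) (by decide) (Comp.addr Comp.loopVar Comp.last)
        (Comp.localFactor ho ha hb hr.wk Comp.last Comp.loopVar)))
    ((CompS.put (x := 14) (by decide) Comp.last (Comp.const 1)).up (Nat.zero_le _)))

theorem CompS.mergeTables {x y : Γ → ℕ} (hx : Comp fun γ _ => x γ) (hy : Comp fun γ _ => y γ) :
    CompS 1 fun γ h => mergeTables o (x γ) (y γ) h := by
  have := CompS.comp (CompS.forAsg ho hy (F := fun γ j h => CutCount.put 12 (j * h 1 2 + y γ)
      (h 12 (j * h 1 2 + y γ) * h 13 (CutCount.code o h (y γ) (x γ) j)) h)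
      (CompS.put (x := 12) (by decide) (Comp.addr Comp.loopVar hy)
        ((Comp.get (x := 12) (by decide) (Comp.addr Comp.loopVar hy)).mul
          (Comp.get (x := 13) (by decide) (Comp.code ho hy hx Comp.loopVar)))))
    (CompS.comp (CompS.forAsg ho hx (F := fun γ j h => CutCount.put 13
      (CutCount.code o h (x γ) (y γ) j)
      (h 13 (CutCount.code o h (x γ) (y γ) j) + h 12 (j * h 1 2 + x γ)) h)
      (CompS.put (x := 13) (by decide) (Comp.code ho hx hy Comp.loopVar)
        ((Comp.get (x := 13) (by decide) (Comp.code ho hx hy Comp.loopVar)).add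
          (Comp.get (x := 12) (by decide) (Comp.addr Comp.loopVar hx)))))
    (CompS.forAsg ho hy (F := fun γ j h => CutCount.put 13 (CutCount.code o h (y γ) (x γ) j) 0 h)
      (CompS.put (x := 13) (by decide) (Comp.code ho hy hx Comp.loopVar) (Comp.const 0))))
  exact this

theorem CompP.nbr {x y : Γ → Mem → ℕ} (hx : Comp x) (hy : Comp y) :
    CompP fun γ h => nbr o h (x γ h) (y γ h) :=
  (CompP.eq (Comp.get (x := 14) (by decide) hy) (Comp.const 0)).not.and
    (CompP.eq (Comp.get (by omega) (Comp.addr hx hy)) (Comp.const 0)).not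

theorem CompP.isLeaf {x : Γ → Mem → ℕ} (hx : Comp x) : CompP fun γ h => isLeaf o h (x γ h) := by
  classical
  exact (CompP.eq (Comp.get (x := 14) (by decide) hx) (Comp.const 0)).not.and
    (CompP.eq (Comp.sum Comp.numN Num.numN (Comp.ite (CompP.nbr ho hx.wk Comp.last)
      (Comp.const 1) (Comp.const 0))) (Comp.const 1))

theorem CompS.leafStep {x : Γ → ℕ} (hx : Comp fun γ _ => x γ) :
    CompS 1 fun γ h => leafStep o (x γ) h := by
  classical
  exact CompS.ite (CompP.isLeaf ho hx)
    (CompS.comp ((CompS.put (x := 14) (by decide) hx (Comp.const 0)).up (Nat.zero_le _))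
      (CompS.loop Comp.numN Num.numN (CompS.ite (CompP.nbr ho hx.wk Comp.last)
        (CompS.mergeTables ho hx.wk Comp.last) (CompS.skip.up (Nat.zero_le _)))))
    (CompS.skip.up (Nat.zero_le _))

theorem CompS.mergeAll : CompS 1 fun (_ : Γ) h => mergeAll o h :=
  CompS.loop Comp.numN Num.numN (CompS.loop Comp.numN Num.numN (CompS.leafStep ho Comp.last))

theorem CompS.sumTables : CompS 1 fun (_ : Γ) h => sumTables o h :=
  CompS.comp (G := fun (_ : Γ) h => floop (fun x h => if h 14 x ≠ 0 then
      CutCount.forAsg o x (fun j h => CutCount.put 15 0 (h 15 0 + h 12 (j * h 1 2 + x)) h) h else h)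
      (h 1 2) h)
    (CompS.loop Comp.numN Num.numN (CompS.ite
      (CompP.eq (Comp.get (x := 14) (by decide) Comp.last) (Comp.const 0)).not
      (CompS.forAsg ho Comp.last (F := fun γ j h => CutCount.put 15 0
          (h 15 0 + h 12 (j * h 1 2 + γ.2)) h)
        (CompS.put (x := 15) (by decide) (Comp.const 0) ((Comp.cell 15 0 (by decide)).add
          (Comp.get (x := 12) (by decide) (Comp.addr Comp.loopVar Comp.last)))))
      (CompS.skip.up (Nat.zero_le _))))
    ((CompS.put (x := 15) (by decide) (Comp.const 0) (Comp.const 0)).up (Nat.zero_le _))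

theorem CompS.partition (ha : CompFun3 aF) (hb : CompFun2 bF) {r : Γ → ℕ}
    (hr : Comp fun γ _ => r γ) : CompS 1 fun γ h => partition o aF bF (r γ) h := by
  have := CompS.comp (CompS.sumTables ho)
    (CompS.comp (CompS.mergeAll ho) (CompS.initTables ho ha hb hr))
  exact this

omit ho in
theorem CompP.accept (ht : CompFun1 tF) (htn : NumFun1 tF) {i : Γ → Mem → ℕ} (hi : Comp i) :
    CompP fun γ h => accept tF (i γ h) h := by
  refine (CompP.eq (Comp.mod (Comp.div (Comp.cell 15 0 (by decide)) (Comp.pow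
    (Comp.cell 9 2 (by decide)) (Comp.ite (CompP.lt hi (Comp.cell 8 4 (by decide))) hi
      (Comp.const 0)) ?_)) (Comp.pow (Comp.const 2) (ht hi) htn)) (Comp.const 0)).not
  refine (Num.reg fun _ _ => 4).of_le fun γ h => ?_
  split_ifs with hlt
  · exact hlt.le
  · exact Nat.zero_le _

omit ho in
theorem CompS.search (ht : CompFun1 tF) (htn : NumFun1 tF) : CompS 0 fun (_ : Γ) h => search tF h := by
  classical
  exact CompS.comp (G := fun (_ : Γ) h => floop (fun i h => if CutCount.accept tF i h then
      CutCount.put 17 2 i (CutCount.put 17 1 1 h) else h) (h 8 4) h)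
    (CompS.loop (Comp.cell 8 4 (by decide)) (Num.reg _) (CompS.ite
      (CompP.accept ht htn Comp.last)
      (CompS.comp (CompS.put (x := 17) (by decide) (Comp.const 2) Comp.last)
        (CompS.put (x := 17) (by decide) (Comp.const 1) (Comp.const 1))) CompS.skip))
    (CompS.put (x := 17) (by decide) (Comp.const 1) (Comp.const 0))

theorem CompS.descend (ha : CompFun3 aF) (hb : CompFun2 bF) (ht : CompFun1 tF) (htn : NumFun1 tF)
    {r : Γ → ℕ} (hr : Comp fun γ _ => r γ) :
    CompS 1 fun γ h => descend o aF bF tF (r γ) h := by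
  classical
  exact CompS.loop Comp.numV Num.numV (CompS.comp
    (G := fun γ h => if CutCount.accept tF (h 17 2) h then h else CutCount.put 11 γ.2 2 h)
    ((CompS.ite (CompP.accept ht htn (Comp.cell 17 2 (by decide))) CompS.skip
      (CompS.put (x := 11) (by decide) Comp.last (Comp.const 2))).up (Nat.zero_le _))
    (CompS.comp (CompS.partition ho ha hb hr.wk)
      ((CompS.put (x := 11) (by decide) Comp.last (Comp.const 1)).up (Nat.zero_le _))))

omit ho in
theorem CompS.report : CompS 0 fun (_ : Γ) h => report h :=
  CompS.comp (G := fun (_ : Γ) h => floop (fun v h => CutCount.put 0 (v + 1)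
      (if h 11 v = 1 then 1 else 0) h) (h 1 0) h)
    (CompS.loop Comp.numV Num.numV (CompS.put (x := 0) (by decide) (Comp.last.add (Comp.const 1))
      (Comp.ite (CompP.eq (Comp.get (x := 11) (by decide) Comp.last) (Comp.const 1)) (Comp.const 1)
        (Comp.const 0))))
    (CompS.put (x := 0) (by decide) (Comp.const 0) (Comp.const 1))

theorem CompS.round (ha : CompFun3 aF) (hb : CompFun2 bF) (ht : CompFun1 tF) (htn : NumFun1 tF)
    {r : Γ → ℕ} (hr : Comp fun γ _ => r γ) :
    CompS 1 fun γ h => round o aF bF tF (r γ) h :=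
  CompS.comp (G := fun γ h => if h 17 1 ≠ 0 then CutCount.report
      (CutCount.descend o aF bF tF (r γ) h) else h)
    (CompS.ite (CompP.eq (Comp.cell 17 1 (by decide)) (Comp.const 0)).not
      (CompS.comp (CompS.report.up (Nat.zero_le _)) (CompS.descend ho ha hb ht htn hr))
      (CompS.skip.up (Nat.zero_le _)))
    (CompS.comp ((CompS.search ht htn).up (Nat.zero_le _))
      (CompS.comp (CompS.partition ho ha hb hr)
        (CompS.loop Comp.numV Num.numV
          ((CompS.put (x := 11) (by decide) Comp.last (Comp.const 0)).up (Nat.zero_le _)))))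

theorem CompS.rounds (ha : CompFun3 aF) (hb : CompFun2 bF) (ht : CompFun1 tF) (htn : NumFun1 tF) :
    CompS 1 fun (_ : Γ) h => rounds o aF bF tF h :=
  CompS.loop (Comp.cell 8 1 (by decide)) (Num.reg _) (CompS.round ho ha hb ht htn Comp.last)

end
end CutCount

namespace CutCount
open Finset

/-! ### Numbering of assignments -/

/-- The number of elements of `U` below `v`. -/
def rank {n : ℕ} (U : Finset (Fin n)) (v : ℕ) : ℕ := (U.filter fun u : Fin n => (u : ℕ) < v).card

/-- The assignment number `j` for `U`. -/
def dec {n : ℕ} (U : Finset (Fin n)) (j : ℕ) : Fin n → ℕ := fun v =>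
  if v ∈ U then j / 3 ^ rank U v % 3 else 0

section
variable {n : ℕ} {U : Finset (Fin n)}

theorem rank_lt {v : Fin n} (hv : v ∈ U) : rank U v < U.card :=
  card_lt_card (filter_ssubset.2 ⟨v, hv, lt_irrefl _⟩)

theorem rank_lt_rank {u v : Fin n} (hu : u ∈ U) (huv : u < v) : rank U u < rank U v := by
  refine card_lt_card ⟨fun w hw => ?_, fun h => ?_⟩
  · rw [mem_filter] at hw ⊢
    exact ⟨hw.1, hw.2.trans huv⟩
  · have := (mem_filter.1 (h (mem_filter.2 ⟨hu, huv⟩))).2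
    exact lt_irrefl _ this

/-- The rank is injective on `U` with values below `|U|`, hence it attains all of them. -/
theorem exists_rank_eq {i : ℕ} (hi : i < U.card) : ∃ v ∈ U, rank U v = i := by
  have h1 : U.image (fun v : Fin n => rank U v) = range U.card := by
    refine eq_of_subset_of_card_le ?_ ?_
    · intro j hj
      obtain ⟨v, hv, rfl⟩ := mem_image.1 hj
      exact mem_range.2 (rank_lt hv)
    · rw [card_range, card_image_of_injOn]
      intro u hu v hv huv
      rcases lt_trichotomy u v with h | h | h
      · exact absurd huv (rank_lt_rank hu h).ne
      · exact h
      · exact absurd huv (rank_lt_rank hv h).ne'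
  obtain ⟨v, hv, h⟩ := mem_image.1 (h1 ▸ mem_range.2 hi)
  exact ⟨v, hv, h⟩

theorem eq_of_digits_eq {c i j : ℕ} (hi : i < 3 ^ c) (hj : j < 3 ^ c)
    (h : ∀ k < c, i / 3 ^ k % 3 = j / 3 ^ k % 3) : i = j := by
  have : (finFunctionFinEquiv (m := 3) (n := c)).symm ⟨i, hi⟩ = finFunctionFinEquiv.symm ⟨j, hj⟩ := by
    ext k
    simpa using h k k.2
  simpa using this

theorem eq_of_sum_eq {f g : Fin n → ℕ} (hf : ∀ v, f v < 3) (hg : ∀ v, g v < 3)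
    (h : ∑ v, f v * 3 ^ (v : ℕ) = ∑ v, g v * 3 ^ (v : ℕ)) : f = g := by
  have : (fun v => (⟨f v, hf v⟩ : Fin 3)) = fun v => ⟨g v, hg v⟩ :=
    (finFunctionFinEquiv (m := 3) (n := n)).injective (Fin.ext (by simpa using h))
  funext v
  simpa using congrFun this v

theorem dec_lt (j : ℕ) (v : Fin n) : dec U j v < 3 := by
  unfold dec
  split_ifs
  · exact Nat.mod_lt _ (by norm_num)
  · norm_num

theorem dec_mem (j : ℕ) : dec U j ∈ assignments U :=
  mem_assignments.2 ⟨dec_lt j, fun _ hv => if_neg hv⟩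

/-- The vertex of rank `i` reads the ternary digit number `i`, and every digit below `|U|` is read
by some vertex. -/
theorem dec_injOn : Set.InjOn (dec U) (range (3 ^ U.card)) := by
  intro i hi j hj h
  refine eq_of_digits_eq (mem_range.1 hi) (mem_range.1 hj) fun k hk => ?_
  obtain ⟨v, hv, rfl⟩ := exists_rank_eq hk
  simpa [dec, hv] using congrFun h v

theorem card_assignments : (assignments U).card = 3 ^ U.card := by
  rw [assignments, Fintype.card_piFinset]
  simp only [apply_ite Finset.card, card_range, card_singleton]
  rw [prod_ite, prod_const, prod_const_one, mul_one, filter_mem_eq_inter, univ_inter]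

theorem image_dec : (range (3 ^ U.card)).image (dec U) = assignments U := by
  refine eq_of_subset_of_card_le ?_ ?_
  · intro σ hσ
    obtain ⟨j, _, rfl⟩ := mem_image.1 hσ
    exact dec_mem j
  · rw [card_image_of_injOn dec_injOn, card_range, card_assignments]

theorem sum_dec {A : Type*} [AddCommMonoid A] (f : (Fin n → ℕ) → A) :
    ∑ j ∈ range (3 ^ U.card), f (dec U j) = ∑ σ ∈ assignments U, f σ := by
  rw [← image_dec, sum_image dec_injOn]

/-- The number of the restriction of `σ` to `U`. -/
noncomputable def idx (U : Finset (Fin n)) (σ : Fin n → ℕ) : ℕ :=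
  Function.invFunOn (dec U) (range (3 ^ U.card)) (restrictTo U σ)

theorem idx_spec {σ : Fin n → ℕ} (h : ∀ v, σ v < 3) :
    idx U σ < 3 ^ U.card ∧ dec U (idx U σ) = restrictTo U σ := by
  have h1 : ∃ j ∈ ((range (3 ^ U.card) : Finset ℕ) : Set ℕ), dec U j = restrictTo U σ := by
    have := restrictTo_mem (U := U) h
    rw [← image_dec] at this
    simpa using this
  exact ⟨mem_range.1 (Function.invFunOn_mem h1), Function.invFunOn_eq h1⟩

theorem idx_dec {j : ℕ} (hj : j < 3 ^ U.card) : idx U (dec U j) = j := by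
  have h := idx_spec (U := U) (dec_lt (U := U) j)
  refine dec_injOn (by simpa using h.1) (by simpa using hj) ?_
  rw [h.2]
  funext v
  by_cases hv : v ∈ U <;> simp [restrictTo, dec, hv]

theorem idx_congr {σ τ : Fin n → ℕ} (h : ∀ v ∈ U, σ v = τ v) : idx U σ = idx U τ := by
  have : restrictTo U σ = restrictTo U τ := by
    funext v
    unfold restrictTo
    split_ifs with hv
    · exact h v hv
    · rfl
  rw [idx, idx, this]

end

/-! ### Inputs -/

/-- The memory `h` describes a graph with the given ends of the edges, and a tree decomposition. -/
structure Enc (o : ℕ) {n m N : ℕ} (ends : Fin m → Fin n × Fin n) (T : SimpleGraph (Fin N))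
    (bag : Fin N → Finset (Fin n)) (h : Mem) : Prop where
  numV : h 1 0 = n
  numE : h 1 1 = m
  numN : h 1 2 = N
  fst : ∀ e : Fin m, h o e = (ends e).1
  snd : ∀ e : Fin m, h (o + 1) e = (ends e).2
  adj : ∀ x y : Fin N, h (o + 2) (x * N + y) ≠ 0 ↔ T.Adj x y
  bag : ∀ (x : Fin N) (v : Fin n), h (o + 3) (x * n + v) ≠ 0 ↔ v ∈ bag x

/-- The memories `h` and `h'` differ in the arrays in `A` only. -/
def SameOff (A : Finset ℕ) (h h' : Mem) : Prop := ∀ x ∉ A, h' x = h x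

theorem SameOff.refl (A : Finset ℕ) (h : Mem) : SameOff A h h := fun _ _ => rfl

theorem SameOff.trans {A : Finset ℕ} {h h' h'' : Mem} (h1 : SameOff A h h') (h2 : SameOff A h' h'') :
    SameOff A h h'' := fun x hx => (h2 x hx).trans (h1 x hx)

theorem SameOff.mono {A B : Finset ℕ} {h h' : Mem} (h1 : SameOff A h h') (hAB : A ⊆ B) :
    SameOff B h h' := fun x hx => h1 x fun hA => hx (hAB hA)

theorem SameOff.set {A : Finset ℕ} {h h' : Mem} (h1 : SameOff A h h') {x : ℕ} (hx : x ∈ A) (i a : ℕ) :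
    SameOff A h (h'.set x i a) := fun y hy => by
  rw [Mem.set_of_ne _ _ _ (fun he => hy (by rw [he]; exact hx)), h1 y hy]

theorem SameOff.put {A : Finset ℕ} {h h' : Mem} (h1 : SameOff A h h') {x : ℕ} (hx : x ∈ A) (i a : ℕ) :
    SameOff A h (put x i a h') := h1.set hx i _

theorem floop_induct {F : ℕ → Mem → Mem} {n : ℕ} {h : Mem} (I : ℕ → Mem → Prop) (h0 : I 0 h)
    (hs : ∀ i < n, ∀ h', I i h' → I (i + 1) (F i h')) : I n (floop F n h) := by
  suffices ∀ k ≤ n, I k (floop F k h) from this n le_rfl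
  intro k
  induction k with
  | zero => exact fun _ => h0
  | succ k ih => exact fun hk => hs k (by omega) _ (ih (by omega))

/-- The arrays of scratch memory. -/
def scratch : Finset ℕ := {12, 13, 14, 15, 16}

section
variable {o n m N : ℕ} {ends : Fin m → Fin n × Fin n} {T : SimpleGraph (Fin N)}
  {bag : Fin N → Finset (Fin n)} {h h' : Mem}

theorem Enc.of_eq (he : Enc o ends T bag h)
    (hs : ∀ x, x = 1 ∨ x = o ∨ x = o + 1 ∨ x = o + 2 ∨ x = o + 3 → h' x = h x) :
    Enc o ends T bag h' where
  numV := by rw [hs 1 (by simp), he.numV]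
  numE := by rw [hs 1 (by simp), he.numE]
  numN := by rw [hs 1 (by simp), he.numN]
  fst := by rw [hs o (by simp)]; exact he.fst
  snd := by rw [hs (o + 1) (by simp)]; exact he.snd
  adj := by rw [hs (o + 2) (by simp)]; exact he.adj
  bag := by rw [hs (o + 3) (by simp)]; exact he.bag

theorem Enc.of_sameOff (he : Enc o ends T bag h) (ho : o ≤ 3) {A : Finset ℕ} (hs : SameOff A h h')
    (hA : ∀ x ∈ A, 6 < x) : Enc o ends T bag h' :=
  he.of_eq fun x hx => hs x fun hxA => by
    have := hA x hxA
    omega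

theorem Enc.inB (he : Enc o ends T bag h) (x : Fin N) (v : Fin n) :
    inB o h x v ↔ v ∈ bag x := by
  rw [CutCount.inB, he.numV, he.bag]

theorem Enc.rk (he : Enc o ends T bag h) (x : Fin N) (v : ℕ) : rk o h x v = rank (bag x) v := by
  rw [CutCount.rk, rank, he.numV, sum_range, ← card_filter]
  congr 1
  ext u
  simp [he.inB, and_comm]

theorem Enc.asgCount (he : Enc o ends T bag h) (x : Fin N) :
    asgCount o h x = 3 ^ (bag x).card := by
  rw [CutCount.asgCount, he.rk, he.numV, rank, filter_true_of_mem fun v _ => v.2]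

theorem Enc.dg (he : Enc o ends T bag h) {x : Fin N} {v : Fin n} (hv : v ∈ bag x) (j : ℕ) :
    dg o h x j v = dec (bag x) j v := by
  rw [CutCount.dg, he.rk, dec, if_pos hv]

/-- The code of the restriction of the assignment number `j` for the bag of `x` to the bag of `y`. -/
def bagCode (bag : Fin N → Finset (Fin n)) (x y : Fin N) (j : ℕ) : ℕ :=
  ∑ v : Fin n, (if v ∈ bag y then dec (bag x) j v else 0) * 3 ^ (v : ℕ)

theorem Enc.code (he : Enc o ends T bag h) (x y : Fin N) (j : ℕ) :
    code o h x y j = bagCode bag x y j := by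
  rw [CutCount.code, he.numV, sum_range]
  refine sum_congr rfl fun v _ => ?_
  by_cases hx : v ∈ bag x
  · by_cases hy : v ∈ bag y
    · rw [if_pos ⟨(he.inB x v).2 hx, (he.inB y v).2 hy⟩, he.dg hx, if_pos hy]
    · rw [if_neg fun hh => hy ((he.inB y v).1 hh.2), if_neg hy, zero_mul]
  · rw [if_neg fun hh => hx ((he.inB x v).1 hh.1), dec, if_neg hx, ite_self, zero_mul]

/-- Outside of the common vertices both codes have the digit 0, and ternary digits are unique. -/
theorem bagCode_eq_iff (x y : Fin N) (i j : ℕ) :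
    bagCode bag x y i = bagCode bag y x j ↔
      ∀ v ∈ bag x, v ∈ bag y → dec (bag x) i v = dec (bag y) j v := by
  constructor
  · intro hh v hx hy
    have := congrFun (eq_of_sum_eq (fun v => ?_) (fun v => ?_) hh) v
    · rwa [if_pos hx, if_pos hy] at this
    · split_ifs
      exacts [dec_lt _ _, by norm_num]
    · split_ifs
      exacts [dec_lt _ _, by norm_num]
  · intro hh
    refine sum_congr rfl fun v _ => ?_
    congr 1
    by_cases hx : v ∈ bag x
    · by_cases hy : v ∈ bag y
      · rw [if_pos hx, if_pos hy, hh v hx hy]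
      · rw [if_neg hy, if_pos hx, dec, if_neg hy]
    · rw [if_neg hx, dec, if_neg hx, ite_self]

/-! ### Merging tables -/

/-- The loop runs up to `h 9 1`, but its iterations from `c` onwards have no effect; so the
invariant is followed at `min k c`. -/
theorem forAsg_induct {F : ℕ → Mem → Mem} {x : ℕ} (I : ℕ → Mem → Prop) {c : ℕ} (hc : c ≤ h 9 1)
    (h0 : I 0 h) (hset : ∀ j i h', I j h' → I j (h'.set 16 0 i))
    (hasg : ∀ j h', I j h' → CutCount.asgCount o h' x = c)
    (hF : ∀ j < c, ∀ h', I j h' → I (j + 1) (F j h')) : I c (forAsg o x F h) := by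
  have key : (fun k h' => I (min k c) h') (h 9 1) (forAsg o x F h) := by
    refine floop_induct (fun k h' => I (min k c) h') (by simpa using h0) fun i _ h' hI => ?_
    have h1 := hset _ i _ hI
    have h2 : (h'.set 16 0 i) 16 0 = i := by simp [Mem.set_apply]
    dsimp only
    rw [h2, hasg _ _ h1]
    split_ifs with hi
    · rw [min_eq_left (by omega)] at h1 ⊢
      exact hF i hi _ h1
    · rw [min_eq_right (by omega)] at h1 ⊢
      exact h1
  simpa [min_eq_right hc] using key

theorem addr_inj {i j : ℕ} {x y : Fin N} : i * N + x = j * N + y ↔ i = j ∧ x = y := by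
  constructor
  · intro hh
    have h1 : (i * N + x) / N = (j * N + y) / N := by rw [hh]
    have hN : 0 < N := x.pos
    rw [mul_comm i, mul_comm j, Nat.mul_add_div hN, Nat.mul_add_div hN, Nat.div_eq_of_lt x.2,
      Nat.div_eq_of_lt y.2] at h1
    have h2 : i = j := h1
    subst h2
    exact ⟨rfl, Fin.ext (by omega)⟩
  · rintro ⟨rfl, rfl⟩
    rfl

/-- What is written is correct modulo `q + 1` only, which is why all identities between tables are
stated in `ZMod (q + 1)`. -/
theorem put_same {q : ℕ} (hq : h 9 0 = q) (x i a : ℕ) :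
    ((put x i a h x i : ℕ) : ZMod (q + 1)) = a := by
  rw [put, Mem.set_apply, if_pos ⟨rfl, rfl⟩, hq, ZMod.natCast_mod]

theorem put_of_ne {x i y j : ℕ} (a : ℕ) (hh : y = x → j ≠ i) : put x i a h y j = h y j := by
  rw [put, Mem.set_apply, if_neg fun h' => hh h'.1 h'.2]

theorem mergeTables_spec (he : Enc o ends T bag h) (ho : o ≤ 3) {q : ℕ} (hq : h 9 0 = q)
    (hK : ∀ z, 3 ^ (bag z).card ≤ h 9 1) (x y : Fin N) :
    SameOff {12, 13, 16} h (mergeTables o x y h) ∧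
    (∀ z j, z ≠ y → mergeTables o x y h 12 (j * N + z) = h 12 (j * N + z)) ∧
    ∀ j < 3 ^ (bag y).card, ((mergeTables o x y h 12 (j * N + y) : ℕ) : ZMod (q + 1)) =
      h 12 (j * N + y) * ∑ i ∈ range (3 ^ (bag x).card) with bagCode bag x y i = bagCode bag y x j,
        (h 12 (i * N + x) : ZMod (q + 1)) := by
  have e13 : ∀ {h'}, SameOff {13, 16} h h' → Enc o ends T bag h' := fun hs =>
    he.of_sameOff ho hs (by decide)
  -- Clearing the codes which come from `y` is enough: no other cell of array `13` is read in the
  -- end, so old values there do no harm.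
  obtain ⟨s1, s2⟩ : SameOff {13, 16} h (forAsg o y (fun j h => put 13 (code o h y x j) 0 h) h) ∧
      ∀ i < 3 ^ (bag y).card, forAsg o y (fun j h => put 13 (code o h y x j) 0 h) h 13
        (bagCode bag y x i) = 0 := by
    refine forAsg_induct (c := 3 ^ (bag y).card)
      (fun j h' => SameOff {13, 16} h h' ∧ ∀ i < j, h' 13 (bagCode bag y x i) = 0)
      (hK y) ⟨SameOff.refl _ _, by simp⟩ ?_ (fun j h' hI => (e13 hI.1).asgCount y) ?_
    · rintro j i h' ⟨a, b⟩
      exact ⟨a.set (by decide) _ _, fun i hi => by rw [Mem.set_of_ne _ _ _ (by decide), b i hi]⟩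
    · rintro j hj h' ⟨a, b⟩
      refine ⟨a.put (by decide) _ _, fun i hi => ?_⟩
      rw [put, Mem.set_apply, (e13 a).code]
      split_ifs with hh
      · simp
      · exact b i (by
          rcases Nat.lt_succ_iff_lt_or_eq.1 hi with h1 | rfl
          · exact h1
          · exact absurd ⟨rfl, rfl⟩ hh)
  rw [mergeTables]
  set h1 := forAsg o y (fun j h => put 13 (code o h y x j) 0 h) h with hh1
  have q1 : h1 9 = h 9 := s1 9 (by decide)
  have e1' : ∀ {h'}, SameOff {13, 16} h1 h' → Enc o ends T bag h' := fun hs => e13 (s1.trans hs)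
  obtain ⟨t1, t2⟩ : SameOff {13, 16} h1 (forAsg o x (fun j h => put 13 (code o h x y j)
        (h 13 (code o h x y j) + h 12 (j * h 1 2 + x)) h) h1) ∧
      ∀ c, ((forAsg o x (fun j h => put 13 (code o h x y j)
        (h 13 (code o h x y j) + h 12 (j * h 1 2 + x)) h) h1 13 c : ℕ) : ZMod (q + 1)) =
        h1 13 c + ∑ i ∈ range (3 ^ (bag x).card) with bagCode bag x y i = c,
          (h 12 (i * N + x) : ZMod (q + 1)) := by
    refine forAsg_induct (c := 3 ^ (bag x).card)
      (fun j h' => SameOff {13, 16} h1 h' ∧ ∀ c, ((h' 13 c : ℕ) : ZMod (q + 1)) =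
        h1 13 c + ∑ i ∈ range j with bagCode bag x y i = c, (h 12 (i * N + x) : ZMod (q + 1)))
      (by rw [q1]; exact hK x) ⟨SameOff.refl _ _, by simp⟩ ?_ (fun j h' hI => (e1' hI.1).asgCount x) ?_
    · rintro j i h' ⟨a, b⟩
      exact ⟨a.set (by decide) _ _, fun i => by rw [Mem.set_of_ne _ _ _ (by decide), b i]⟩
    · rintro j hj h' ⟨a, b⟩
      refine ⟨a.put (by decide) _ _, fun c => ?_⟩
      have hN : h' 1 2 = N := (e1' a).numN
      have h12 : h' 12 = h 12 := (a 12 (by decide)).trans (s1 12 (by decide))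
      rw [(e1' a).code, hN, h12, range_add_one, filter_insert]
      split_ifs with hc
      · subst hc
        rw [put_same (by rw [a 9 (by decide), q1, hq]), Nat.cast_add, b, sum_insert (by simp)]
        ring
      · rw [put_of_ne _ fun _ hh => hc hh.symm, b]
  set h2 := forAsg o x (fun j h => put 13 (code o h x y j)
        (h 13 (code o h x y j) + h 12 (j * h 1 2 + x)) h) h1 with hh2
  have e2' : ∀ {h'}, SameOff {12, 16} h2 h' → Enc o ends T bag h' := fun hs =>
    (e1' t1).of_sameOff ho hs (by decide)
  have q2 : h2 9 = h 9 := (t1 9 (by decide)).trans q1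
  have h212 : h2 12 = h 12 := (t1 12 (by decide)).trans (s1 12 (by decide))
  -- The invariant also says that entries from `j` on are still the old ones; those are what the
  -- next multiplications read.
  obtain ⟨u1, u2, u3⟩ := forAsg_induct (h := h2) (c := 3 ^ (bag y).card) (o := o)
    (F := fun j h => put 12 (j * h 1 2 + y) (h 12 (j * h 1 2 + y) * h 13 (code o h y x j)) h) (x := y)
    (fun j h' => SameOff {12, 16} h2 h' ∧
      (∀ z i, z ≠ y ∨ j ≤ i → h' 12 (i * N + z) = h2 12 (i * N + z)) ∧
      ∀ i < j, ((h' 12 (i * N + y) : ℕ) : ZMod (q + 1)) =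
        h2 12 (i * N + y) * h2 13 (bagCode bag y x i))
    (by rw [q2]; exact hK y) ⟨SameOff.refl _ _, by simp⟩ (by
      rintro j i h' ⟨a, b, c⟩
      have : (h'.set 16 0 i) 12 = h' 12 := Mem.set_of_ne _ _ _ (by decide)
      rw [this]
      exact ⟨a.set (by decide) _ _, b, c⟩)
    (fun j h' hI => (e2' hI.1).asgCount y) (by
      rintro j hj h' ⟨a, b, c⟩
      have hN : h' 1 2 = N := (e2' a).numN
      have h13 : h' 13 = h2 13 := a 13 (by decide)
      refine ⟨a.put (by decide) _ _, fun z i hz => ?_, fun i hi => ?_⟩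
      · rw [hN, put_of_ne _ fun _ hh => ?_, b z i (by omega)]
        have := addr_inj.1 hh
        omega
      · rw [hN, (e2' a).code]
        by_cases hij : i = j
        · subst hij
          rw [put_same (by rw [a 9 (by decide), q2, hq]), Nat.cast_mul, b _ _ (Or.inr le_rfl), h13]
        · rw [put_of_ne _ fun _ hh => hij (addr_inj.1 hh).1, c i (by omega)])
  refine ⟨?_, fun z j hz => ?_, fun j hj => ?_⟩
  · exact ((s1.trans t1).mono (by decide)).trans (u1.mono (by decide))
  · rw [u2 z j (Or.inl hz), h212]
  · rw [u3 j hj, t2, s2 j hj, h212]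
    simp

/-! ### Leaves -/

theorem Enc.nbr (he : Enc o ends T bag h) {Q : Finset (Fin N)} (hQ : ∀ x : Fin N, h 14 x ≠ 0 ↔ x ∈ Q)
    (x y : Fin N) : nbr o h x y ↔ y ∈ Q ∧ T.Adj x y := by
  rw [CutCount.nbr, hQ, he.numN, he.adj]

theorem Enc.isLeaf (he : Enc o ends T bag h) {Q : Finset (Fin N)}
    (hQ : ∀ x : Fin N, h 14 x ≠ 0 ↔ x ∈ Q) (x : Fin N) :
    isLeaf o h x ↔ ∃ y, IsLeafAt T Q x y := by
  classical
  rw [CutCount.isLeaf, hQ, he.numN, sum_range, ← card_filter, card_eq_one]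
  simp only [he.nbr hQ, IsLeafAt]
  constructor
  · rintro ⟨hx, y, hy⟩
    have h1 := mem_filter.1 (hy.symm ▸ mem_singleton_self y : y ∈ filter _ _)
    exact ⟨y, hx, h1.2.1, h1.2.2, fun z hz hxz => mem_singleton.1 (hy ▸ mem_filter.2
      ⟨mem_univ _, hz, hxz⟩)⟩
  · rintro ⟨y, hx, hy, hxy, hu⟩
    refine ⟨hx, y, ?_⟩
    ext z
    simp only [mem_filter, mem_univ, true_and, mem_singleton]
    exact ⟨fun hz => hu z hz.1 hz.2, fun hz => hz ▸ ⟨hy, hxy⟩⟩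

/-- The loop over all possible neighbours merges exactly once. A merge changes neither array `14`
nor the tree, so the tests before and after it see the same single neighbour. -/
theorem leafStep_of_isLeafAt (he : Enc o ends T bag h) (ho : o ≤ 3) {q : ℕ} (hq : h 9 0 = q)
    (hK : ∀ z, 3 ^ (bag z).card ≤ h 9 1) {Q : Finset (Fin N)}
    (hQ : ∀ x : Fin N, h 14 x ≠ 0 ↔ x ∈ Q) {x y : Fin N} (hxy : IsLeafAt T Q x y) :
    leafStep o x h = put 14 x 0 (mergeTables o x y h) := by
  classical
  rw [leafStep, if_pos ((he.isLeaf hQ x).2 ⟨y, hxy⟩)]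
  congr 1
  have hs := (mergeTables_spec he ho hq hK x y).1
  have h14 : mergeTables o x y h 14 = h 14 := hs 14 (by decide)
  have he' : Enc o ends T bag (mergeTables o x y h) := he.of_sameOff ho hs (by decide)
  have := floop_induct (F := fun y h => if nbr o h x y then mergeTables o x y h else h)
    (n := h 1 2) (h := h) (fun k h' => h' = if k ≤ y then h else mergeTables o x y h) (by simp) (by
      rintro i hi h' rfl
      rw [he.numN] at hi
      obtain ⟨i, rfl⟩ : ∃ i' : Fin N, i = i' := ⟨⟨i, hi⟩, rfl⟩
      by_cases hiy : i = y
      · subst hiy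
        rw [if_pos le_rfl, if_pos ((he.nbr hQ x i).2 ⟨hxy.2.1, hxy.2.2.1⟩), if_neg (by omega)]
      · have hne : (i : ℕ) ≠ y := fun hh => hiy (Fin.ext hh)
        by_cases hlt : (i : ℕ) ≤ y
        · have hnb : ¬ nbr o h x i := fun hh => by
            rw [he.nbr hQ] at hh
            exact hiy (hxy.2.2.2 i hh.1 hh.2)
          rw [if_pos hlt, if_neg hnb, if_pos (by omega)]
        · have hnb : ¬ nbr o (mergeTables o x y h) x i := fun hh => by
            rw [he'.nbr (by rw [h14]; exact hQ)] at hh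
            exact hiy (hxy.2.2.2 i hh.1 hh.2)
          rw [if_neg hlt, if_neg hnb, if_neg (by omega)])
  rw [this, he.numN, if_neg (by omega)]

/-- The sum over all assignments of the product of the entries of the tables of the nodes in `Q`. -/
noncomputable def tableSum (bag : Fin N → Finset (Fin n)) (q : ℕ) (Q : Finset (Fin N)) (h : Mem) :
    ZMod (q + 1) :=
  ∑ σ ∈ assignments (Q.biUnion bag), ∏ z ∈ Q, ((h 12 (idx (bag z) σ * N + z) : ℕ) : ZMod (q + 1))

/-- This is `sum_prod_merge` for the tables, where the separation property comes from
`IsLeafAt.mem_of_connected`. -/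
theorem tableSum_leafStep (he : Enc o ends T bag h) (ho : o ≤ 3) {q : ℕ} (hq : h 9 0 = q)
    (hK : ∀ z, 3 ^ (bag z).card ≤ h 9 1) (hT : T.IsAcyclic)
    (hconn : ∀ v, (T.induce {x | v ∈ bag x}).Connected) {Q : Finset (Fin N)}
    (hQ : ∀ x : Fin N, h 14 x ≠ 0 ↔ x ∈ Q) (hQc : (T.induce (Q : Set (Fin N))).Connected)
    {x y : Fin N} (hxy : IsLeafAt T Q x y) :
    tableSum bag q (Q.erase x) (leafStep o x h) = tableSum bag q Q h := by
  rw [leafStep_of_isLeafAt he ho hq hK hQ hxy]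
  obtain ⟨_, h2, h3⟩ := mergeTables_spec he ho hq hK x y
  have h12 : put 14 x 0 (mergeTables o x y h) 12 = mergeTables o x y h 12 :=
    Mem.set_of_ne _ _ _ (by decide)
  rw [tableSum, tableSum, h12]
  refine (sum_prod_merge (y := y)
    (f := fun z σ => ((h 12 (idx (bag z) σ * N + z) : ℕ) : ZMod (q + 1)))
    (f' := fun z σ => ((mergeTables o x y h 12 (idx (bag z) σ * N + z) : ℕ) : ZMod (q + 1)))
    hxy.1 hxy.2.1 hxy.2.2.1.ne ?_ ?_ ?_ ?_).symm
  · intro z hz hzx v hvx hvz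
    exact hxy.mem_of_connected hT hQc (hconn v) hz hzx hvx hvz
  · intro z _ σ τ hst
    rw [idx_congr hst]
  · intro z _ hzy σ
    rw [h2 z _ hzy]
  · intro σ hσ
    have hi := idx_spec (U := bag y) hσ
    rw [h3 _ hi.1, sum_filter, sum_filter, ← sum_dec]
    congr 1
    refine sum_congr rfl fun i hi' => ?_
    rw [idx_dec (mem_range.1 hi')]
    refine if_congr ?_ rfl rfl
    rw [bagCode_eq_iff, hi.2]
    refine forall_congr' fun v => forall_congr' fun _ => forall_congr' fun hv => ?_
    rw [restrictTo, if_pos hv]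

/-- The tables of all the nodes outside of `Q` have been merged into those of `Q`. -/
structure Merged (T : SimpleGraph (Fin N)) (bag : Fin N → Finset (Fin n)) (q : ℕ) (h : Mem)
    (Q : Finset (Fin N)) (h' : Mem) : Prop where
  same : SameOff {12, 13, 14, 16} h h'
  alive : ∀ x : Fin N, h' 14 x ≠ 0 ↔ x ∈ Q
  connected : (T.induce (Q : Set (Fin N))).Connected
  sum_eq : tableSum bag q Q h' = tableSum bag q univ h

theorem Merged.leafStep (he : Enc o ends T bag h) (ho : o ≤ 3) {q : ℕ} (hq : h 9 0 = q)
    (hK : ∀ z, 3 ^ (bag z).card ≤ h 9 1) (hT : T.IsAcyclic)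
    (hconn : ∀ v, (T.induce {x | v ∈ bag x}).Connected) {Q : Finset (Fin N)}
    (hM : Merged T bag q h Q h') (x : Fin N) :
    ((∃ y, IsLeafAt T Q x y) ∧ Merged T bag q h (Q.erase x) (leafStep o x h')) ∨
      ((¬ ∃ y, IsLeafAt T Q x y) ∧ Merged T bag q h Q (leafStep o x h')) := by
  have he' : Enc o ends T bag h' := he.of_sameOff ho hM.same (by decide)
  have q' : h' 9 = h 9 := hM.same 9 (by decide)
  by_cases hx : ∃ y, IsLeafAt T Q x y
  · refine Or.inl ⟨hx, ?_⟩
    obtain ⟨y, hxy⟩ := hx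
    have hq' : h' 9 0 = q := by rw [q', hq]
    have hK' : ∀ z, 3 ^ (bag z).card ≤ h' 9 1 := by rwa [q']
    have hms := (mergeTables_spec he' ho hq' hK' x y).1
    have hls := leafStep_of_isLeafAt he' ho hq' hK' hM.alive hxy
    refine ⟨?_, fun z => ?_, hxy.connected_erase hM.connected, ?_⟩
    · rw [hls]
      exact (hM.same.trans (hms.mono (by decide))).put (by decide) _ _
    · rw [hls, mem_erase, ← hM.alive z]
      by_cases hzx : z = x
      · subst hzx
        simp [put, Mem.set_apply]
      · rw [put_of_ne _ fun _ hh => hzx (Fin.ext hh), hms 14 (by decide)]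
        exact ⟨fun hh => ⟨hzx, hh⟩, fun hh => hh.2⟩
    · rw [tableSum_leafStep he' ho hq' hK' hT hconn hM.alive hM.connected hxy, hM.sum_eq]
  · refine Or.inr ⟨hx, ?_⟩
    rw [CutCount.leafStep, if_neg fun hh => hx ((he'.isLeaf hM.alive x).1 hh)]
    exact hM

/-- A pass that removed nothing would meet every node with `Q` unchanged, and so would have met a
leaf, which exists while `Q` has two nodes. Hence after `k` passes at most `N - k` nodes remain, or
only one. -/
theorem mergeAll_spec (he : Enc o ends T bag h) (ho : o ≤ 3) {q : ℕ} (hq : h 9 0 = q)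
    (hK : ∀ z, 3 ^ (bag z).card ≤ h 9 1) (hT : T.IsTree)
    (hconn : ∀ v, (T.induce {x | v ∈ bag x}).Connected) (hal : ∀ x : Fin N, h 14 x ≠ 0) :
    ∃ r, Merged T bag q h {r} (mergeAll o h) := by
  have key := floop_induct (F := fun _ h => floop (fun x h => leafStep o x h) (h 1 2) h) (n := h 1 2)
    (h := h) (fun k h' => ∃ Q : Finset (Fin N), Merged T bag q h Q h' ∧ (Q.card ≤ 1 ∨ Q.card + k ≤ N))
    ⟨univ, ⟨SameOff.refl _ _, fun x => by simp [hal], by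
      rw [coe_univ]
      exact (SimpleGraph.induceUnivIso T).connected_iff.2 hT.1, rfl⟩, Or.inr (by simp)⟩ (by
      rintro k _ h' ⟨Q, hM, hQ⟩
      have hN : h' 1 2 = N := by rw [hM.same 1 (by decide), he.numN]
      obtain ⟨Q', hQ', hM', hlt⟩ := floop_induct (F := fun x h => leafStep o x h) (n := h' 1 2)
        (h := h') (fun k h'' => ∃ Q' ⊆ Q, Merged T bag q h Q' h'' ∧
          (Q' = Q → ∀ x : Fin N, (x : ℕ) < k → ¬ ∃ y, IsLeafAt T Q x y))
        ⟨Q, Subset.rfl, hM, by simp⟩ (by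
          rintro i hi h'' ⟨Q', hQ', hM', hl⟩
          rw [hN] at hi
          rcases hM'.leafStep he ho hq hK hT.2 hconn ⟨i, hi⟩ with ⟨⟨y, h1⟩, h2⟩ | ⟨h1, h2⟩
          · refine ⟨_, (erase_subset _ _).trans hQ', h2, fun hh => ?_⟩
            have : (⟨i, hi⟩ : Fin N) ∈ Q'.erase ⟨i, hi⟩ := by
              rw [hh]
              exact hQ' h1.1
            exact absurd this (notMem_erase _ _)
          · refine ⟨Q', hQ', h2, fun hh x hx => ?_⟩
            rcases Nat.lt_succ_iff_lt_or_eq.1 hx with h3 | h3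
            · exact hl hh x h3
            · obtain rfl : x = ⟨i, hi⟩ := Fin.ext h3
              rwa [hh] at h1)
      refine ⟨Q', hM', ?_⟩
      by_cases hc : Q.card ≤ 1
      · exact Or.inl ((card_le_card hQ').trans hc)
      · refine Or.inr ?_
        have hne : Q' ≠ Q := fun hh => by
          obtain ⟨x, y, hxy⟩ := exists_isLeafAt hT.2 hM.connected (by omega)
          exact hlt hh x (by rw [hN]; exact x.2) ⟨y, hxy⟩
        have := card_lt_card (hQ'.ssubset_of_ne hne)
        omega)
  obtain ⟨Q, hM, hQ⟩ := key
  rw [he.numN] at hQ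
  obtain ⟨⟨r, hr⟩⟩ := hM.connected.nonempty
  have h1 : Q.card = 1 := by
    have := card_pos.2 ⟨r, hr⟩
    omega
  obtain ⟨r, rfl⟩ := card_eq_one.1 h1
  exact ⟨r, hM⟩

theorem sumTables_spec (he : Enc o ends T bag h) (ho : o ≤ 3) {q : ℕ} (hq : h 9 0 = q)
    (hK : ∀ z, 3 ^ (bag z).card ≤ h 9 1) {r : Fin N} (hr : ∀ x : Fin N, h 14 x ≠ 0 ↔ x ∈ ({r} : Finset _)) :
    SameOff {15, 16} h (sumTables o h) ∧ sumTables o h 15 0 < q + 1 ∧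
      ((sumTables o h 15 0 : ℕ) : ZMod (q + 1)) = tableSum bag q {r} h := by
  rw [sumTables]
  set h1 := put 15 0 0 h with hh1
  have s1 : SameOff {15, 16} h h1 := (SameOff.refl _ _).put (by decide) _ _
  have e' : ∀ {h'}, SameOff {15, 16} h h' → Enc o ends T bag h' := fun hs =>
    he.of_sameOff ho hs (by decide)
  have hz : h1 15 0 = 0 := by simp [hh1, put, Mem.set_apply]
  have hN : h1 1 2 = N := (e' s1).numN
  obtain ⟨f1, f2, f3⟩ := floop_induct (F := fun x h => if h 14 x ≠ 0 then
    forAsg o x (fun j h => put 15 0 (h 15 0 + h 12 (j * h 1 2 + x)) h) h else h) (n := h1 1 2)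
    (h := h1) (fun k h' => SameOff {15, 16} h h' ∧ h' 15 0 < q + 1 ∧
      ((h' 15 0 : ℕ) : ZMod (q + 1)) = if k ≤ r then 0 else
        ∑ j ∈ range (3 ^ (bag r).card), (h 12 (j * N + r) : ZMod (q + 1)))
    ⟨s1, by rw [hz]; omega, by simp [hz]⟩ (by
      rintro i hi h' ⟨a, b, c⟩
      rw [hN] at hi
      obtain ⟨i, rfl⟩ : ∃ i' : Fin N, i = i' := ⟨⟨i, hi⟩, rfl⟩
      have h14 : h' 14 = h 14 := a 14 (by decide)
      rw [h14]
      by_cases hir : i = r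
      · subst hir
        rw [if_pos ((hr i).2 (mem_singleton_self _)), if_neg (by omega)]
        rw [if_pos le_rfl] at c
        exact forAsg_induct (c := 3 ^ (bag i).card) (fun j h'' => SameOff {15, 16} h h'' ∧
          h'' 15 0 < q + 1 ∧ ((h'' 15 0 : ℕ) : ZMod (q + 1)) =
            ∑ j ∈ range j, (h 12 (j * N + i) : ZMod (q + 1)))
          (by rw [a 9 (by decide)]; exact hK i) ⟨a, b, by simpa using c⟩
          (by
            rintro j k h'' ⟨a, b, c⟩
            have : (h''.set 16 0 k) 15 = h'' 15 := Mem.set_of_ne _ _ _ (by decide)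
            rw [this]
            exact ⟨a.set (by decide) _ _, b, c⟩)
          (fun j h'' hI => (e' hI.1).asgCount i)
          (by
            rintro j hj h'' ⟨a, b, c⟩
            have hN'' : h'' 1 2 = N := (e' a).numN
            have hq'' : h'' 9 0 = q := by rw [a 9 (by decide), hq]
            refine ⟨a.put (by decide) _ _, ?_, ?_⟩
            · rw [put, Mem.set_apply, if_pos ⟨rfl, rfl⟩, hq'']
              exact Nat.mod_lt _ (by omega)
            · rw [put_same hq'', hN'', a 12 (by decide), Nat.cast_add, c, sum_range_succ])
      · have hne : (i : ℕ) ≠ r := fun hh => hir (Fin.ext hh)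
        rw [if_neg fun hh => hir (mem_singleton.1 ((hr i).1 hh))]
        refine ⟨a, b, c.trans (if_congr (by omega) rfl rfl)⟩)
  refine ⟨f1, f2, ?_⟩
  rw [f3, if_neg (by rw [hN]; omega), tableSum, singleton_biUnion, ← sum_dec]
  refine sum_congr rfl fun j hj => ?_
  rw [prod_singleton, idx_dec (mem_range.1 hj)]

/-! ### The partition function -/

theorem Enc.ownV (he : Enc o ends T bag h) (x : Fin N) (v : Fin n) :
    ownV o h x v ↔ IsFirst (fun x => v ∈ bag x) x := by
  rw [CutCount.ownV, IsFirst, he.inB, he.numN]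
  refine and_congr_right fun _ => ⟨fun hh z hz => ?_, fun hh z hzN hz => ?_⟩
  · rw [← he.inB]
    exact hh z z.2 hz
  · exact fun hb => hh ⟨z, hzN⟩ hz ((he.inB ⟨z, hzN⟩ v).1 hb)

theorem Enc.hasE (he : Enc o ends T bag h) (x : Fin N) (e : Fin m) :
    hasE o h x e ↔ (ends e).1 ∈ bag x ∧ (ends e).2 ∈ bag x := by
  rw [CutCount.hasE, he.fst, he.snd, he.inB, he.inB]

theorem Enc.ownE (he : Enc o ends T bag h) (x : Fin N) (e : Fin m) :
    ownE o h x e ↔ IsFirst (fun x => (ends e).1 ∈ bag x ∧ (ends e).2 ∈ bag x) x := by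
  rw [CutCount.ownE, IsFirst, he.hasE, he.numN]
  refine and_congr_right fun _ => ⟨fun hh z hz => ?_, fun hh z hzN hz => ?_⟩
  · rw [← he.hasE]
    exact hh z z.2 hz
  · exact fun hb => hh ⟨z, hzN⟩ hz ((he.hasE ⟨z, hzN⟩ e).1 hb)

open Classical in
theorem Enc.localFactor (he : Enc o ends T bag h) (aF : ℕ → ℕ → ℕ → Mem → ℕ) (bF : ℕ → ℕ → Mem → ℕ)
    (r : ℕ) (x : Fin N) (j : ℕ) : localFactor o aF bF r x j h =
      (∏ v : Fin n, if IsFirst (fun x => v ∈ bag x) x then aF r v (dec (bag x) j v) h else 1) *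
        ∏ e : Fin m, if IsFirst (fun x => (ends e).1 ∈ bag x ∧ (ends e).2 ∈ bag x) x then
          bF (dec (bag x) j (ends e).1) (dec (bag x) j (ends e).2) h else 1 := by
  rw [CutCount.localFactor, he.numV, he.numE, prod_range, prod_range]
  congr 1
  · refine prod_congr rfl fun v _ => ?_
    by_cases hv : CutCount.ownV o h x v
    · rw [if_pos hv, if_pos ((he.ownV x v).1 hv), he.dg ((he.inB x v).1 hv.1)]
    · rw [if_neg hv, if_neg fun hh => hv ((he.ownV x v).2 hh)]
  · refine prod_congr rfl fun e _ => ?_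
    by_cases hv : CutCount.ownE o h x e
    · have h1 := (he.hasE x e).1 hv.1
      rw [if_pos hv, if_pos ((he.ownE x e).1 hv), he.fst, he.snd, he.dg h1.1, he.dg h1.2]
    · rw [if_neg hv, if_neg fun hh => hv ((he.ownE x e).2 hh)]

/-- Functions of the memory which do not depend on the scratch memory. -/
structure Stable (aF : ℕ → ℕ → ℕ → Mem → ℕ) (bF : ℕ → ℕ → Mem → ℕ) : Prop where
  vertex : ∀ {h h'}, SameOff scratch h h' → ∀ r v s, aF r v s h' = aF r v s h
  edge : ∀ {h h'}, SameOff scratch h h' → ∀ s s', bF s s' h' = bF s s' h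

variable {aF : ℕ → ℕ → ℕ → Mem → ℕ} {bF : ℕ → ℕ → Mem → ℕ}

open Classical in
theorem initTables_spec (he : Enc o ends T bag h) (ho : o ≤ 3) {q : ℕ} (hq : h 9 0 = q) (hq1 : 1 ≤ q)
    (hK : ∀ z, 3 ^ (bag z).card ≤ h 9 1) (hst : Stable aF bF) (r : ℕ) :
    SameOff {12, 14, 16} h (initTables o aF bF r h) ∧
    (∀ x : Fin N, initTables o aF bF r h 14 x ≠ 0) ∧
    ∀ (x : Fin N), ∀ j < 3 ^ (bag x).card,
      ((initTables o aF bF r h 12 (j * N + x) : ℕ) : ZMod (q + 1)) = localFactor o aF bF r x j h := by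
  have e' : ∀ {h'}, SameOff {12, 14, 16} h h' → Enc o ends T bag h' := fun hs =>
    he.of_sameOff ho hs (by decide)
  obtain ⟨f1, f2⟩ := floop_induct (F := fun x h => forAsg o x (fun j h =>
      put 12 (j * h 1 2 + x) (localFactor o aF bF r x j h) h) (put 14 x 1 h)) (n := h 1 2)
    (h := h) (fun k h' => SameOff {12, 14, 16} h h' ∧ ∀ x : Fin N, (x : ℕ) < k → h' 14 x ≠ 0 ∧
      ∀ j < 3 ^ (bag x).card,
        ((h' 12 (j * N + x) : ℕ) : ZMod (q + 1)) = localFactor o aF bF r x j h)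
    ⟨SameOff.refl _ _, by simp⟩ (by
      rintro i hi h' ⟨a, b⟩
      rw [he.numN] at hi
      obtain ⟨i, rfl⟩ : ∃ i' : Fin N, i = i' := ⟨⟨i, hi⟩, rfl⟩
      have a1 : SameOff {12, 14, 16} h (put 14 i 1 h') := a.put (by decide) _ _
      have q1 : ∀ {h''}, SameOff {12, 14, 16} h h'' → h'' 9 0 = q := fun hs => by
        rw [hs 9 (by decide), hq]
      -- The tables are interleaved in a single array, so the invariant has to preserve those of the
      -- earlier nodes as well.
      obtain ⟨c1, c2, c3⟩ := forAsg_induct (o := o) (x := i) (h := put 14 i 1 h')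
        (F := fun j h => put 12 (j * h 1 2 + i) (localFactor o aF bF r i j h) h)
        (c := 3 ^ (bag i).card)
        (fun j h'' => SameOff {12, 14, 16} h h'' ∧ (∀ x : Fin N, (x : ℕ) < i + 1 → h'' 14 x ≠ 0) ∧
          ∀ x : Fin N, ∀ k < 3 ^ (bag x).card, (x : ℕ) < i ∨ x = i ∧ k < j →
            ((h'' 12 (k * N + x) : ℕ) : ZMod (q + 1)) = localFactor o aF bF r x k h)
        (by rw [a1 9 (by decide)]; exact hK i)
        ⟨a1, fun x hx => by
          by_cases hxi : x = i
          · subst hxi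
            rw [put, Mem.set_apply, if_pos ⟨rfl, rfl⟩, q1 a, Nat.mod_eq_of_lt (by omega)]
            exact one_ne_zero
          · have : (x : ℕ) ≠ i := fun hh => hxi (Fin.ext hh)
            rw [put_of_ne _ fun _ => this]
            exact (b x (by omega)).1, fun x k hk hx => by
          rw [put, Mem.set_of_ne _ _ _ (by decide)]
          exact (b x (by omega)).2 k hk⟩
        (by
          rintro j k h'' ⟨a, b, c⟩
          rw [Mem.set_of_ne _ _ _ (by decide), Mem.set_of_ne _ _ _ (by decide)]
          exact ⟨a.set (by decide) _ _, b, c⟩)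
        (fun j h'' hI => (e' hI.1).asgCount i)
        (by
          rintro j hj h'' ⟨a, b, c⟩
          have hN'' : h'' 1 2 = N := (e' a).numN
          have hl : localFactor o aF bF r i j h'' = localFactor o aF bF r i j h := by
            rw [(e' a).localFactor, he.localFactor]
            simp only [hst.vertex (a.mono (by decide)), hst.edge (a.mono (by decide))]
          refine ⟨a.put (by decide) _ _, fun x hx => ?_, fun x k hk hx => ?_⟩
          · rw [put, Mem.set_of_ne _ _ _ (by decide)]
            exact b x hx
          · rw [hN'']
            by_cases hxk : k = j ∧ x = i
            · obtain ⟨rfl, rfl⟩ := hxk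
              rw [put_same (q1 a), hl]
            · rw [put_of_ne _ fun _ hh => hxk (addr_inj.1 hh)]
              refine c x k hk ?_
              rcases hx with hx | ⟨rfl, hx⟩
              · exact Or.inl hx
              · exact Or.inr ⟨rfl, by
                  have : k ≠ j := fun hh => hxk ⟨hh, rfl⟩
                  omega⟩)
      refine ⟨c1, fun x hx => ⟨c2 x hx, fun j hj => c3 x j hj ?_⟩⟩
      by_cases hxi : x = i
      · exact Or.inr ⟨hxi, hxi ▸ hj⟩
      · have : (x : ℕ) ≠ i := fun hh => hxi (Fin.ext hh)
        omega)
  exact ⟨f1, fun x => (f2 x (by rw [he.numN]; exact x.2)).1,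
    fun x => (f2 x (by rw [he.numN]; exact x.2)).2⟩

/-- The sum over all assignments of the product of the weights of vertices and edges. -/
def partitionFun {n m : ℕ} (ends : Fin m → Fin n × Fin n) (a : Fin n → ℕ → ℕ) (b : ℕ → ℕ → ℕ) : ℕ :=
  ∑ σ ∈ assignments univ, (∏ v, a v (σ v)) * ∏ e, b (σ (ends e).1) (σ (ends e).2)

/-- Merging does not change `tableSum`. For the initial tables, the product over all nodes collects
the weight of each vertex and each edge once (`prod_isFirst`), which is the summand of the partition
function. -/
theorem partition_spec {D : TreeDecomposition (graphOf ends) N}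
    (he : Enc o ends D.tree D.bag h) (ho : o ≤ 3) (hq1 : 1 ≤ h 9 0)
    (hK : ∀ z, 3 ^ (D.bag z).card ≤ h 9 1) (hst : Stable aF bF) (r : ℕ) :
    SameOff scratch h (partition o aF bF r h) ∧ partition o aF bF r h 15 0 =
      partitionFun ends (fun v s => aF r v s h) (fun s s' => bF s s' h) % (h 9 0 + 1) := by
  classical
  obtain ⟨a1, a2, a3⟩ := initTables_spec (q := h 9 0) he ho rfl hq1 hK hst r
  rw [partition]
  set h1 := initTables o aF bF r h
  have e1 : Enc o ends D.tree D.bag h1 := he.of_sameOff ho a1 (by decide)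
  have q1 : h1 9 = h 9 := a1 9 (by decide)
  obtain ⟨x, hM⟩ := mergeAll_spec (q := h 9 0) e1 ho (by rw [q1]) (by rw [q1]; exact hK) D.isTree
    (fun v => D.connected v (Set.mem_univ _)) a2
  have e2 : Enc o ends D.tree D.bag (mergeAll o h1) := e1.of_sameOff ho hM.same (by decide)
  have q2 : mergeAll o h1 9 = h 9 := (hM.same 9 (by decide)).trans q1
  obtain ⟨c1, c2, c3⟩ := sumTables_spec (q := h 9 0) e2 ho (by rw [q2]) (by rw [q2]; exact hK) hM.alive
  refine ⟨((a1.mono (by decide)).trans (hM.same.mono (by decide))).trans (c1.mono (by decide)), ?_⟩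
  -- The stored number is a remainder, so it is determined by its residue class.
  rw [← Nat.mod_eq_of_lt c2]
  change _ ≡ _ [MOD _]
  rw [← ZMod.natCast_eq_natCast_iff, c3, hM.sum_eq, tableSum, partitionFun, Nat.cast_sum]
  have hU : univ.biUnion D.bag = univ := by
    ext v
    simpa using D.vertex_mem v (Set.mem_univ _)
  rw [hU]
  refine sum_congr rfl fun σ hσ => ?_
  rw [mem_assignments] at hσ
  have hi := fun z => idx_spec (U := D.bag z) hσ.1
  have hres : ∀ z, ∀ v ∈ D.bag z, dec (D.bag z) (idx (D.bag z) σ) v = σ v := fun z v hv => by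
    rw [(hi z).2, restrictTo, if_pos hv]
  simp only [a3 _ _ (hi _).1, he.localFactor]
  rw [← Nat.cast_prod, prod_mul_distrib, prod_comm, prod_comm (s := univ (α := Fin N))]
  congr 2
  · refine prod_congr rfl fun v _ => prod_isFirst (D.vertex_mem v (Set.mem_univ _)) _ _ fun z hz => ?_
    rw [hres z v hz.1]
  · refine prod_congr rfl fun e _ => prod_isFirst (P := fun x => (ends e).1 ∈ D.bag x ∧ (ends e).2 ∈ D.bag x)
      (D.edge_mem e _ _ rfl) _ _ fun z hz => ?_
    rw [hres z _ hz.1.1, hres z _ hz.1.2]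

end
end CutCount

namespace CutCount
open Finset

/-! ### Counting with digits -/

theorem sum_pow_lt {I : Type*} {A : Finset I} {X k : ℕ} {id : I → ℕ} (hA : A.card < X)
    (hk : ∀ x ∈ A, id x < k) : ∑ x ∈ A, X ^ id x < X ^ k := by
  rcases A.eq_empty_or_nonempty with rfl | ⟨a, ha⟩
  · simpa using Nat.pow_pos (by omega)
  · obtain ⟨k, rfl⟩ : ∃ j, k = j + 1 := ⟨k - 1, by have := hk a ha; omega⟩
    calc ∑ x ∈ A, X ^ id x ≤ A.card • X ^ k := sum_le_card_nsmul _ _ _ fun x hx =>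
          Nat.pow_le_pow_right (by omega) (Nat.lt_succ_iff.1 (hk x hx))
      _ < X * X ^ k := by
          rw [smul_eq_mul]
          exact Nat.mul_lt_mul_of_pos_right hA (Nat.pow_pos (by omega))
      _ = X ^ (k + 1) := by ring

/-- Each digit is a number of items, hence less than `X`, and no carries occur. -/
theorem sum_pow_digit {I : Type*} {A : Finset I} {X : ℕ} {id : I → ℕ} (hA : A.card < X) (k : ℕ) :
    (∑ x ∈ A, X ^ id x) / X ^ k % X = (A.filter fun x => id x = k).card := by
  have h1 : ∑ x ∈ A with id x < k, X ^ id x < X ^ k :=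
    sum_pow_lt ((card_filter_le _ _).trans_lt hA) fun x hx => (mem_filter.1 hx).2
  have h2 : ∑ x ∈ A with ¬ id x < k, X ^ id x =
      X ^ k * ((A.filter fun x => id x = k).card + X * ∑ x ∈ A with k < id x, X ^ (id x - k - 1)) := by
    rw [← sum_filter_add_sum_filter_not (A.filter fun x => ¬ id x < k) fun x => id x = k,
      filter_filter, filter_filter, mul_add]
    congr 1
    · have : (A.filter fun x => ¬ id x < k ∧ id x = k) = A.filter fun x => id x = k :=
        filter_congr fun x _ => by omega
      rw [this, sum_congr rfl fun x hx => by rw [(mem_filter.1 hx).2], sum_const, smul_eq_mul,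
        mul_comm]
    · have : (A.filter fun x => ¬ id x < k ∧ ¬ id x = k) = A.filter fun x => k < id x :=
        filter_congr fun x _ => by omega
      rw [this, mul_sum, mul_sum]
      refine sum_congr rfl fun x hx => ?_
      rw [← mul_assoc, ← pow_succ, ← pow_add]
      congr 1
      have := (mem_filter.1 hx).2
      omega
  rw [← sum_filter_add_sum_filter_not A fun x => id x < k, h2,
    Nat.add_mul_div_left _ _ (Nat.pow_pos (by omega)), Nat.div_eq_of_lt h1, zero_add,
    Nat.add_mul_mod_self_left, Nat.mod_eq_of_lt ((card_filter_le _ _).trans_lt hA)]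

/-! ### Finding a solution -/

/-- The set `S` agrees with the decisions in `c`. -/
def Compat {n : ℕ} (c : ℕ → ℕ) (S : Finset (Fin n)) : Prop :=
  ∀ v : Fin n, (c v = 1 → v ∈ S) ∧ (c v = 2 → v ∉ S)

/-- The arrays which the search for a solution changes. -/
def changed : Finset ℕ := {0, 11, 12, 13, 14, 15, 16, 17}

open Classical in
/-- The partition function counts `items`, each of which comes with a set of vertices and
with an index, and the sets of vertices which pass the test are solutions. -/
structure Model {n m : ℕ} (ends : Fin m → Fin n × Fin n) (aF : ℕ → ℕ → ℕ → Mem → ℕ)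
    (bF : ℕ → ℕ → Mem → ℕ) (tF : ℕ → Mem → ℕ) (h : Mem) (r : ℕ) (Sol : Set (Finset (Fin n)))
    {I : Type} (items : Finset I) (set : I → Finset (Fin n)) (id : I → ℕ) : Prop where
  card_lt : items.card < h 9 2
  id_lt : ∀ x ∈ items, id x < h 8 4
  sum_eq : ∀ h', SameOff changed h h' →
    partitionFun ends (fun v s => aF r v s h') (fun s s' => bF s s' h') ≡
      ∑ x ∈ items with Compat (h' 11) (set x), h 9 2 ^ id x [MOD h 9 0 + 1]
  sound : ∀ S, ∀ i < h 8 4,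
    ¬ 2 ^ tF i h ∣ (items.filter fun x => set x = S ∧ id x = i).card → S ∈ Sol

/-- The memory is ready for the search for a solution. -/
structure Ready {n m N : ℕ} (o : ℕ) {ends : Fin m → Fin n × Fin n}
    (D : TreeDecomposition (graphOf ends) N) (tF : ℕ → Mem → ℕ) (h : Mem) : Prop where
  enc : Enc o ends D.tree D.bag h
  offset : 2 ≤ o ∧ o ≤ 3
  two_le : 2 ≤ h 9 0
  table_le : ∀ z, 3 ^ (D.bag z).card ≤ h 9 1
  base_dvd : ∀ i, 2 ^ tF i h ∣ h 9 2
  base_pos : 2 ≤ h 9 2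
  base_pow : h 9 2 ^ h 8 4 ≤ h 9 0 + 1
  test : ∀ h', SameOff changed h h' → ∀ i, tF i h' = tF i h

section
variable {o n m N : ℕ} {ends : Fin m → Fin n × Fin n} {D : TreeDecomposition (graphOf ends) N}
  {aF : ℕ → ℕ → ℕ → Mem → ℕ} {bF : ℕ → ℕ → Mem → ℕ} {tF : ℕ → Mem → ℕ} {h h' : Mem}

theorem Ready.of_sameOff (hr : Ready o D tF h) (hs : SameOff changed h h') : Ready o D tF h' where
  enc := hr.enc.of_eq fun x hx => hs x fun hxA => by
    have := hr.offset
    simp only [changed, mem_insert, mem_singleton] at hxA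
    omega
  offset := hr.offset
  two_le := by rw [hs 9 (by decide)]; exact hr.two_le
  table_le := by rw [hs 9 (by decide)]; exact hr.table_le
  base_dvd := by rw [hs 9 (by decide)]; simpa only [hr.test _ hs] using hr.base_dvd
  base_pos := by rw [hs 9 (by decide)]; exact hr.base_pos
  base_pow := by rw [hs 9 (by decide), hs 8 (by decide)]; exact hr.base_pow
  test := fun h'' hs' i => by rw [hr.test _ (hs.trans hs'), hr.test _ hs]

open Classical in
/-- The number of items with index `i` which agree with the decisions in `c`. -/
noncomputable def itemCount {I : Type} (items : Finset I) (set : I → Finset (Fin n)) (id : I → ℕ)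
    (c : ℕ → ℕ) (i : ℕ) : ℕ :=
  (items.filter fun x => Compat c (set x) ∧ id x = i).card

variable {r : ℕ} {Sol : Set (Finset (Fin n))} {I : Type} {items : Finset I}
  {set : I → Finset (Fin n)} {id : I → ℕ}

/-- The weighted sum is below the modulus, so the remainder is the sum itself. As `2 ^ t` divides
the base, reducing the shifted number modulo `2 ^ t` reduces the digit number `i`. -/
theorem Model.accept_iff (hm : Model ends aF bF tF h r Sol items set id) (hr : Ready o D tF h)
    (hst : Stable aF bF) (hs : SameOff changed h h') {h'' : Mem} (hs' : SameOff changed h h'')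
    (hZ : h'' 15 0 = partition o aF bF r h' 15 0) {i : ℕ} (hi : i < h 8 4) :
    accept tF i h'' ↔ ¬ 2 ^ tF i h ∣ itemCount items set id (h' 11) i := by
  classical
  have hr' := hr.of_sameOff hs
  have h9 := hs 9 (by decide)
  have hcard : (items.filter fun x => Compat (h' 11) (set x)).card < h 9 2 :=
    (card_filter_le _ _).trans_lt hm.card_lt
  have h1 : h'' 15 0 = ∑ x ∈ items with Compat (h' 11) (set x), h 9 2 ^ id x := by
    rw [hZ, (partition_spec hr'.enc hr'.offset.2 ((Nat.le_succ 1).trans hr'.two_le) hr'.table_le hst r).2,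
      h9]
    have h2 := hm.sum_eq h' hs
    rw [Nat.ModEq] at h2
    rw [h2]
    exact Nat.mod_eq_of_lt ((sum_pow_lt hcard fun x hx => hm.id_lt x (mem_filter.1 hx).1).trans_le
      hr.base_pow)
  rw [accept, h1, hs' 9 (by decide), hs' 8 (by decide), if_pos hi, hr.test _ hs',
    ← Nat.mod_mod_of_dvd _ (hr.base_dvd i), sum_pow_digit hcard, itemCount, filter_filter, ne_eq,
    Nat.dvd_iff_mod_eq_zero]

theorem search_spec (hr : Ready o D tF h) (hs : SameOff changed h h') :
    SameOff {17} h' (search tF h') ∧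
    (search tF h' 17 1 ≠ 0 → search tF h' 17 2 < h 8 4 ∧ accept tF (search tF h' 17 2) h') ∧
    ((∃ i < h 8 4, accept tF i h') → search tF h' 17 1 ≠ 0) := by
  classical
  rw [search]
  have hq := hr.two_le
  -- The index is reduced when it is written; it is unharmed since `i < h 8 4 < 2 ^ h 8 4 ≤ h 9 0 +
  -- 1`.
  have hB : ∀ i < h 8 4, i ≤ h 9 0 := fun i hi => by
    have h1 : 2 ^ h 8 4 ≤ h 9 2 ^ h 8 4 := Nat.pow_le_pow_left hr.base_pos _
    have h2 := (h 8 4).lt_two_pow_self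
    have := hr.base_pow
    omega
  set h1 := put 17 1 0 h' with hh1
  have s1 : SameOff {17} h' h1 := (SameOff.refl _ _).put (by decide) _ _
  have acc : ∀ {h''}, SameOff {17} h' h'' → ∀ i, accept tF i h'' ↔ accept tF i h' := by
    intro h'' hs'' i
    rw [accept, accept, hs'' 15 (by decide), hs'' 9 (by decide), hs'' 8 (by decide), hr.test _ hs,
      hr.test _ (hs.trans (hs''.mono (by decide)))]
  have := floop_induct (F := fun i h => if accept tF i h then put 17 2 i (put 17 1 1 h) else h)
    (n := h1 8 4) (h := h1) (fun k h'' => SameOff {17} h' h'' ∧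
      (h'' 17 1 ≠ 0 → h'' 17 2 < h 8 4 ∧ accept tF (h'' 17 2) h') ∧
      ((∃ i < k, accept tF i h') → h'' 17 1 ≠ 0))
    ⟨s1, by simp [hh1, put, Mem.set_apply], by simp⟩ (by
      rintro i hi h'' ⟨a, b, c⟩
      rw [s1 8 (by decide), hs 8 (by decide)] at hi
      have hq'' : h'' 9 0 = h 9 0 := by rw [a 9 (by decide), hs 9 (by decide)]
      split_ifs with hacc
      · have hp : (put 17 1 1 h'') 9 0 = h 9 0 := by
          rw [put, Mem.set_of_ne _ _ _ (by decide), hq'']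
        refine ⟨(a.put (by decide) _ _).put (by decide) _ _, fun _ => ?_, fun _ => ?_⟩
        · rw [put, Mem.set_apply, if_pos ⟨rfl, rfl⟩, hp, Nat.mod_eq_of_lt (by have := hB i hi; omega)]
          exact ⟨hi, (acc a i).1 hacc⟩
        · rw [put_of_ne _ (by decide), put, Mem.set_apply, if_pos ⟨rfl, rfl⟩, hq'',
            Nat.mod_eq_of_lt (by omega)]
          exact one_ne_zero
      · refine ⟨a, b, ?_⟩
        rintro ⟨j, hj, hj'⟩
        rcases Nat.lt_succ_iff_lt_or_eq.1 hj with h1 | rfl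
        · exact c ⟨j, h1, hj'⟩
        · exact absurd ((acc a j).2 hj') hacc)
  refine ⟨this.1, this.2.1, fun hi => this.2.2 ?_⟩
  rwa [s1 8 (by decide), hs 8 (by decide)]

/-- If `2 ^ t` does not divide the count before the decision on `v`, then it does not divide both
counts after it. So when membership fails the test, exclusion must be right. -/
theorem itemCount_split {c c₁ c₂ : ℕ → ℕ} {v : ℕ} (hv : v < n) (h0 : c v = 0) (h1 : c₁ v = 1)
    (h2 : c₂ v = 2) (h1' : ∀ u, u ≠ v → c₁ u = c u) (h2' : ∀ u, u ≠ v → c₂ u = c u) (i : ℕ) :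
    itemCount items set id c i = itemCount items set id c₁ i + itemCount items set id c₂ i := by
  classical
  have key : ∀ S : Finset (Fin n), (Compat c₁ S ↔ Compat c S ∧ ⟨v, hv⟩ ∈ S) ∧
      (Compat c₂ S ↔ Compat c S ∧ ⟨v, hv⟩ ∉ S) := by
    intro S
    have hu : ∀ u : Fin n, u = ⟨v, hv⟩ ∨ (u : ℕ) ≠ v := fun u => by
      by_cases hh : (u : ℕ) = v
      · exact Or.inl (Fin.ext hh)
      · exact Or.inr hh
    refine ⟨⟨fun hh => ⟨fun u => ?_, (hh ⟨v, hv⟩).1 h1⟩, fun hh u => ?_⟩,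
      ⟨fun hh => ⟨fun u => ?_, (hh ⟨v, hv⟩).2 h2⟩, fun hh u => ?_⟩⟩
    · rcases hu u with rfl | hne
      · simp [h0]
      · rw [← h1' u hne]
        exact hh u
    · rcases hu u with rfl | hne
      · simp [h1, hh.2]
      · rw [h1' u hne]
        exact hh.1 u
    · rcases hu u with rfl | hne
      · simp [h0]
      · rw [← h2' u hne]
        exact hh u
    · rcases hu u with rfl | hne
      · simp [h2, hh.2]
      · rw [h2' u hne]
        exact hh.1 u
  rw [itemCount, itemCount, itemCount,
    ← card_filter_add_card_filter_not (s := items.filter fun x => Compat c (set x) ∧ id x = i)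
      (fun x => ⟨v, hv⟩ ∈ set x), filter_filter, filter_filter]
  congr 2
  · exact filter_congr fun x _ => by rw [(key _).1]; tauto
  · exact filter_congr fun x _ => by rw [(key _).2]; tauto

/-- The set of the vertices which have been decided to belong to the solution. -/
def chosen (n : ℕ) (c : ℕ → ℕ) : Finset (Fin n) := univ.filter fun v : Fin n => c v = 1

theorem compat_iff_eq_chosen {c : ℕ → ℕ} (hc : ∀ v < n, c v = 1 ∨ c v = 2) (S : Finset (Fin n)) :
    Compat c S ↔ S = chosen n c := by
  constructor
  · intro hh
    ext v
    rw [chosen, mem_filter]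
    rcases hc v v.2 with h1 | h1
    · simp [h1, (hh v).1 h1]
    · simp [h1, (hh v).2 h1]
  · rintro rfl v
    rw [chosen, mem_filter]
    refine ⟨fun h1 => ⟨mem_univ _, h1⟩, fun h1 h2 => ?_⟩
    rw [h1] at h2
    exact absurd h2.2 (by decide)

theorem put_eq {q : ℕ} (hq : h 9 0 = q) {x i a : ℕ} (ha : a ≤ q) : put x i a h x i = a := by
  rw [put, Mem.set_apply, if_pos ⟨rfl, rfl⟩, hq, Nat.mod_eq_of_lt (by omega)]

/-- The invariant is that the number of compatible items with the fixed index is not divisible by `2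
^ t`. Once all vertices are decided, only the chosen set is compatible, and `Model.sound` applies to
it. -/
theorem descend_spec (hm : Model ends aF bF tF h r Sol items set id) (hr : Ready o D tF h)
    (hst : Stable aF bF) (hs : SameOff changed h h') (hi : h' 17 2 < h 8 4)
    (hc : ∀ v < n, h' 11 v = 0)
    (hcount : ¬ 2 ^ tF (h' 17 2) h ∣ itemCount items set id (h' 11) (h' 17 2)) :
    SameOff (changed.erase 0) h' (descend o aF bF tF r h') ∧
      chosen n (descend o aF bF tF r h' 11) ∈ Sol := by
  classical
  have hN : h' 1 0 = n := (hr.of_sameOff hs).enc.numV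
  have hq := hr.two_le
  obtain ⟨a, _, b, c⟩ := floop_induct (F := fun v h => (fun h =>
      if accept tF (h 17 2) h then h else put 11 v 2 h) (partition o aF bF r (put 11 v 1 h)))
    (n := h' 1 0) (h := h') (fun k h'' => SameOff (changed.erase 0) h' h'' ∧ h'' 17 = h' 17 ∧
      (∀ v < n, if v < k then h'' 11 v = 1 ∨ h'' 11 v = 2 else h'' 11 v = 0) ∧
      ¬ 2 ^ tF (h' 17 2) h ∣ itemCount items set id (h'' 11) (h' 17 2))
    ⟨SameOff.refl _ _, rfl, by simpa using hc, hcount⟩ (by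
      rintro v hv h'' ⟨a, a', b, c⟩
      rw [hN] at hv
      have q2 : h'' 9 0 = h 9 0 := by rw [a 9 (by decide), hs 9 (by decide)]
      have hv0 : h'' 11 v = 0 := by simpa using b v hv
      set h1 := put 11 v 1 h'' with hh1
      have s1 : SameOff (changed.erase 0) h' h1 := a.put (by decide) _ _
      have s1' : SameOff changed h h1 := hs.trans (s1.mono (erase_subset _ _))
      have hr1 := hr.of_sameOff s1'
      have p1 := (partition_spec hr1.enc hr1.offset.2 ((Nat.le_succ 1).trans hr1.two_le) hr1.table_le
        hst r).1
      set h2 := partition o aF bF r h1 with hh2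
      have s2 : SameOff (changed.erase 0) h' h2 := s1.trans (p1.mono (by decide))
      have s2' : SameOff changed h h2 := hs.trans (s2.mono (erase_subset _ _))
      have e17 : h2 17 = h' 17 := by
        rw [p1 17 (by decide), hh1, put, Mem.set_of_ne _ _ _ (by decide), a']
      have e11 : h2 11 = h1 11 := p1 11 (by decide)
      have hv1 : h1 11 v = 1 := put_eq q2 (by omega)
      have hne1 : ∀ u, u ≠ v → h1 11 u = h'' 11 u := fun u hu => put_of_ne _ fun _ => hu
      have hacc := hm.accept_iff hr hst s1' s2' rfl hi
      dsimp only
      rw [e17]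
      have q3 : h2 9 0 = h 9 0 := by rw [s2' 9 (by decide)]
      have hv2 : put 11 v 2 h2 11 v = 2 := put_eq q3 (by omega)
      have hne2 : ∀ u, u ≠ v → put 11 v 2 h2 11 u = h'' 11 u := fun u hu => by
        rw [put_of_ne _ fun _ => hu, e11, hne1 u hu]
      have hsplit := itemCount_split (items := items) (set := set) (id := id) hv hv0 hv1 hv2 hne1 hne2
        (h' 17 2)
      split_ifs with hA
      · refine ⟨s2, e17, fun u hu => ?_, ?_⟩
        · rw [e11]
          by_cases huv : u = v
          · subst huv
            rw [if_pos (by omega)]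
            exact Or.inl hv1
          · rw [hne1 u huv]
            have := b u hu
            split_ifs at this ⊢ <;> first | assumption | omega
        · rw [e11]
          exact hacc.1 hA
      · refine ⟨s2.put (by decide) _ _, ?_, fun u hu => ?_, fun hd => ?_⟩
        · rw [put, Mem.set_of_ne _ _ _ (by decide), e17]
        · by_cases huv : u = v
          · subst huv
            rw [if_pos (by omega)]
            exact Or.inr hv2
          · rw [hne2 u huv]
            have := b u hu
            split_ifs at this ⊢ <;> first | assumption | omega
        · rw [hacc, not_not] at hA
          exact c (by rw [hsplit]; exact dvd_add hA hd))
  rw [descend]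
  refine ⟨a, hm.sound _ _ hi ?_⟩
  convert c using 2
  refine congrArg card (filter_congr fun x _ => ?_)
  rw [compat_iff_eq_chosen]
  intro v hv
  simpa [hN, hv] using b v hv

theorem report_spec (hN : h 1 0 = n) (hq : 1 ≤ h 9 0) :
    SameOff {0} h (report h) ∧ output n ⟨report h, []⟩ = some (chosen n (h 11)) := by
  rw [report]
  set h1 := put 0 0 1 h with hh1
  have s1 : SameOff {0} h h1 := (SameOff.refl _ _).put (by decide) _ _
  obtain ⟨a, b, c⟩ := floop_induct (F := fun v h => put 0 (v + 1) (if h 11 v = 1 then 1 else 0) h)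
    (n := h1 1 0) (h := h1) (fun k h' => SameOff {0} h h' ∧ h' 0 0 = 1 ∧
      ∀ v < k, h' 0 (v + 1) = if h 11 v = 1 then 1 else 0)
    ⟨s1, put_eq rfl hq, by simp⟩ (by
      rintro i hi h' ⟨a, b, c⟩
      refine ⟨a.put (by decide) _ _, ?_, fun v hv => ?_⟩
      · rw [put_of_ne _ (by omega), b]
      · rw [a 11 (by decide)]
        by_cases hvi : v = i
        · subst hvi
          refine put_eq rfl ?_
          rw [a 9 (by decide)]
          split_ifs <;> omega
        · rw [put_of_ne _ (by omega), c v (by omega)])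
  refine ⟨a, ?_⟩
  rw [output, if_neg (by simp [b])]
  congr 1
  ext v
  rw [chosen, mem_filter, mem_filter]
  dsimp only
  rw [c v (by rw [s1 1 (by decide), hN]; exact v.2)]
  split_ifs with h1 <;> simp [h1]

theorem round_spec (hm : Model ends aF bF tF h r Sol items set id) (hr : Ready o D tF h)
    (hst : Stable aF bF) (hs : SameOff changed h h') :
    SameOff changed h (round o aF bF tF r h') ∧
      ((round o aF bF tF r h' 0 = h' 0 ∧
        ∀ i < h 8 4, 2 ^ tF i h ∣ (items.filter fun x => id x = i).card) ∨
      ∃ S ∈ Sol, output n ⟨round o aF bF tF r h', []⟩ = some S) := by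
  classical
  have hq := hr.two_le
  have hN : h' 1 0 = n := (hr.of_sameOff hs).enc.numV
  rw [round]
  obtain ⟨a1, a2⟩ := floop_induct (F := fun v h => put 11 v 0 h) (n := h' 1 0) (h := h')
    (fun k h'' => SameOff {11} h' h'' ∧ ∀ v < k, h'' 11 v = 0) ⟨SameOff.refl _ _, by simp⟩ (by
      rintro i hi h'' ⟨a, b⟩
      refine ⟨a.put (by decide) _ _, fun v hv => ?_⟩
      by_cases hvi : v = i
      · subst hvi
        exact put_eq rfl (Nat.zero_le _)
      · rw [put_of_ne _ fun _ => hvi, b v (by omega)])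
  set h1 := floop (fun v h => put 11 v 0 h) (h' 1 0) h'
  replace a2 : ∀ v < n, h1 11 v = 0 := fun v hv => a2 v (by rwa [hN])
  have s1 : SameOff changed h h1 := hs.trans (a1.mono (by decide))
  have hr1 := hr.of_sameOff s1
  have p1 := (partition_spec hr1.enc hr1.offset.2 ((Nat.le_succ 1).trans hr1.two_le) hr1.table_le
    hst r).1
  have hacc : ∀ {i}, i < h 8 4 → (accept tF i (partition o aF bF r h1) ↔
      ¬ 2 ^ tF i h ∣ itemCount items set id (h1 11) i) := fun hi =>
    hm.accept_iff hr hst s1 (s1.trans (p1.mono (by decide))) rfl hi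
  set h2 := partition o aF bF r h1
  have s2 : SameOff changed h h2 := s1.trans (p1.mono (by decide))
  obtain ⟨b1, b2, b3⟩ := search_spec hr s2
  set h3 := search tF h2
  have s3 : SameOff changed h h3 := s2.trans (b1.mono (by decide))
  have e11 : h3 11 = h1 11 := (b1 11 (by decide)).trans (p1 11 (by decide))
  dsimp only
  split_ifs with hf
  · obtain ⟨c1, c2⟩ := b2 hf
    rw [hacc c1, ← e11] at c2
    obtain ⟨d1, d2⟩ := descend_spec hm hr hst s3 c1 (by rw [e11]; exact a2) c2
    have s4 : SameOff changed h (descend o aF bF tF r h3) := s3.trans (d1.mono (erase_subset _ _))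
    obtain ⟨f1, f2⟩ := report_spec (n := n) (h := descend o aF bF tF r h3)
      ((hr.of_sameOff s4).enc.numV) (by rw [s4 9 (by decide)]; omega)
    exact ⟨s4.trans (f1.mono (by decide)), Or.inr ⟨_, d2, f2⟩⟩
  · refine ⟨s3, Or.inl ⟨?_, fun i hi => ?_⟩⟩
    · rw [b1 0 (by decide), p1 0 (by decide), a1 0 (by decide)]
    · have := mt (fun hA => b3 ⟨i, hi, hA⟩) hf
      rw [hacc hi, not_not, itemCount] at this
      convert this using 2
      refine filter_congr fun x _ => ?_
      rw [and_iff_right]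
      intro v
      rw [a2 v v.2]
      simp

/-- The result of all the rounds. -/
theorem rounds_spec {item : ℕ → Type} {items : ∀ r, Finset (item r)}
    {set : ∀ r, item r → Finset (Fin n)} {id : ∀ r, item r → ℕ}
    (hm : ∀ r < h 8 1, Model ends aF bF tF h r Sol (items r) (set r) (id r)) (hr : Ready o D tF h)
    (hst : Stable aF bF) (h0 : h 0 0 = 0) :
    (∀ S, output n ⟨rounds o aF bF tF h, []⟩ = some S → S ∈ Sol) ∧
    ((∃ r < h 8 1, ∃ i < h 8 4, ¬ 2 ^ tF i h ∣ ((items r).filter fun x => id r x = i).card) →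
      ∃ S ∈ Sol, output n ⟨rounds o aF bF tF h, []⟩ = some S) := by
  rw [rounds]
  obtain ⟨_, b⟩ := floop_induct (F := fun r h => round o aF bF tF r h) (n := h 8 1) (h := h)
    (fun k h' => SameOff changed h h' ∧ ((h' 0 0 = 0 ∧ ∀ r < k, ∀ i < h 8 4,
      2 ^ tF i h ∣ ((items r).filter fun x => id r x = i).card) ∨
        ∃ S ∈ Sol, output n ⟨h', []⟩ = some S)) ⟨SameOff.refl _ _, Or.inl ⟨h0, by simp⟩⟩ (by
      rintro r hr' h' ⟨a, b⟩
      obtain ⟨c1, c2⟩ := round_spec (hm r hr') hr hst a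
      refine ⟨c1, ?_⟩
      rcases c2 with ⟨c2, c3⟩ | c2
      · rcases b with ⟨b1, b2⟩ | ⟨S, b1, b2⟩
        · refine Or.inl ⟨by rw [c2, b1], fun r' hr'' => ?_⟩
          rcases Nat.lt_succ_iff_lt_or_eq.1 hr'' with h1 | rfl
          · exact b2 r' h1
          · exact c3
        · refine Or.inr ⟨S, b1, ?_⟩
          rw [← b2, output, output]
          simp only [c2]
      · exact Or.inr c2)
  rcases b with ⟨b1, b2⟩ | ⟨S, hS, b⟩
  · refine ⟨fun S hS => ?_, ?_⟩
    · rw [output, if_pos b1] at hS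
      exact absurd hS (by simp)
    · rintro ⟨r, hr, i, hi, hh⟩
      exact absurd (b2 r hr i hi) hh
  · refine ⟨fun S' hS' => ?_, fun _ => ⟨S, hS, b⟩⟩
    rw [b] at hS'
    exact Option.some.inj hS' ▸ hS

end
end CutCount

namespace CutCount
open Finset

/-! ### Restricted Independent Almost Forest Deletion -/

section
variable {n m : ℕ} (ends : Fin m → Fin n × Fin n)

/-- The edges of the graph without the vertices in `S`. -/
def edgesOff (S : Finset (Fin n)) : Finset (Fin m) :=
  univ.filter fun e => (ends e).1 ∉ S ∧ (ends e).2 ∉ S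

/-- The index of `S`, from which its size, the number of edges outside of it and its weight can be
read off. -/
def ident (w : Fin n → ℕ) (S : Finset (Fin n)) : ℕ :=
  S.card + (n + 1) * ((edgesOff ends S).card + (m + 1) * ∑ v ∈ S, w v)

/-- The vertices with value `0`. -/
def zeroSet (σ : Fin n → ℕ) : Finset (Fin n) := univ.filter fun v => σ v = 0

theorem mem_zeroSet {σ : Fin n → ℕ} {v : Fin n} : v ∈ zeroSet σ ↔ σ v = 0 := by simp [zeroSet]

/-- The two ends of an edge may have the values `s` and `s'`. -/
def Allowed (s s' : ℕ) : Prop := ¬ (s = 0 ∧ s' = 0) ∧ (s = 0 ∨ s' = 0 ∨ s = s')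

instance : DecidableRel Allowed := fun s s' => by unfold Allowed; infer_instance

variable {ends}

theorem mem_edgesOff {S : Finset (Fin n)} {e : Fin m} :
    e ∈ edgesOff ends S ↔ (ends e).1 ∉ S ∧ (ends e).2 ∉ S := by simp [edgesOff]

theorem card_edgesOff_le (S : Finset (Fin n)) : (edgesOff ends S).card ≤ m :=
  (card_le_univ _).trans (by simp)

theorem card_le_n (S : Finset (Fin n)) : S.card ≤ n := (card_le_univ _).trans (by simp)

theorem ident_mod (w : Fin n → ℕ) (S : Finset (Fin n)) : ident ends w S % (n + 1) = S.card := by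
  rw [ident, Nat.add_mul_mod_self_left, Nat.mod_eq_of_lt (Nat.lt_succ_of_le (card_le_n S))]

theorem ident_div (w : Fin n → ℕ) (S : Finset (Fin n)) :
    ident ends w S / (n + 1) = (edgesOff ends S).card + (m + 1) * ∑ v ∈ S, w v := by
  rw [ident, Nat.add_mul_div_left _ _ (Nat.succ_pos n),
    Nat.div_eq_of_lt (Nat.lt_succ_of_le (card_le_n S)), zero_add]

theorem ident_div_mod (w : Fin n → ℕ) (S : Finset (Fin n)) :
    ident ends w S / (n + 1) % (m + 1) = (edgesOff ends S).card := by
  rw [ident_div, Nat.add_mul_mod_self_left,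
    Nat.mod_eq_of_lt (Nat.lt_succ_of_le (card_edgesOff_le S))]

theorem ident_div_div (w : Fin n → ℕ) (S : Finset (Fin n)) :
    ident ends w S / (n + 1) / (m + 1) = ∑ v ∈ S, w v := by
  rw [ident_div, Nat.add_mul_div_left _ _ (Nat.succ_pos m),
    Nat.div_eq_of_lt (Nat.lt_succ_of_le (card_edgesOff_le S)), zero_add]

theorem ident_lt {w : Fin n → ℕ} {W : ℕ} (hw : ∀ v, w v ≤ W) (S : Finset (Fin n)) :
    ident ends w S < (n + 1) * ((m + 1) * (n * W + 1)) := by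
  have h1 : ∑ v ∈ S, w v ≤ n * W :=
    (sum_le_card_nsmul _ _ _ fun v _ => hw v).trans (Nat.mul_le_mul_right _ (card_le_n S))
  have h2 : (edgesOff ends S).card + (m + 1) * ∑ v ∈ S, w v < (m + 1) * (n * W + 1) := by
    have := card_edgesOff_le (ends := ends) S
    have := Nat.mul_le_mul_left (m + 1) h1
    rw [mul_add]
    omega
  have h3 := card_le_n S
  have h4 := Nat.mul_le_mul_left (n + 1) (Nat.succ_le_of_lt h2)
  rw [ident]
  rw [Nat.succ_eq_add_one, mul_add, mul_one] at h4
  omega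

/-- The index is additive: a deleted vertex adds 1 for the size and its scaled weight, a remaining
edge adds `n + 1`. Hence `X` to the index is a product of weights of vertices and edges. -/
theorem sum_exponents (w : Fin n → ℕ) (σ : Fin n → ℕ) :
    ((∑ v, if σ v = 0 then 1 + (n + 1) * ((m + 1) * w v) else 0) +
      ∑ e : Fin m, if σ (ends e).1 = 0 ∨ σ (ends e).2 = 0 then 0 else n + 1) =
        ident ends w (zeroSet σ) := by
  have h1 : (∑ e : Fin m, if σ (ends e).1 = 0 ∨ σ (ends e).2 = 0 then 0 else n + 1) =
      (edgesOff ends (zeroSet σ)).card * (n + 1) := by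
    rw [← smul_eq_mul, ← sum_const, edgesOff, sum_filter]
    refine sum_congr rfl fun e _ => ?_
    by_cases h1 : σ (ends e).1 = 0 <;> by_cases h2 : σ (ends e).2 = 0 <;> simp [mem_zeroSet, h1, h2]
  rw [h1, ← sum_filter, sum_add_distrib, sum_const, ← mul_sum, ← mul_sum, ident, zeroSet]
  simp only [smul_eq_mul]
  ring

open Classical in
/-- Products of weights which are powers or zero. -/
theorem partitionFun_eq_sum {X : ℕ} {okV : Fin n → ℕ → Prop} {okE : ℕ → ℕ → Prop}
    [∀ v s, Decidable (okV v s)] [∀ s s', Decidable (okE s s')]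
    {ev : Fin n → ℕ → ℕ} {ee : ℕ → ℕ → ℕ} :
    partitionFun ends (fun v s => if okV v s then X ^ ev v s else 0)
      (fun s s' => if okE s s' then X ^ ee s s' else 0) =
    ∑ σ ∈ assignments univ with (∀ v, okV v (σ v)) ∧ ∀ e, okE (σ (ends e).1) (σ (ends e).2),
      X ^ ((∑ v, ev v (σ v)) + ∑ e, ee (σ (ends e).1) (σ (ends e).2)) := by
  rw [partitionFun, sum_filter]
  refine sum_congr rfl fun σ _ => ?_
  rw [Fintype.prod_ite_zero, Fintype.prod_ite_zero, prod_pow_eq_pow_sum, prod_pow_eq_pow_sum, pow_add,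
    ite_and]
  split_ifs <;> simp

open Classical in
/-- The assignments with the value `0` outside of `R` only which respect all edges. -/
noncomputable def cutItems (ends : Fin m → Fin n × Fin n) (R : Finset (Fin n)) :
    Finset (Fin n → ℕ) :=
  (assignments univ).filter fun σ =>
    (∀ v ∈ R, σ v ≠ 0) ∧ ∀ e, Allowed (σ (ends e).1) (σ (ends e).2)

theorem graphOf_isLink {e : Fin m} {x y : Fin n} : (graphOf ends).IsLink e x y ↔
    s((ends e).1, (ends e).2) = s(x, y) := Iff.rfl

theorem edgeSet_deleteVerts_graphOf (S : Finset (Fin n)) :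
    (edgesOff ends S : Set (Fin m)) = ((graphOf ends).deleteVerts (S : Set (Fin n))).edgeSet := by
  ext e
  rw [Graph.edgeSet_deleteVerts, mem_coe, mem_edgesOff]
  constructor
  · rintro ⟨h1, h2⟩
    exact ⟨_, _, rfl, h1, h2⟩
  · rintro ⟨x, y, hl, hx, hy⟩
    rcases Sym2.eq_iff.1 (graphOf_isLink.1 hl) with ⟨h1, h2⟩ | ⟨h1, h2⟩
    · rw [h1, h2]
      exact ⟨hx, hy⟩
    · rw [h1, h2]
      exact ⟨hy, hx⟩

theorem vertexSet_deleteVerts_graphOf (S : Finset (Fin n)) :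
    ((Sᶜ : Finset (Fin n)) : Set (Fin n)) =
      ((graphOf ends).deleteVerts (S : Set (Fin n))).vertexSet := by
  rw [Graph.vertexSet_deleteVerts, coe_compl]
  exact Set.compl_eq_univ_sdiff _

theorem isIndependent_graphOf {S : Finset (Fin n)} : IsIndependent (graphOf ends) (S : Set (Fin n)) ↔
    ∀ e, ¬ ((ends e).1 ∈ S ∧ (ends e).2 ∈ S) := by
  constructor
  · exact fun h e => h e _ _ rfl
  · intro h e x y hl
    rcases Sym2.eq_iff.1 (graphOf_isLink.1 hl) with ⟨h1, h2⟩ | ⟨h1, h2⟩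
    · rw [← h1, ← h2]
      exact h e
    · rw [← h1, ← h2, and_comm]
      exact h e

-- The values 1 and 2 are the two colours. At an edge, `Allowed` excludes two deleted ends and
-- otherwise asks for equal colours when neither end is deleted.
open Classical in
theorem card_cutItems {R S : Finset (Fin n)} (hR : Disjoint S R)
    (hS : IsIndependent (graphOf ends) (S : Set (Fin n))) :
    ((cutItems ends R).filter fun σ => zeroSet σ = S).card =
      (cuts ((graphOf ends).deleteVerts (S : Set (Fin n))) Sᶜ (edgesOff ends S : Set (Fin m))).card := by
  rw [isIndependent_graphOf] at hS
  have hcuts : ∀ c : Fin n → Bool,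
      c ∈ cuts ((graphOf ends).deleteVerts (S : Set (Fin n))) Sᶜ (edgesOff ends S : Set (Fin m)) ↔
      (∀ v ∈ S, c v = false) ∧ ∀ e ∈ edgesOff ends S, c (ends e).1 = c (ends e).2 := by
    intro c
    rw [mem_cuts]
    refine and_congr (by simp) ⟨fun h e he => ?_, fun h e he x y hl => ?_⟩
    · have := mem_edgesOff.1 he
      exact h e he _ _ ((Graph.deleteVerts_isLink _ _).2 ⟨rfl, this.1, this.2⟩)
    · have hl' := ((Graph.deleteVerts_isLink _ _).1 hl).1
      rcases Sym2.eq_iff.1 (graphOf_isLink.1 hl') with ⟨h1, h2⟩ | ⟨h1, h2⟩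
      · rw [← h1, ← h2]
        exact h e he
      · rw [← h1, ← h2]
        exact (h e he).symm
  refine card_bij' (fun σ _ v => decide (σ v = 2))
    (fun c _ v => if v ∈ S then 0 else if c v then 2 else 1) ?_ ?_ ?_ ?_
  · intro σ hσ
    rw [mem_filter, cutItems, mem_filter] at hσ
    obtain ⟨⟨h1, h2, h3⟩, rfl⟩ := hσ
    refine (hcuts _).2 ⟨fun v hv => ?_, fun e he => ?_⟩
    · rw [mem_zeroSet.1 hv]
      rfl
    · have := mem_edgesOff.1 he
      rw [mem_zeroSet, mem_zeroSet] at this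
      rcases (h3 e).2 with h4 | h4 | h4
      · exact absurd h4 this.1
      · exact absurd h4 this.2
      · rw [h4]
  · intro c hc
    obtain ⟨h1, h2⟩ := (hcuts c).1 hc
    rw [mem_filter, cutItems, mem_filter, mem_assignments]
    refine ⟨⟨⟨fun v => ?_, fun v hv => absurd (mem_univ v) hv⟩, fun v hv => ?_, fun e => ?_⟩, ?_⟩
    · split_ifs <;> norm_num
    · dsimp only
      rw [if_neg fun hh => disjoint_left.1 hR hh hv]
      split_ifs <;> norm_num
    · have hne : ∀ v ∉ S, (if v ∈ S then 0 else if c v then 2 else 1) ≠ 0 := fun v hv => by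
        rw [if_neg hv]
        split_ifs <;> norm_num
      have hS' := hS e
      by_cases he1 : (ends e).1 ∈ S
      · have he2 : (ends e).2 ∉ S := fun hh => hS' ⟨he1, hh⟩
        exact ⟨fun hh => hne _ he2 hh.2, Or.inl (if_pos he1)⟩
      · by_cases he2 : (ends e).2 ∈ S
        · exact ⟨fun hh => hne _ he1 hh.1, Or.inr (Or.inl (if_pos he2))⟩
        · exact ⟨fun hh => hne _ he1 hh.1, Or.inr (Or.inr (by
            dsimp only
            rw [if_neg he1, if_neg he2, h2 e (mem_edgesOff.2 ⟨he1, he2⟩)]))⟩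
    · ext v
      rw [mem_zeroSet]
      by_cases hv : v ∈ S
      · simp [hv]
      · simp only [hv, if_false, iff_false]
        split_ifs <;> norm_num
  · intro σ hσ
    rw [mem_filter, cutItems, mem_filter, mem_assignments] at hσ
    obtain ⟨⟨⟨h1, _⟩, _, _⟩, rfl⟩ := hσ
    funext v
    have := h1 v
    dsimp only
    split_ifs with h4 h5
    · exact (mem_zeroSet.1 h4).symm
    · simpa using Eq.symm (by simpa using h5)
    · have : σ v ≠ 2 := by simpa using h5
      have := mt mem_zeroSet.2 h4
      omega
  · intro c hc
    obtain ⟨h1, _⟩ := (hcuts c).1 hc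
    funext v
    dsimp only
    split_ifs with h4 h5
    · simp [h1 v h4]
    · simp [h5]
    · simpa using h5

/-- There are only `m` edges. Replacing `l` by `min l m` keeps the exponent of the test polynomial,
although `l` is given in binary and may be huge. -/
theorem isAlmostForest_min {l : ℕ} {G : Graph (Fin n) (Fin m)} :
    IsAlmostForest (min l m) G ↔ IsAlmostForest l G := by
  constructor
  · rintro ⟨F, h1, h2, h3⟩
    exact ⟨F, h1, h2.trans (min_le_left _ _), h3⟩
  · rintro ⟨F, h1, h2, h3⟩
    exact ⟨F, h1, le_min h2 ((card_le_univ F).trans (by simp)), h3⟩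

/-- The number of divisions by two which a solution passes. -/
def riafdTest (n m k l i : ℕ) : ℕ :=
  if i % (n + 1) ≤ k then n - i % (n + 1) + min l m + 1 - i / (n + 1) % (m + 1) else 0

/-- The count is a power `2 ^ a`, which is indivisible by `2 ^ t` iff `a < t`, and `t` is chosen to
make this the criterion of `card_cuts_eq_two_pow`. For `|S| > k` the exponent 0 makes the test fail.
-/
theorem riafd_test_iff {R S : Finset (Fin n)} {k l : ℕ} (hR : Disjoint S R)
    (hS : IsIndependent (graphOf ends) (S : Set (Fin n))) (w : Fin n → ℕ) :
    ¬ 2 ^ riafdTest n m k l (ident ends w S) ∣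
      ((cutItems ends R).filter fun σ => zeroSet σ = S).card ↔
    S ∈ riafdSolutions (graphOf ends) R k l := by
  obtain ⟨a, h1, h2⟩ := card_cuts_eq_two_pow (vertexSet_deleteVerts_graphOf (ends := ends) S)
    (edgeSet_deleteVerts_graphOf S)
  rw [card_cutItems hR hS, h1, riafdTest, ident_mod, ident_div_mod,
    Nat.pow_dvd_pow_iff_le_right (by norm_num)]
  have h3 : IsAlmostForest l ((graphOf ends).deleteVerts (S : Set (Fin n))) ↔
      a + (edgesOff ends S).card ≤ n - S.card + min l m := by
    rw [← isAlmostForest_min, h2, card_compl, Fintype.card_fin]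
  rw [riafdSolutions, Set.mem_ofPred_eq, h3]
  constructor
  · intro h
    split_ifs at h with hk
    · exact ⟨fun _ _ => Set.mem_univ _, hk, hR, hS, by omega⟩
    · omega
  · rintro ⟨_, hk, _, _, h⟩
    rw [if_pos hk]
    omega

-- An indivisible count is not zero, so there is an item; its very existence shows that `S` avoids
-- `R` and is independent, and then `riafd_test_iff` applies.
open Classical in
theorem cutItems_sound {R S : Finset (Fin n)} {k l i : ℕ} {w : Fin n → ℕ}
    (h : ¬ 2 ^ riafdTest n m k l i ∣ ((cutItems ends R).filter fun σ =>
      zeroSet σ = S ∧ ident ends w (zeroSet σ) = i).card) :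
    S ∈ riafdSolutions (graphOf ends) R k l ∧ ident ends w S = i := by
  have hne : ((cutItems ends R).filter fun σ =>
      zeroSet σ = S ∧ ident ends w (zeroSet σ) = i).Nonempty := by
    by_contra hh
    rw [not_nonempty_iff_eq_empty] at hh
    rw [hh] at h
    simp at h
  obtain ⟨σ, hσ⟩ := hne
  rw [mem_filter, cutItems, mem_filter] at hσ
  obtain ⟨⟨_, h1, h2⟩, rfl, rfl⟩ := hσ
  refine ⟨?_, rfl⟩
  rw [← riafd_test_iff (disjoint_left.2 fun v hv hv' => h1 v hv' (mem_zeroSet.1 hv))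
    (isIndependent_graphOf.2 fun e he => (h2 e).1
      ⟨mem_zeroSet.1 he.1, mem_zeroSet.1 he.2⟩) w]
  convert h using 3
  refine filter_congr fun τ _ => ⟨fun hh => ⟨hh, by rw [hh]⟩, fun hh => hh.1⟩

-- Split the items with the index of the isolated solution `S` by their zero sets. The part of `S`
-- is not divisible by `2 ^ t`, and all other parts are.
open Classical in
theorem cutItems_complete {R : Finset (Fin n)} {k l : ℕ}
    {S₀ : Finset (Fin n)} {Ω : Type*} {wt : Ω → ℕ} {w : Fin n → Ω}
    (hiso : Isolates wt {S | S ∈ riafdSolutions (graphOf ends) R k l ∧ S.card = S₀.card ∧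
      (edgesOff ends S).card = (edgesOff ends S₀).card} w) :
    ∃ S, ¬ 2 ^ riafdTest n m k l (ident ends (fun v => wt (w v)) S) ∣
      ((cutItems ends R).filter fun σ => ident ends (fun v => wt (w v)) (zeroSet σ) =
        ident ends (fun v => wt (w v)) S).card := by
  obtain ⟨S, ⟨hS, hc, he⟩, huniq⟩ := hiso
  set w' : Fin n → ℕ := fun v => wt (w v) with hw'
  refine ⟨S, fun hdvd => ?_⟩
  have h1 := (riafd_test_iff hS.2.2.1 hS.2.2.2.1 w').2 hS
  refine h1 ?_
  have h2 : (cutItems ends R).filter (fun σ => ident ends w' (zeroSet σ) = ident ends w' S) =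
      (cutItems ends R).filter (fun σ => zeroSet σ = S) ∪ (univ.filter fun S' => S' ≠ S).biUnion
        fun S' => (cutItems ends R).filter fun σ =>
          zeroSet σ = S' ∧ ident ends w' (zeroSet σ) = ident ends w' S := by
    ext σ
    simp only [mem_filter, mem_union, mem_biUnion, mem_univ, true_and]
    constructor
    · rintro ⟨h3, h4⟩
      by_cases h5 : zeroSet σ = S
      · exact Or.inl ⟨h3, h5⟩
      · exact Or.inr ⟨_, h5, h3, rfl, h4⟩
    · rintro (⟨h3, rfl⟩ | ⟨_, _, h3, _, h4⟩)
      · exact ⟨h3, rfl⟩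
      · exact ⟨h3, h4⟩
  rw [h2, card_union_of_disjoint, card_biUnion] at hdvd
  · refine (Nat.dvd_add_left (dvd_sum fun S' hS' => ?_)).1 hdvd
    -- An indivisible part would belong to another solution with the same size, number of edges and
    -- weight, against isolation.
    by_contra h3
    obtain ⟨h4, h5⟩ := cutItems_sound h3
    have e1 := congrArg (· % (n + 1)) h5
    have e2 := congrArg (· / (n + 1) % (m + 1)) h5
    have e3 := congrArg (· / (n + 1) / (m + 1)) h5
    simp only [ident_mod, ident_div_mod, ident_div_div] at e1 e2 e3
    exact (mem_filter.1 hS').2 (huniq S' ⟨h4, e1.trans hc, e2.trans he⟩ e3)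
  · intro S₁ _ S₂ _ hne
    rw [Function.onFun, disjoint_left]
    intro σ h3 h4
    exact hne ((mem_filter.1 h3).2.1.symm.trans (mem_filter.1 h4).2.1)
  · rw [disjoint_left]
    intro σ h3 h4
    obtain ⟨S', h5, h6⟩ := mem_biUnion.1 h4
    exact (mem_filter.1 h5).2 ((mem_filter.1 h6).2.1.symm.trans (mem_filter.1 h3).2)

end
end CutCount

namespace CutCount
open Finset

/-! ### Pseudoforest Deletion -/

section
variable {n m : ℕ} (ends : Fin m → Fin n × Fin n)

/-- The end of `e` which `f` chooses. -/
def head (f : Fin m → Bool) (e : Fin m) : Fin n := if f e then (ends e).2 else (ends e).1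

/-- The vertices which `f` chooses for the edges outside of `S`. -/
def heads (S : Finset (Fin n)) (f : Fin m → Bool) : Finset (Fin n) :=
  (edgesOff ends S).image (head ends f)

/-- The choices of one end for every edge outside of `S`. -/
def choices (S : Finset (Fin n)) : Finset (Fin m → Bool) :=
  Fintype.piFinset fun e => if e ∈ edgesOff ends S then univ else {false}

variable {ends}

theorem heads_subset {S : Finset (Fin n)} {f : Fin m → Bool} {v : Fin n} (hv : v ∈ heads ends S f) :
    v ∉ S := by
  obtain ⟨e, he, rfl⟩ := mem_image.1 hv
  rw [mem_edgesOff] at he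
  rw [head]
  split_ifs
  exacts [he.2, he.1]

theorem filter_zeroSet_eq (S : Finset (Fin n)) :
    (assignments univ).filter (fun σ => zeroSet σ = S) =
      Fintype.piFinset fun v => if v ∈ S then ({0} : Finset ℕ) else {1, 2} := by
  ext σ
  rw [mem_filter, mem_assignments, Fintype.mem_piFinset]
  constructor
  · rintro ⟨⟨h1, _⟩, rfl⟩ v
    have := h1 v
    split_ifs with hv
    · rw [mem_singleton]
      exact mem_zeroSet.1 hv
    · have := mt mem_zeroSet.2 hv
      rw [mem_insert, mem_singleton]
      omega
  · intro h
    refine ⟨⟨fun v => ?_, fun v hv => absurd (mem_univ v) hv⟩, ?_⟩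
    · have := h v
      split_ifs at this
      · rw [mem_singleton] at this
        omega
      · rw [mem_insert, mem_singleton] at this
        omega
    · ext v
      rw [mem_zeroSet]
      have := h v
      split_ifs at this with hv
      · simpa [hv] using this
      · rw [mem_insert, mem_singleton] at this
        simp only [hv, iff_false]
        omega

/-- Expanding the product chooses an end for each remaining edge. A term survives iff all chosen
ends have the value 1, a condition on the set of chosen vertices only. -/
theorem prod_edges {A : Type*} [CommRing A] (g : A) (σ : Fin n → ℕ) :
    (∏ e, if σ (ends e).1 = 0 ∨ σ (ends e).2 = 0 then 1 else
      g * ((if σ (ends e).1 = 1 then 1 else 0) + if σ (ends e).2 = 1 then 1 else 0)) =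
    ∑ f ∈ choices ends (zeroSet σ), g ^ (edgesOff ends (zeroSet σ)).card *
      ∏ v, if v ∈ heads ends (zeroSet σ) f ∧ σ v ≠ 1 then 0 else 1 := by
  have h1 : ∀ e, (if σ (ends e).1 = 0 ∨ σ (ends e).2 = 0 then 1 else
      g * ((if σ (ends e).1 = 1 then 1 else 0) + if σ (ends e).2 = 1 then 1 else 0)) =
      ∑ t ∈ (if e ∈ edgesOff ends (zeroSet σ) then univ else {false}),
        if e ∈ edgesOff ends (zeroSet σ) then
          g * (if σ (if t then (ends e).2 else (ends e).1) = 1 then 1 else 0) else 1 := by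
    intro e
    by_cases he : e ∈ edgesOff ends (zeroSet σ)
    · have := mem_edgesOff.1 he
      rw [mem_zeroSet, mem_zeroSet] at this
      rw [if_neg (by tauto)]
      simp only [he, if_true, Fintype.sum_bool, if_false, Bool.false_eq_true]
      ring
    · have : σ (ends e).1 = 0 ∨ σ (ends e).2 = 0 := by
        rw [mem_edgesOff, mem_zeroSet, mem_zeroSet] at he
        tauto
      simp [he, this]
  rw [prod_congr rfl fun e _ => h1 e, prod_univ_sum]
  refine sum_congr rfl fun f _ => ?_
  rw [← prod_filter, filter_mem_eq_inter, univ_inter, prod_mul_distrib, prod_const]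
  congr 1
  rw [show (∏ v, if v ∈ heads ends (zeroSet σ) f ∧ σ v ≠ 1 then (0 : A) else 1) =
    ∏ v, if v ∈ heads ends (zeroSet σ) f → σ v = 1 then 1 else 0 from
      prod_congr rfl fun v _ => by
        by_cases h2 : v ∈ heads ends (zeroSet σ) f <;> by_cases h3 : σ v = 1 <;> simp [h2, h3],
    Fintype.prod_boole, prod_boole]
  refine @if_congr _ _ _ (_) (_) _ _ _ _ ?_ rfl rfl
  simp only [heads, mem_image, forall_exists_index, and_imp]
  constructor
  · rintro h v e he rfl
    exact h e he
  · exact fun h e he => h _ e he rfl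

/-- Expansion of the weights of edges into choices of ends. -/
theorem sum_prod_choices {A : Type*} [CommRing A] (g : A) (a : Fin n → ℕ → A) :
    (∑ σ ∈ assignments univ, (∏ v, a v (σ v)) *
      ∏ e : Fin m, if σ (ends e).1 = 0 ∨ σ (ends e).2 = 0 then 1 else
        g * ((if σ (ends e).1 = 1 then 1 else 0) + if σ (ends e).2 = 1 then 1 else 0)) =
    ∑ S, ∑ f ∈ choices ends S, g ^ (edgesOff ends S).card *
      ∏ v, if v ∈ S then a v 0 else if v ∈ heads ends S f then a v 1 else a v 1 + a v 2 := by
  rw [← sum_fiberwise (assignments univ) zeroSet]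
  refine sum_congr rfl fun S _ => ?_
  rw [sum_congr rfl fun σ hσ => by rw [prod_edges, (mem_filter.1 hσ).2, mul_sum], sum_comm]
  refine sum_congr rfl fun f _ => ?_
  rw [sum_congr rfl fun σ _ => by rw [mul_left_comm, ← prod_mul_distrib], ← mul_sum,
    filter_zeroSet_eq, ← prod_univ_sum (fun v => if v ∈ S then ({0} : Finset ℕ) else {1, 2})
      (fun v s => a v s * if v ∈ heads ends S f ∧ s ≠ 1 then 0 else 1)]
  congr 1
  refine prod_congr rfl fun v _ => ?_
  by_cases hS : v ∈ S
  · have : v ∉ heads ends S f := fun hh => heads_subset hh hS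
    simp [hS, this]
  · by_cases hv : v ∈ heads ends S f <;> simp [hS, hv]

-- A chosen vertex must have the value 1 and contributes `X ^ j`. A vertex which is neither deleted
-- nor chosen may have the value 1 or 2 and contributes `X ^ j + y = 1`. So the power of `X ^ j`
-- counts the distinct chosen vertices, without a further value for them.
open Classical in
theorem sum_choices_eq {A : Type*} [CommRing A] (X y : A) (j : ℕ) (hy : X ^ j + y = 1) (c : ℕ → ℕ) :
    (∑ σ ∈ assignments univ, (∏ v : Fin n, if σ v = 0 then (if c v ≠ 2 then X else 0) else
        if c v ≠ 1 then (if σ v = 1 then X ^ j else y) else 0) *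
      ∏ e : Fin m, if σ (ends e).1 = 0 ∨ σ (ends e).2 = 0 then 1 else
        X ^ (n + 1) * ((if σ (ends e).1 = 1 then 1 else 0) + if σ (ends e).2 = 1 then 1 else 0)) =
    ∑ x ∈ (univ : Finset (Finset (Fin n))).sigma (choices ends) with Compat c x.1,
      X ^ (x.1.card + (n + 1) * (edgesOff ends x.1).card + j * (heads ends x.1 x.2).card) := by
  rw [sum_prod_choices (X ^ (n + 1)) fun v s => if s = 0 then (if c v ≠ 2 then X else 0) else
        if c v ≠ 1 then (if s = 1 then X ^ j else y) else 0, sum_filter, sum_sigma]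
  refine sum_congr rfl fun S _ => sum_congr rfl fun f _ => ?_
  have h1 : ∀ v : Fin n, (if v ∈ S then (if c v ≠ 2 then X else 0) else if v ∈ heads ends S f then
      (if c v ≠ 1 then X ^ j else 0) else if c v ≠ 1 then 1 else 0) =
      if (c v = 1 → v ∈ S) ∧ (c v = 2 → v ∉ S) then
        X ^ ((if v ∈ S then 1 else 0) + j * if v ∈ heads ends S f then 1 else 0) else 0 := by
    intro v
    by_cases hS : v ∈ S
    · have : v ∉ heads ends S f := fun hh => heads_subset hh hS
      by_cases h2 : c v = 2 <;> simp [hS, this, h2]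
    · by_cases hv : v ∈ heads ends S f <;> by_cases h2 : c v = 1 <;> simp [hS, hv, h2]
  have h2 : ∀ v : Fin n, (if v ∈ S then (if (0 : ℕ) = 0 then (if c v ≠ 2 then X else 0) else
        if c v ≠ 1 then (if (0 : ℕ) = 1 then X ^ j else y) else 0) else if v ∈ heads ends S f then
        (if (1 : ℕ) = 0 then (if c v ≠ 2 then X else 0) else
        if c v ≠ 1 then (if (1 : ℕ) = 1 then X ^ j else y) else 0) else
        (if (1 : ℕ) = 0 then (if c v ≠ 2 then X else 0) else
        if c v ≠ 1 then (if (1 : ℕ) = 1 then X ^ j else y) else 0) +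
        (if (2 : ℕ) = 0 then (if c v ≠ 2 then X else 0) else
        if c v ≠ 1 then (if (2 : ℕ) = 1 then X ^ j else y) else 0)) =
      if (c v = 1 → v ∈ S) ∧ (c v = 2 → v ∉ S) then
        X ^ ((if v ∈ S then 1 else 0) + j * if v ∈ heads ends S f then 1 else 0) else 0 := by
    intro v
    rw [← h1 v]
    by_cases h3 : c v = 1 <;> simp [h3, hy]
  dsimp only
  rw [prod_congr rfl fun v _ => h2 v, Fintype.prod_ite_zero, mul_ite, mul_zero]
  refine @if_congr _ _ _ (_) (_) _ _ _ _ Iff.rfl ?_ rfl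
  rw [prod_pow_eq_pow_sum, sum_add_distrib, ← mul_sum, ← pow_mul, ← pow_add]
  simp only [sum_boole, filter_mem_eq_inter, univ_inter, Nat.cast_id]
  congr 1
  ring

/-! ### Orientations -/

/-- As many chosen vertices as edges means that the choice is injective, that is, an orientation. -/
theorem isPseudoforest_of_card_heads {S : Finset (Fin n)} {f : Fin m → Bool}
    (h : (heads ends S f).card = (edgesOff ends S).card) :
    IsPseudoforest ((graphOf ends).deleteVerts (S : Set (Fin n))) := by
  refine IsOrientation.isPseudoforest (f := head ends f) ⟨?_, fun e he => ?_⟩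
  · rw [← edgeSet_deleteVerts_graphOf]
    exact card_image_iff.1 h
  · rw [← edgeSet_deleteVerts_graphOf, mem_coe, mem_edgesOff] at he
    rw [head]
    split_ifs
    · exact ⟨(ends e).1, (Graph.deleteVerts_isLink _ _).2 ⟨Sym2.eq_swap, he.2, he.1⟩⟩
    · exact ⟨(ends e).2, (Graph.deleteVerts_isLink _ _).2 ⟨rfl, he.1, he.2⟩⟩

theorem exists_card_heads {S : Finset (Fin n)}
    (h : IsPseudoforest ((graphOf ends).deleteVerts (S : Set (Fin n)))) :
    ∃ f ∈ choices ends S, (heads ends S f).card = (edgesOff ends S).card := by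
  classical
  -- Orientations need a default vertex for absent edges; without vertices there are no edges
  -- either.
  rcases isEmpty_or_nonempty (Fin n) with h0 | h0
  · have : IsEmpty (Fin m) := ⟨fun e => h0.false (ends e).1⟩
    refine ⟨fun _ => false, Fintype.mem_piFinset.2 fun e => this.elim e, ?_⟩
    rw [Subsingleton.elim (edgesOff ends S) ∅, Subsingleton.elim (heads ends S _) ∅]
    rfl
  · obtain ⟨o, ho⟩ := h.exists_orientation (edgeSet_deleteVerts_graphOf S)
    rw [IsOrientation, ← edgeSet_deleteVerts_graphOf] at ho
    have hh : ∀ e ∈ edgesOff ends S, head ends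
        (fun e => decide (e ∈ edgesOff ends S ∧ o e ≠ (ends e).1)) e = o e := by
      intro e he
      obtain ⟨y, hy⟩ := ho.2 e he
      rw [head]
      rcases Sym2.eq_iff.1 (graphOf_isLink.1 ((Graph.deleteVerts_isLink _ _).1 hy).1) with h1 | h1
      · simp [h1.1]
      · by_cases h2 : (ends e).2 = (ends e).1
        · simp [← h1.2, h2]
        · simp [he, ← h1.2, h2]
    refine ⟨fun e => decide (e ∈ edgesOff ends S ∧ o e ≠ (ends e).1),
      Fintype.mem_piFinset.2 fun e => ?_, ?_⟩
    · split_ifs with he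
      · exact mem_univ _
      · simp [he]
    · rw [heads, card_image_of_injOn]
      intro e he e' he' hee
      rw [hh e he, hh e' he'] at hee
      exact ho.1 he he' hee

end
end CutCount

namespace CutCount
open Finset

/-! ### The parameters of the algorithm -/

/-- The parameters are consistent. -/
structure Params (n m : ℕ) (h : Mem) : Prop where
  weights : h 8 5 = 2 ^ h 8 0
  digits : h 8 3 = 2 * (n + m) + 1
  indices : h 8 4 = (n + 1) * ((m + 1) * (n * h 8 5 + 1))
  base : h 9 2 = 2 ^ h 8 3
  modulus : h 9 0 = h 9 2 ^ h 8 4 + 2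

section
variable {o n m N : ℕ} {ends : Fin m → Fin n × Fin n} {D : TreeDecomposition (graphOf ends) N}
  {tF : ℕ → Mem → ℕ} {h : Mem}

theorem Params.ready (hp : Params n m h) (he : Enc o ends D.tree D.bag h) (ho : 2 ≤ o ∧ o ≤ 3)
    (hK : ∀ z, 3 ^ (D.bag z).card ≤ h 9 1) (ht : ∀ i, tF i h ≤ h 8 3)
    (htest : ∀ h', SameOff changed h h' → ∀ i, tF i h' = tF i h) : Ready o D tF h where
  enc := he
  offset := ho
  two_le := by rw [hp.modulus]; omega
  table_le := hK
  base_dvd := fun i => by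
    rw [hp.base]
    exact pow_dvd_pow _ (ht i)
  base_pos := by
    rw [hp.base]
    exact Nat.le_self_pow (by rw [hp.digits]; omega) 2
  base_pow := by rw [hp.modulus]; omega
  test := htest

theorem Params.one_le (hp : Params n m h) : 1 ≤ h 8 5 := by
  rw [hp.weights]
  exact Nat.one_le_two_pow

/-! ### Weights for Restricted Independent Almost Forest Deletion -/

/-- The number which the coins show for the vertex `v` in round `r`. -/
def coinValue (r v : ℕ) (h : Mem) : ℕ :=
  ∑ j ∈ range (h 8 0), h 10 ((r * h 1 0 + v) * h 8 0 + j) * 2 ^ j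

/-- The random weight of `v` in round `r`. -/
def vertexWeight (r v : ℕ) (h : Mem) : ℕ :=
  -- For the coins tossed the condition always holds. The cutoff bounds the weight for arbitrary
  -- contents of the memory.
  if coinValue r v h < h 8 5 then coinValue r v h else 0

theorem vertexWeight_congr {h' : Mem} (h1 : h' 1 = h 1) (h8 : h' 8 = h 8) (h10 : h' 10 = h 10)
    (r v : ℕ) : vertexWeight r v h' = vertexWeight r v h := by
  have : coinValue r v h' = coinValue r v h := by simp only [coinValue, h1, h8, h10]
  rw [vertexWeight, vertexWeight, this, h8]

/-- Array `2` marks the vertices of `R`. The condition forbids deleting a vertex of `R` or one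
decided to stay, and keeping one decided to be deleted; the exponent is the share of `v` in the
index. -/
def riafdV (r v s : ℕ) (h : Mem) : ℕ :=
  if (s = 0 → h 2 v = 0 ∧ h 11 v ≠ 2) ∧ (s ≠ 0 → h 11 v ≠ 1) then
    h 9 2 ^ (if s = 0 then 1 + (h 1 0 + 1) * ((h 1 1 + 1) * vertexWeight r v h) else 0) else 0

def riafdE (s s' : ℕ) (h : Mem) : ℕ :=
  if Allowed s s' then h 9 2 ^ (if s = 0 ∨ s' = 0 then 0 else h 1 0 + 1) else 0

def riafdT (i : ℕ) (h : Mem) : ℕ := riafdTest (h 1 0) (h 1 1) (h 1 3) (h 1 4) i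

theorem stable_riafd : Stable riafdV riafdE where
  vertex := fun {h h'} hs r v s => by
    rw [riafdV, riafdV, hs 1 (by decide), hs 2 (by decide), hs 9 (by decide), hs 11 (by decide),
      vertexWeight_congr (hs 1 (by decide)) (hs 8 (by decide)) (hs 10 (by decide))]
  edge := fun {h h'} hs s s' => by
    simp only [riafdE, hs 1 (by decide), hs 9 (by decide)]

theorem three_pow_lt (n m : ℕ) : 3 ^ n < 2 ^ (2 * (n + m) + 1) := by
  calc 3 ^ n ≤ 4 ^ n := Nat.pow_le_pow_left (by norm_num) n
    _ = 2 ^ (2 * n) := by rw [pow_mul]; norm_num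
    _ < 2 ^ (2 * (n + m) + 1) := Nat.pow_lt_pow_right (by norm_num) (by omega)

theorem model_riafd {R : Finset (Fin n)} {k l : ℕ} (hp : Params n m h)
    (he : Enc 3 ends D.tree D.bag h) (hR : ∀ v : Fin n, h 2 v = 0 ↔ v ∉ R) (hk : h 1 3 = k)
    (hl : h 1 4 = l) (r : ℕ) :
    Model ends riafdV riafdE riafdT h r (riafdSolutions (graphOf ends) R k l) (cutItems ends R)
      zeroSet (fun σ => ident ends (fun v => vertexWeight r v h) (zeroSet σ)) where
  card_lt := by
    rw [hp.base, hp.digits]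
    refine (card_filter_le _ _).trans_lt ?_
    rw [card_assignments, card_univ, Fintype.card_fin]
    exact three_pow_lt n m
  id_lt := fun σ _ => by
    rw [hp.indices]
    refine ident_lt (fun v => ?_) _
    rw [vertexWeight]
    split_ifs with hh
    · exact hh.le
    · exact Nat.zero_le _
  sum_eq := fun h' hs => by
    classical
    have hw : ∀ v, vertexWeight r v h' = vertexWeight r v h :=
      vertexWeight_congr (hs 1 (by decide)) (hs 8 (by decide)) (hs 10 (by decide)) r
    simp only [riafdV, riafdE, hs 1 (by decide), hs 9 (by decide), hs 2 (by decide), hw, he.numV,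
      he.numE]
    rw [partitionFun_eq_sum (okV := fun (v : Fin n) s => (s = 0 → h 2 v = 0 ∧ h' 11 v ≠ 2) ∧
      (s ≠ 0 → h' 11 v ≠ 1)) (ev := fun (v : Fin n) s => if s = 0 then
        1 + (n + 1) * ((m + 1) * vertexWeight r v h) else 0) (okE := Allowed)
        (ee := fun s s' => if s = 0 ∨ s' = 0 then 0 else n + 1),
      sum_congr rfl fun σ _ => by rw [sum_exponents (fun v => vertexWeight r v h) σ], cutItems,
      filter_filter]
    refine congrArg (· % (h 9 0 + 1)) (sum_congr (filter_congr fun σ _ => ?_) fun _ _ => rfl)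
    have : (∀ v : Fin n, (σ v = 0 → h 2 v = 0 ∧ h' 11 v ≠ 2) ∧ (σ v ≠ 0 → h' 11 v ≠ 1)) ↔
        (∀ v ∈ R, σ v ≠ 0) ∧ Compat (h' 11) (zeroSet σ) := by
      simp only [Compat, mem_zeroSet, hR]
      constructor
      · exact fun hh => ⟨fun v hv h0 => (hh v).1 h0 |>.1 hv, fun v => ⟨fun h1 => by
          by_contra h0
          exact (hh v).2 h0 h1, fun h2 h0 => ((hh v).1 h0).2 h2⟩⟩
      · exact fun hh v => ⟨fun h0 => ⟨fun hv => hh.1 v hv h0, fun h2 => (hh.2 v).2 h2 h0⟩,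
          fun h0 h1 => h0 ((hh.2 v).1 h1)⟩
    rw [this]
    tauto
  sound := fun S i _ hh => by
    rw [riafdT, he.numV, he.numE, hk, hl] at hh
    refine (cutItems_sound (w := fun v : Fin n => vertexWeight r v h) (i := i) ?_).1
    convert hh

theorem riafdTest_le (n m k l i : ℕ) : riafdTest n m k l i ≤ 2 * (n + m) + 1 := by
  rw [riafdTest]
  have := min_le_right l m
  split_ifs <;> omega

theorem rounds_riafd {R : Finset (Fin n)} {k l : ℕ} (hp : Params n m h)
    (he : Enc 3 ends D.tree D.bag h) (hR : ∀ v : Fin n, h 2 v = 0 ↔ v ∉ R) (hk : h 1 3 = k)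
    (hl : h 1 4 = l) (hK : ∀ z, 3 ^ (D.bag z).card ≤ h 9 1) (h0 : h 0 0 = 0) :
    (∀ S, output n ⟨rounds 3 riafdV riafdE riafdT h, []⟩ = some S →
      S ∈ riafdSolutions (graphOf ends) R k l) ∧
    ((∃ r < h 8 1, ∃ (Ω : Type) (wt : Ω → ℕ) (w : Fin n → Ω), ∃ S₀,
        (∀ v : Fin n, vertexWeight r v h = wt (w v)) ∧
        Isolates wt {S | S ∈ riafdSolutions (graphOf ends) R k l ∧ S.card = S₀.card ∧
          (edgesOff ends S).card = (edgesOff ends S₀).card} w) →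
      ∃ S ∈ riafdSolutions (graphOf ends) R k l,
        output n ⟨rounds 3 riafdV riafdE riafdT h, []⟩ = some S) := by
  classical
  have hr : Ready 3 D riafdT h := hp.ready he (by omega) hK
    (fun i => by rw [riafdT, he.numV, he.numE, hp.digits]; exact riafdTest_le _ _ _ _ _)
    (fun h' hs i => by rw [riafdT, riafdT, hs 1 (by decide)])
  obtain ⟨h1, h2⟩ := rounds_spec (fun r _ => model_riafd hp he hR hk hl r) hr stable_riafd h0
  refine ⟨h1, ?_⟩
  rintro ⟨r, hr', Ω, wt, w, S₀, hw, hiso⟩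
  obtain ⟨S, hS⟩ := cutItems_complete hiso
  refine h2 ⟨r, hr', ident ends (fun v => vertexWeight r v h) S, ?_, ?_⟩
  · rw [hp.indices]
    refine ident_lt (fun v => ?_) _
    rw [vertexWeight]
    split_ifs with hh
    · exact hh.le
    · exact Nat.zero_le _
  · simp only [riafdT, he.numV, he.numE, hk, hl, hw]
    convert hS

/-! ### Weights for Pseudoforest Deletion -/

/-- Modulo `h 9 0 + 1`, the weight of the value 2 is `1 - X ^ j` with `j = (n + 1) * (m + 1)`. -/
def pdV (_r v s : ℕ) (h : Mem) : ℕ :=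
  if s = 0 then (if h 11 v ≠ 2 then h 9 2 else 0) else
    if h 11 v ≠ 1 then (if s = 1 then h 9 2 ^ ((h 1 0 + 1) * (h 1 1 + 1)) else
      h 9 0 + 2 - h 9 2 ^ ((h 1 0 + 1) * (h 1 1 + 1))) else 0

def pdE (s s' : ℕ) (h : Mem) : ℕ :=
  if s = 0 ∨ s' = 0 then 1 else
    h 9 2 ^ (h 1 0 + 1) * ((if s = 1 then 1 else 0) + if s' = 1 then 1 else 0)

/-- For indices with a correct size and as many chosen vertices as edges the power of two is the
base itself, which exceeds all counts, so the test asks for a nonzero digit. Other indices get `2 ^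
0`, which divides everything. -/
def pdT (i : ℕ) (h : Mem) : ℕ :=
  if i % (h 1 0 + 1) ≤ h 1 3 ∧ i / (h 1 0 + 1) / (h 1 1 + 1) = i / (h 1 0 + 1) % (h 1 1 + 1) then
    h 8 3 else 0

theorem stable_pd : Stable pdV pdE where
  vertex := fun {h h'} hs r v s => by
    simp only [pdV, hs 1 (by decide), hs 9 (by decide), hs 11 (by decide)]
  edge := fun {h h'} hs s s' => by
    simp only [pdE, hs 1 (by decide), hs 9 (by decide)]

theorem card_choices_lt (ends : Fin m → Fin n × Fin n) :
    ((univ : Finset (Finset (Fin n))).sigma (choices ends)).card < 2 ^ (2 * (n + m) + 1) := by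
  rw [card_sigma]
  calc ∑ S, (choices ends S).card ≤ (univ : Finset (Finset (Fin n))).card • 2 ^ m :=
        sum_le_card_nsmul _ _ _ fun S _ => (card_le_univ _).trans (by simp)
    _ = 2 ^ (n + m) := by simp [pow_add]
    _ < 2 ^ (2 * (n + m) + 1) := Nat.pow_lt_pow_right (by norm_num) (by omega)

/-- The index of `S` with a choice of heads of the edges outside of `S`. -/
def headIdent (ends : Fin m → Fin n × Fin n) (x : (_ : Finset (Fin n)) × (Fin m → Bool)) : ℕ :=
  x.1.card + (n + 1) * ((edgesOff ends x.1).card + (m + 1) * (heads ends x.1 x.2).card)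

theorem headIdent_mod (x : (_ : Finset (Fin n)) × (Fin m → Bool)) :
    headIdent ends x % (n + 1) = x.1.card ∧
    headIdent ends x / (n + 1) % (m + 1) = (edgesOff ends x.1).card ∧
    headIdent ends x / (n + 1) / (m + 1) = (heads ends x.1 x.2).card := by
  have h1 : headIdent ends x / (n + 1) =
      (edgesOff ends x.1).card + (m + 1) * (heads ends x.1 x.2).card := by
    rw [headIdent, Nat.add_mul_div_left _ _ (Nat.succ_pos n),
      Nat.div_eq_of_lt (Nat.lt_succ_of_le (card_le_n x.1)), zero_add]
  have h2 := Nat.lt_succ_of_le (card_edgesOff_le (ends := ends) x.1)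
  refine ⟨?_, ?_, ?_⟩
  · rw [headIdent, Nat.add_mul_mod_self_left, Nat.mod_eq_of_lt (Nat.lt_succ_of_le (card_le_n _))]
  · rw [h1, Nat.add_mul_mod_self_left, Nat.mod_eq_of_lt h2]
  · rw [h1, Nat.add_mul_div_left _ _ (Nat.succ_pos m), Nat.div_eq_of_lt h2, zero_add]

theorem headIdent_lt {W : ℕ} (hW : 1 ≤ W) (x : (_ : Finset (Fin n)) × (Fin m → Bool)) :
    headIdent ends x < (n + 1) * ((m + 1) * (n * W + 1)) := by
  have h1 : (heads ends x.1 x.2).card ≤ n * W :=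
    (card_le_n _).trans (Nat.le_mul_of_pos_right _ hW)
  have h2 : (edgesOff ends x.1).card + (m + 1) * (heads ends x.1 x.2).card <
      (m + 1) * (n * W + 1) := by
    have := card_edgesOff_le (ends := ends) x.1
    have := Nat.mul_le_mul_left (m + 1) h1
    rw [mul_add]
    omega
  have h3 := card_le_n x.1
  have h4 := Nat.mul_le_mul_left (n + 1) (Nat.succ_le_of_lt h2)
  rw [headIdent]
  rw [Nat.succ_eq_add_one, mul_add, mul_one] at h4
  omega

theorem model_pd {k : ℕ} (hp : Params n m h) (he : Enc o ends D.tree D.bag h) (hk : h 1 3 = k)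
    (r : ℕ) :
    Model ends pdV pdE pdT h r (pdSolutions (graphOf ends) k)
      ((univ : Finset (Finset (Fin n))).sigma (choices ends)) Sigma.fst (headIdent ends) where
  card_lt := by
    rw [hp.base, hp.digits]
    exact card_choices_lt ends
  id_lt := fun x _ => by
    rw [hp.indices]
    exact headIdent_lt hp.one_le x
  sum_eq := fun h' hs => by
    classical
    -- This makes the subtraction in `pdV` an honest one.
    have hz : h 9 2 ^ ((n + 1) * (m + 1)) ≤ h 9 0 + 2 := by
      have h1 : h 9 2 ^ ((n + 1) * (m + 1)) ≤ h 9 2 ^ h 8 4 := by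
        refine Nat.pow_le_pow_right (by rw [hp.base]; exact Nat.two_pow_pos _) ?_
        rw [hp.indices]
        exact Nat.mul_le_mul_left _ (Nat.le_mul_of_pos_right _ (by omega))
      rw [hp.modulus]
      omega
    rw [← ZMod.natCast_eq_natCast_iff, partitionFun]
    simp only [pdV, pdE, hs 1 (by decide), hs 9 (by decide), he.numV, he.numE]
    have key := sum_choices_eq (ends := ends) (A := ZMod (h 9 0 + 1)) (h 9 2 : ZMod (h 9 0 + 1))
      ((h 9 0 + 2 - h 9 2 ^ ((n + 1) * (m + 1)) : ℕ) : ZMod (h 9 0 + 1)) ((n + 1) * (m + 1)) (by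
        rw [← Nat.cast_pow, ← Nat.cast_add, Nat.add_sub_cancel' hz]
        have : ((h 9 0 + 2 : ℕ) : ZMod (h 9 0 + 1)) = ((h 9 0 + 1 : ℕ) : ZMod (h 9 0 + 1)) + 1 := by
          push_cast
          ring
        rw [this, ZMod.natCast_self, zero_add]) (h' 11)
    rw [Nat.cast_sum, Nat.cast_sum]
    refine (Eq.trans (sum_congr rfl fun σ _ => ?_) key).trans (sum_congr rfl fun x _ => ?_)
    · rw [Nat.cast_mul, Nat.cast_prod, Nat.cast_prod]
      congr 1
      · refine prod_congr rfl fun v _ => ?_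
        simp only [apply_ite (Nat.cast : ℕ → ZMod (h 9 0 + 1)), Nat.cast_pow, Nat.cast_zero]
      · refine prod_congr rfl fun e _ => ?_
        simp only [apply_ite (Nat.cast : ℕ → ZMod (h 9 0 + 1)), Nat.cast_pow, Nat.cast_zero,
          Nat.cast_one, Nat.cast_mul, Nat.cast_add]
    · rw [Nat.cast_pow, headIdent]
      congr 1
      ring
  sound := fun S i _ hh => by
    classical
    have hne : (((univ : Finset (Finset (Fin n))).sigma (choices ends)).filter fun x =>
        x.1 = S ∧ headIdent ends x = i).Nonempty := by
      by_contra hh'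
      rw [not_nonempty_iff_eq_empty] at hh'
      rw [hh'] at hh
      simp at hh
    obtain ⟨⟨S', f⟩, hx⟩ := hne
    rw [mem_filter] at hx
    obtain ⟨_, rfl, rfl⟩ := hx
    obtain ⟨h1, h2, h3⟩ := headIdent_mod (ends := ends) ⟨S', f⟩
    rw [pdT, he.numV, he.numE, h1, h2, h3] at hh
    split_ifs at hh with h4
    · exact ⟨fun _ _ => Set.mem_univ _, hk ▸ h4.1, isPseudoforest_of_card_heads h4.2⟩
    · simp at hh

/-- Every solution has an item whose index is tested for being nonzero, and items cannot cancel; so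
isolation is not needed and a single round suffices. -/
theorem rounds_pd {k : ℕ} (hp : Params n m h)
    (he : Enc 2 ends D.tree D.bag h) (hk : h 1 3 = k)
    (hK : ∀ z, 3 ^ (D.bag z).card ≤ h 9 1) (h0 : h 0 0 = 0) (hr1 : 1 ≤ h 8 1) :
    (∀ S, output n ⟨rounds 2 pdV pdE pdT h, []⟩ = some S → S ∈ pdSolutions (graphOf ends) k) ∧
    ((pdSolutions (graphOf ends) k).Nonempty → ∃ S ∈ pdSolutions (graphOf ends) k,
        output n ⟨rounds 2 pdV pdE pdT h, []⟩ = some S) := by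
  classical
  have hr : Ready 2 D pdT h := hp.ready he (by omega) hK
    (fun i => by rw [pdT]; split_ifs <;> omega)
    (fun h' hs i => by rw [pdT, pdT, hs 1 (by decide), hs 8 (by decide)])
  obtain ⟨h1, h2⟩ := rounds_spec (fun r _ => model_pd hp he hk r) hr stable_pd h0
  refine ⟨h1, ?_⟩
  rintro ⟨S, _, hS, hps⟩
  obtain ⟨f, hf, hcard⟩ := exists_card_heads hps
  refine h2 ⟨0, hr1, headIdent ends ⟨S, f⟩, ?_, fun hd => ?_⟩
  · rw [hp.indices]
    exact headIdent_lt hp.one_le _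
  · obtain ⟨h3, h4, h5⟩ := headIdent_mod (ends := ends) ⟨S, f⟩
    rw [pdT, he.numV, he.numE, h3, h4, h5, if_pos ⟨hk ▸ hS, hcard⟩] at hd
    refine absurd (Nat.le_of_dvd (card_pos.2 ⟨⟨S, f⟩, ?_⟩) hd) (not_le.2 ?_)
    · rw [mem_filter, mem_sigma]
      exact ⟨⟨mem_univ _, hf⟩, rfl⟩
    · rw [hp.digits]
      exact (card_filter_le _ _).trans_lt (card_choices_lt ends)

end
end CutCount

namespace CutCount
open Finset

/-! ### The weights can be computed -/

section
variable {Γ : Type} [Ctx Γ]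

theorem Comp.coinValue {r v : Γ → Mem → ℕ} (hr : Comp r) (hv : Comp v) :
    Comp fun γ h => coinValue (r γ h) (v γ h) h :=
  Comp.sum (Comp.cell 8 0 (by decide)) (Num.reg _)
    ((Comp.get (x := 10) (by decide) ((((hr.wk.mul Comp.numV).add hv.wk).mul
      (Comp.cell 8 0 (by decide))).add Comp.last)).mul (Comp.pow (Comp.const 2) Comp.last Num.last))

theorem Comp.vertexWeight {r v : Γ → Mem → ℕ} (hr : Comp r) (hv : Comp v) :
    Comp fun γ h => vertexWeight (r γ h) (v γ h) h :=
  Comp.ite (CompP.lt (Comp.coinValue hr hv) (Comp.cell 8 5 (by decide))) (Comp.coinValue hr hv)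
    (Comp.const 0)

theorem Num.vertexWeight (r v : Γ → Mem → ℕ) : Num fun γ h => vertexWeight (r γ h) (v γ h) h :=
  (Num.reg fun _ _ => 5).of_le fun γ h => by
    rw [CutCount.vertexWeight]
    split_ifs with hh
    · exact hh.le
    · exact Nat.zero_le _

theorem CompP.zero {s : Γ → Mem → ℕ} (hs : Comp s) : CompP fun γ h => s γ h = 0 :=
  CompP.eq hs (Comp.const 0)

end

theorem compFun_riafdV : CompFun3 riafdV := fun {Γ _ r v s} hr hv hs =>
  Comp.ite (((CompP.zero hs).imp ((CompP.zero (Comp.get (by decide) hv)).and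
      (CompP.eq (Comp.get (x := 11) (by decide) hv) (Comp.const 2)).not)).and
      ((CompP.zero hs).not.imp (CompP.eq (Comp.get (x := 11) (by decide) hv) (Comp.const 1)).not))
    (Comp.pow (Comp.cell 9 2 (by decide)) (Comp.ite (CompP.zero hs)
      ((Comp.const 1).add ((Comp.numV.add (Comp.const 1)).mul ((Comp.numE.add (Comp.const 1)).mul
        (Comp.vertexWeight hr hv)))) (Comp.const 0))
      (((Num.const 1).add ((Num.numV.add (Num.const 1)).mul ((Num.numE.add (Num.const 1)).mul
        (Num.vertexWeight r v)))).of_le fun γ h => by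
          split_ifs
          · exact le_rfl
          · exact Nat.zero_le _)) (Comp.const 0)

theorem compFun_riafdE : CompFun2 riafdE := fun {Γ _ s s'} hs hs' =>
  Comp.ite ((((CompP.zero hs).and (CompP.zero hs')).not).and ((CompP.zero hs).or ((CompP.zero hs').or
      (CompP.eq hs hs'))))
    (Comp.pow (Comp.cell 9 2 (by decide)) (Comp.ite ((CompP.zero hs).or (CompP.zero hs'))
      (Comp.const 0) (Comp.numV.add (Comp.const 1)))
      ((Num.numV.add (Num.const 1)).of_le fun γ h => by
        split_ifs
        · exact Nat.zero_le _
        · exact le_rfl)) (Comp.const 0)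

theorem Comp.min {Γ : Type} [Ctx Γ] {a b : Γ → Mem → ℕ} (ha : Comp a) (hb : Comp b) :
    Comp fun γ h => min (a γ h) (b γ h) :=
  (Comp.ite (CompP.le ha hb) ha hb).congr fun _ _ => min_def _ _

theorem compFun_riafdT : CompFun1 riafdT := fun {Γ _ i} hi =>
  Comp.ite (CompP.le (hi.mod (Comp.numV.add (Comp.const 1))) (Comp.cell 1 3 (by decide)))
    ((((Comp.numV.sub (hi.mod (Comp.numV.add (Comp.const 1)))).add
      ((Comp.cell 1 4 (by decide)).min Comp.numE)).add (Comp.const 1)).sub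
      ((hi.div (Comp.numV.add (Comp.const 1))).mod (Comp.numE.add (Comp.const 1)))) (Comp.const 0)

theorem numFun_riafdT : NumFun1 riafdT := fun {_ _ _} =>
  (((Num.const 2).mul (Num.numV.add Num.numE)).add (Num.const 1)) |>.of_le fun _ _ =>
    riafdTest_le _ _ _ _ _

theorem compFun_pdV : CompFun3 pdV := fun {Γ _ r v s} _ hv hs => by
  have hz : Comp fun (_ : Γ) h => h 9 2 ^ ((h 1 0 + 1) * (h 1 1 + 1)) :=
    Comp.pow (Comp.cell 9 2 (by decide)) ((Comp.numV.add (Comp.const 1)).mul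
      (Comp.numE.add (Comp.const 1))) ((Num.numV.add (Num.const 1)).mul (Num.numE.add (Num.const 1)))
  have hc : Comp fun γ h => h 11 (v γ h) := Comp.get (by decide) hv
  exact Comp.ite (CompP.zero hs) (Comp.ite (CompP.eq hc (Comp.const 2)).not
    (Comp.cell 9 2 (by decide)) (Comp.const 0)) (Comp.ite (CompP.eq hc (Comp.const 1)).not
    (Comp.ite (CompP.eq hs (Comp.const 1)) hz
      (((Comp.cell 9 0 (by decide)).add (Comp.const 2)).sub hz)) (Comp.const 0))

theorem compFun_pdE : CompFun2 pdE := fun {Γ _ s s'} hs hs' =>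
  Comp.ite ((CompP.zero hs).or (CompP.zero hs')) (Comp.const 1)
    ((Comp.pow (Comp.cell 9 2 (by decide)) (Comp.numV.add (Comp.const 1))
      (Num.numV.add (Num.const 1))).mul
      ((Comp.ite (CompP.eq hs (Comp.const 1)) (Comp.const 1) (Comp.const 0)).add
        (Comp.ite (CompP.eq hs' (Comp.const 1)) (Comp.const 1) (Comp.const 0))))

theorem compFun_pdT : CompFun1 pdT := fun {Γ _ i} hi =>
  Comp.ite ((CompP.le (hi.mod (Comp.numV.add (Comp.const 1))) (Comp.cell 1 3 (by decide))).and
    (CompP.eq ((hi.div (Comp.numV.add (Comp.const 1))).div (Comp.numE.add (Comp.const 1)))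
      ((hi.div (Comp.numV.add (Comp.const 1))).mod (Comp.numE.add (Comp.const 1)))))
    (Comp.cell 8 3 (by decide)) (Comp.const 0)

theorem numFun_pdT : NumFun1 pdT := fun {_ _ _} =>
  (Num.reg fun _ _ => 3).of_le fun _ _ => by
    rw [pdT]
    split_ifs
    · exact le_rfl
    · exact Nat.zero_le _

/-! ### Preparations -/

/-- `F` can be carried out in polynomial time, and keeps the memory small. -/
def CompT (F : Mem → Mem) : Prop :=
  ∃ (p : Prog) (q : Polynomial ℕ), ∀ L h ρ cs, Small L () h → Small (q.eval L) () (F h) ∧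
    ∃ t ≤ q.eval L, ∃ ρ', Run p ⟨withStack h ρ, cs⟩ t ⟨withStack (F h) ρ', cs⟩

theorem CompT.comp {F G : Mem → Mem} (hG : CompT G) (hF : CompT F) : CompT fun h => G (F h) := by
  obtain ⟨p, q, hF⟩ := hF
  obtain ⟨p', q', hG⟩ := hG
  refine ⟨.seq p p', q + q'.comp q, fun L h ρ cs hs => ?_⟩
  obtain ⟨h1, t, ht, ρ', hr⟩ := hF L h ρ cs hs
  obtain ⟨h2, t', ht', ρ'', hr'⟩ := hG _ _ ρ' cs h1
  rw [Polynomial.eval_add, Polynomial.eval_comp]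
  exact ⟨h2.mono (Nat.le_add_left _ _), _, Nat.add_le_add ht ht', _, Run.seq hr hr'⟩

/-- Array `8` is for numbers with polynomially bounded values, which may control loops. Array `9`
only needs bounded length, as for the modulus and the total size of the tables. -/
theorem CompT.write {x : ℕ} (i : ℕ) {f : Mem → ℕ} (hf : Comp fun (_ : Unit) h => f h)
    (hx : x = 9 ∨ x = 8 ∧ Num fun (_ : Unit) h => f h) : CompT fun h => h.set x i (f h) := by
  have hx1 : x ≠ 1 ∧ x ≠ 20 := by
    rcases hx with rfl | ⟨rfl, _⟩ <;> decide
  obtain ⟨b, hb⟩ : ∃ b : Polynomial ℕ, ∀ L h, Small L () h → x = 8 → f h ≤ b.eval L := by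
    rcases hx with rfl | ⟨rfl, b, hb⟩
    · exact ⟨0, fun _ _ _ h => absurd h (by decide)⟩
    · exact ⟨b, fun L h hs _ => hb L () h hs⟩
  obtain ⟨p, q, hf⟩ := hf
  refine ⟨.seq (p (fun _ => 0) 0) (.assign x (.const i) (.get 20 (.const 0))),
    3 * q + b + Polynomial.X + Polynomial.C (2 * i.size + 10), fun L h ρ cs hs => ?_⟩
  obtain ⟨h1, t, ht, ρ', hr, -, h3⟩ := hf (fun _ => 0) 0 L () h ρ cs (fun i hi => absurd hi (Nat.not_lt_zero i))
    (Nat.zero_le _) hs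
  change (f h).size ≤ _ at h1
  simp only [Polynomial.eval_add, Polynomial.eval_mul, Polynomial.eval_X, Polynomial.eval_C,
    Polynomial.eval_ofNat]
  refine ⟨⟨fun y j => ?_, fun i hi => absurd hi (Nat.not_lt_zero i), fun j hj => ?_, fun j => ?_⟩, ?_⟩
  · rw [Mem.set_apply]
    split_ifs
    · omega
    · have := hs.size y j
      omega
  · rw [Mem.set_of_ne _ _ _ hx1.1.symm]
    have := hs.input j hj
    omega
  · rw [Mem.set_apply]
    split_ifs with hh
    · have := hb L h hs hh.1.symm
      omega
    · have := hs.reg j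
      omega
  · have hr' := Run.assign x (.const i) (.get 20 (.const 0)) ⟨withStack h ρ', cs⟩
    simp only [Expr.eval, withStack_stack, h3, withStack_set hx1.2] at hr'
    refine ⟨_, ?_, _, Run.seq hr hr'⟩
    simp only [Expr.cost, Expr.eval, withStack_stack, h3, Nat.size_zero]
    omega

/-- A bound for the length of the input, which is the number of rounds. -/
def roundCount (h : Mem) : ℕ :=
  (h 1 0).size + (h 1 1).size + (h 1 2).size + (h 1 3).size + (h 1 4).size + 5 + 2 * h 1 0 +
    2 * (h 1 1 * ((h 1 0).size + 1)) + 2 * (h 1 2 * h 1 2) + 2 * (h 1 2 * h 1 0)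

/-- Compute the parameters. -/
def setup (o : ℕ) (h : Mem) : Mem :=
  -- The order of execution is from the bottom up, and later parameters use earlier ones. In this
  -- last one, the summand 2 ensures that the decisions 0, 1, 2 survive the reduction.
  (fun h => h.set 9 0 (h 9 2 ^ h 8 4 + 2)) <| (fun h => h.set 9 2 (2 ^ h 8 3)) <|
  (fun h => h.set 8 4 ((h 1 0 + 1) * ((h 1 1 + 1) * (h 1 0 * h 8 5 + 1)))) <|
  (fun h => h.set 8 3 (2 * (h 1 0 + h 1 1) + 1)) <| (fun h => h.set 8 2 (h 8 1 * h 1 0 * h 8 0)) <|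
  (fun h => h.set 8 1 (roundCount h)) <| (fun h => h.set 8 5 (2 ^ (2 * h 1 0).size)) <|
  (fun h => h.set 8 0 (2 * h 1 0).size) <|
    h.set 9 1 (∑ x ∈ range (h 1 2), asgCount o h x)

/-- The number of weights available to a vertex is therefore at most `4 * n + 1`, small enough for
array `8`. -/
theorem two_pow_size_le (a : ℕ) : 2 ^ a.size ≤ 2 * a + 1 := by
  rcases Nat.eq_zero_or_pos a with rfl | ha
  · simp
  · obtain ⟨s, hs⟩ : ∃ s, a.size = s + 1 := ⟨a.size - 1, by have := Nat.size_pos.2 ha; omega⟩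
    have : 2 ^ s ≤ a := Nat.lt_size.1 (by omega)
    rw [hs, pow_succ]
    omega

theorem compT_setup {o : ℕ} (ho : o ≤ 3) : CompT (setup o) := by
  have c0 : ∀ x i, x ≠ 20 → Comp fun (_ : Unit) h => h x i := fun x i hx => Comp.cell x i hx
  have nr : ∀ i, Num fun (_ : Unit) h => h 8 i := fun i => Num.reg fun _ _ => i
  have sz : ∀ i, Comp fun (_ : Unit) h => (h 1 i).size := fun i => (c0 1 i (by decide)).size
  have nsz : ∀ i, Num fun (_ : Unit) h => (h 1 i).size := fun i => Num.size (c0 1 i (by decide))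
  have s2 : Comp fun (_ : Unit) h => (2 * h 1 0).size := ((Comp.const 2).mul Comp.numV).size
  have n2 : Num fun (_ : Unit) h => (2 * h 1 0).size := Num.size ((Comp.const 2).mul Comp.numV)
  have w1 := CompT.write 1 (x := 9) (f := fun h => ∑ x ∈ range (h 1 2), asgCount o h x)
    (Comp.sum Comp.numN Num.numN (Comp.asgCount ho Comp.last)) (Or.inl rfl)
  have w2 := CompT.write 0 (f := fun h => (2 * h 1 0).size) s2 (Or.inr ⟨rfl, n2⟩)
  have w3 := CompT.write 5 (f := fun h => 2 ^ (2 * h 1 0).size) (Comp.pow (Comp.const 2) s2 n2)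
    (Or.inr ⟨rfl, (((Num.const 2).mul ((Num.const 2).mul Num.numV)).add (Num.const 1)).of_le
      fun _ _ => two_pow_size_le _⟩)
  have w4 := CompT.write 1 (f := roundCount)
    (((((((((sz 0).add (sz 1)).add (sz 2)).add (sz 3)).add (sz 4)).add (Comp.const 5)).add
      ((Comp.const 2).mul Comp.numV)).add ((Comp.const 2).mul (Comp.numE.mul
      ((sz 0).add (Comp.const 1))))).add ((Comp.const 2).mul (Comp.numN.mul Comp.numN)) |>.add
      ((Comp.const 2).mul (Comp.numN.mul Comp.numV)))
    (Or.inr ⟨rfl, ((((((((nsz 0).add (nsz 1)).add (nsz 2)).add (nsz 3)).add (nsz 4)).add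
      (Num.const 5)).add ((Num.const 2).mul Num.numV)).add ((Num.const 2).mul (Num.numE.mul
      ((nsz 0).add (Num.const 1))))).add ((Num.const 2).mul (Num.numN.mul Num.numN)) |>.add
      ((Num.const 2).mul (Num.numN.mul Num.numV))⟩)
  have w5 := CompT.write 2 (f := fun h => h 8 1 * h 1 0 * h 8 0) (((c0 8 1 (by decide)).mul Comp.numV).mul (c0 8 0 (by decide)))
    (Or.inr ⟨rfl, ((nr 1).mul Num.numV).mul (nr 0)⟩)
  have w6 := CompT.write 3 (f := fun h => 2 * (h 1 0 + h 1 1) + 1) (((Comp.const 2).mul (Comp.numV.add Comp.numE)).add (Comp.const 1))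
    (Or.inr ⟨rfl, ((Num.const 2).mul (Num.numV.add Num.numE)).add (Num.const 1)⟩)
  have w7 := CompT.write 4
    (f := fun h => (h 1 0 + 1) * ((h 1 1 + 1) * (h 1 0 * h 8 5 + 1))) ((Comp.numV.add (Comp.const 1)).mul ((Comp.numE.add (Comp.const 1)).mul
      ((Comp.numV.mul (c0 8 5 (by decide))).add (Comp.const 1))))
    (Or.inr ⟨rfl, (Num.numV.add (Num.const 1)).mul ((Num.numE.add (Num.const 1)).mul
      ((Num.numV.mul (nr 5)).add (Num.const 1)))⟩)
  have w8 := CompT.write 2 (x := 9) (f := fun h => 2 ^ h 8 3)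
    (Comp.pow (Comp.const 2) (c0 8 3 (by decide)) (nr 3)) (Or.inl rfl)
  have w9 := CompT.write 0 (x := 9) (f := fun h => h 9 2 ^ h 8 4 + 2)
    ((Comp.pow (c0 9 2 (by decide)) (c0 8 4 (by decide)) (nr 4)).add (Comp.const 2)) (Or.inl rfl)
  exact w9.comp (w8.comp (w7.comp (w6.comp (w5.comp (w4.comp (w3.comp (w2.comp w1)))))))

theorem setup_spec {o n m N : ℕ} {ends : Fin m → Fin n × Fin n} {T : SimpleGraph (Fin N)}
    {bag : Fin N → Finset (Fin n)} {h : Mem} (he : Enc o ends T bag h) :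
    SameOff {8, 9} h (setup o h) ∧ Params n m (setup o h) ∧ setup o h 8 0 = (2 * n).size ∧
      setup o h 8 1 = roundCount h ∧ setup o h 8 2 = roundCount h * n * (2 * n).size ∧
      setup o h 9 1 = ∑ x, 3 ^ (bag x).card := by
  have h1 : ∑ x ∈ range (h 1 2), asgCount o h x = ∑ x, 3 ^ (bag x).card := by
    rw [he.numN, sum_range]
    exact sum_congr rfl fun x _ => he.asgCount x
  refine ⟨?_, ⟨?_, ?_, ?_, ?_, ?_⟩, ?_, ?_, ?_, ?_⟩
  · unfold setup
    exact ((((((((((SameOff.refl _ _).set (by decide) _ _).set (by decide) _ _).set (by decide) _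
      _).set (by decide) _ _).set (by decide) _ _).set (by decide) _ _).set (by decide) _ _).set
      (by decide) _ _).set (by decide) _ _)
  all_goals simp [setup, Mem.set_apply, roundCount, he.numV, he.numE, h1]

/-! ### Tossing the coins -/

/-- The memory after tossing coins. -/
def flipped (h : Mem) (cs : List Bool) (C : ℕ) : Mem := fun x i =>
  if x = 10 ∧ i < C then (cs.getD i false).toNat else h x i

/-- All coins are tossed and stored in advance, so that the rest of the computation is a
deterministic transformation of the memory. -/
theorem run_flips : ∃ (p : Prog) (q : Polynomial ℕ), ∀ L h ρ cs, Small L () h → h 8 2 ≤ cs.length →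
    ∃ t ≤ q.eval L, ∃ ρ', Run p ⟨withStack h ρ, cs⟩ t
      ⟨withStack (flipped h cs (h 8 2)) ρ', cs.drop (h 8 2)⟩ := by
  refine ⟨.seq (.assign 20 (.const 0) (.const 0)) (.loop (.bin .lt (.get 20 (.const 0))
    (.get 8 (.const 2))) (.seq (.flip 10 (.get 20 (.const 0))) (.assign 20 (.const 0)
    (.bin .add (.get 20 (.const 0)) (.const 1))))),
    (Polynomial.X + 1) * ((Polynomial.X + 1) * (Polynomial.X + 1) + 20 * Polynomial.X + 50),
    fun L h ρ cs hs hlen => ?_⟩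
  have hC := hs.reg 2
  have hsz : ∀ i ≤ h 8 2, i.size ≤ L := fun i hi => (size_le_self i).trans (hi.trans hC)
  obtain ⟨t, ht, s', hr, ρ', rfl, -⟩ := Run.loop_iterate (h 8 2)
    (e := .bin .lt (.get 20 (.const 0)) (.get 8 (.const 2)))
    (p := .seq (.flip 10 (.get 20 (.const 0))) (.assign 20 (.const 0)
      (.bin .add (.get 20 (.const 0)) (.const 1))))
    (C := (L + 1) * (L + 1) + 4 * L + 20) (τ := 10 * L + 25)
    (fun i s => ∃ ρ', s = ⟨withStack (flipped h cs i) ρ', cs.drop i⟩ ∧ ρ' 0 = i)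
    (by
      rintro i hi _ ⟨σ, rfl, h0⟩
      have hi' := hsz i hi.le
      have hi'' := hsz (i + 1) hi
      have hc := hsz _ le_rfl
      have h82 : (withStack (flipped h cs i) σ) 8 2 = h 8 2 := by
        rw [withStack_of_ne (by decide)]
        simp [flipped]
      refine ⟨?_, ?_, ?_⟩
      · simp only [Expr.eval, Op.eval, h82, withStack_stack, h0, if_pos hi]
        exact one_ne_zero
      · simp only [Expr.eval, Expr.cost, h82, withStack_stack, h0]
        have := Nat.mul_le_mul (Nat.add_le_add_right hi' 1) (Nat.add_le_add_right hc 1)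
        simp only [Nat.size_zero, show Nat.size 2 = 2 from by decide]
        omega
      · have hd : cs.drop i = cs[i] :: cs.drop (i + 1) := List.drop_eq_getElem_cons (by omega)
        have hf := Run.flip 10 (.get 20 (.const 0)) (withStack (flipped h cs i) σ) cs[i]
          (cs.drop (i + 1))
        simp only [Expr.eval, withStack_stack, h0, withStack_set (show (10 : ℕ) ≠ 20 by decide)] at hf
        have hset : (flipped h cs i).set 10 i cs[i].toNat = flipped h cs (i + 1) := by
          funext x j
          rw [Mem.set_apply]
          simp only [flipped]
          by_cases hx : x = 10
          · by_cases hj : j = i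
            · subst hj
              rw [if_pos ⟨hx, rfl⟩, if_pos ⟨hx, by omega⟩, List.getD_eq_getElem _ _ (by omega)]
            · rw [if_neg fun hh => hj hh.2]
              refine if_congr ?_ rfl rfl
              omega
          · simp [hx]
        rw [hset] at hf
        rw [hd]
        refine ⟨_, ?_, _, Run.seq hf (Run.assign_stack 0 _ _ σ _), _, rfl, ?_⟩
        · simp only [Expr.eval, Expr.cost, Op.eval, withStack_stack, h0, Nat.size_zero, Nat.size_one]
          omega
        · simp [Expr.eval, Op.eval, h0])
    (by
      rintro _ ⟨σ, rfl, h0⟩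
      have hc := hsz _ le_rfl
      have h82 : (withStack (flipped h cs (h 8 2)) σ) 8 2 = h 8 2 := by
        rw [withStack_of_ne (by decide)]
        simp [flipped]
      refine ⟨?_, ?_⟩
      · simp [Expr.eval, Op.eval, h82, withStack_stack, h0]
      · simp only [Expr.eval, Expr.cost, h82, withStack_stack, h0]
        have := Nat.mul_le_mul (Nat.add_le_add_right hc 1) (Nat.add_le_add_right hc 1)
        simp only [Nat.size_zero, show Nat.size 2 = 2 from by decide]
        omega)
    (s := ⟨withStack h (Function.update ρ 0 0), cs⟩) ⟨Function.update ρ 0 0, by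
      congr 2
      funext x i
      simp [flipped], by simp⟩
  refine ⟨_, ?_, ρ', Run.seq (Run.assign_stack 0 (.const 0) h ρ cs) hr⟩
  simp only [Expr.cost, Expr.eval, Nat.size_zero, Polynomial.eval_add, Polynomial.eval_mul,
    Polynomial.eval_X, Polynomial.eval_one, Polynomial.eval_ofNat]
  have := Nat.mul_le_mul_right ((L + 1) * (L + 1) + 4 * L + 20 + (10 * L + 25) + 1) hC
  nlinarith

end CutCount

namespace CutCount
open Finset

/-! ### The whole algorithm -/

/-- A bag has at most `width + 1` vertices; the extra factor 3 and the number of nodes go into the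
polynomial. -/
theorem sum_bag_le {n m N : ℕ} {ends : Fin m → Fin n × Fin n}
    (D : TreeDecomposition (graphOf ends) N) :
    ∑ x, 3 ^ (D.bag x).card ≤ 3 ^ D.width * (3 * N) := by
  have h1 : ∀ x, 3 ^ (D.bag x).card ≤ 3 ^ D.width * 3 := fun x => by
    rw [← pow_succ]
    refine Nat.pow_le_pow_right (by norm_num) ?_
    have : (D.bag x).card ≤ univ.sup fun x => (D.bag x).card :=
      le_sup (f := fun x => (D.bag x).card) (mem_univ x)
    rw [TreeDecomposition.width]
    omega
  calc ∑ x, 3 ^ (D.bag x).card ≤ (univ : Finset (Fin N)).card • (3 ^ D.width * 3) :=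
        sum_le_card_nsmul _ _ _ fun x _ => h1 x
    _ = 3 ^ D.width * (3 * N) := by
        rw [card_univ, Fintype.card_fin, smul_eq_mul]
        ring

theorem flipped_sameOff (h : Mem) (cs : List Bool) (C : ℕ) : SameOff {10} h (flipped h cs C) := by
  intro x hx
  funext i
  rw [flipped, if_neg fun hh => hx (mem_singleton.2 hh.1)]

theorem withStack_zero {x : List (List ℕ)} (hx : x.length ≤ 19) :
    withStack (inputMem x) (fun _ => 0) = inputMem x := by
  funext y i
  by_cases hy : y = 20
  · subst hy
    rw [withStack_stack]
    change 0 = (x.getD 19 []).getD i 0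
    rw [List.getD_eq_default _ _ hx]
    rfl
  · rw [withStack_of_ne hy]

/-- Prepare, toss the coins, and run all the rounds. -/
theorem exists_program {o : ℕ} (ho : o ≤ 3) {aF : ℕ → ℕ → ℕ → Mem → ℕ} {bF : ℕ → ℕ → Mem → ℕ}
    {tF : ℕ → Mem → ℕ} (ha : CompFun3 aF) (hb : CompFun2 bF) (ht : CompFun1 tF) (htn : NumFun1 tF) :
    ∃ (p : Prog) (P : Polynomial ℕ), ∀ {n m N : ℕ} {ends : Fin m → Fin n × Fin n}
      (D : TreeDecomposition (graphOf ends) N) (x : List (List ℕ)), x.length ≤ 19 →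
      Enc o ends D.tree D.bag (inputMem x) → Small (inputSize x) () (inputMem x) →
      setup o (inputMem x) 8 2 ≤ 3 ^ D.width * P.eval (inputSize x) ∧
      ∀ cs : List Bool, cs.length = 3 ^ D.width * P.eval (inputSize x) →
        ∃ t ≤ 3 ^ D.width * P.eval (inputSize x), ∃ ρ cs', Run p ⟨inputMem x, cs⟩ t
          ⟨withStack (rounds o aF bF tF (flipped (setup o (inputMem x)) cs
            (setup o (inputMem x) 8 2))) ρ, cs'⟩ := by
  obtain ⟨ps, qs, hs⟩ := compT_setup ho
  obtain ⟨pf, qf, hf⟩ := run_flips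
  obtain ⟨-, -, pr, qr, hr⟩ := CompS.rounds (Γ := Unit) ho ha hb ht htn
  -- The preparation enlarges the bound `L` to `qs` of it, so the other polynomials are composed
  -- with `qs`; the factor `3 * X + 1` comes from `K + 1 ≤ 3 ^ width * (3 * L + 1)`.
  refine ⟨.seq ps (.seq pf (pr (fun _ => 0) 0)), qs + qf.comp qs +
    (3 * Polynomial.X + 1) * qr.comp (qs + 1), fun {n m N ends} D x hx he hsm => ?_⟩
  set L := inputSize x
  set h := setup o (inputMem x) with hh
  obtain ⟨h1, h2, -, -, h3, h4⟩ := setup_spec he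
  rw [← hh] at h1 h2 h3 h4
  have hpos : 1 ≤ 3 ^ D.width := Nat.one_le_pow _ _ (by norm_num)
  obtain ⟨hs1, -⟩ := hs L (inputMem x) (fun _ => 0) [] hsm
  rw [← hh] at hs1
  have hev : (qs + qf.comp qs + (3 * Polynomial.X + 1) * qr.comp (qs + 1)).eval L =
      qs.eval L + qf.eval (qs.eval L) + (3 * L + 1) * qr.eval (qs.eval L + 1) := by
    simp
  rw [hev]
  have hC : h 8 2 ≤ 3 ^ D.width *
      (qs.eval L + qf.eval (qs.eval L) + (3 * L + 1) * qr.eval (qs.eval L + 1)) :=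
    (hs1.reg 2).trans (((Nat.le_add_right _ _).trans (Nat.le_add_right _ _)).trans
      (Nat.le_mul_of_pos_left _ hpos))
  refine ⟨hC, fun cs hcs => ?_⟩
  obtain ⟨-, t1, ht1, ρ1, r1⟩ := hs L (inputMem x) (fun _ => 0) cs hsm
  rw [withStack_zero hx, ← hh] at r1
  obtain ⟨t2, ht2, ρ2, r2⟩ := hf _ h ρ1 cs hs1 (by rw [hcs]; exact hC)
  have hfl := flipped_sameOff h cs (h 8 2)
  have hs2 : Small (qs.eval L + 1) () (flipped h cs (h 8 2)) := by
    refine ⟨fun y i => ?_, fun i hi => absurd hi (Nat.not_lt_zero i), fun i hi => ?_, fun i => ?_⟩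
    · rw [flipped]
      split_ifs
      · exact (size_le_self _).trans ((Bool.toNat_le _).trans (by omega))
      · exact (hs1.size y i).trans (by omega)
    · rw [hfl 1 (by decide)]
      exact (hs1.input i hi).trans (by omega)
    · rw [hfl 8 (by decide)]
      exact (hs1.reg i).trans (by omega)
  obtain ⟨t3, ht3, ρ3, r3, -⟩ := hr (fun _ => 0) 0 _ () _ ρ2 (cs.drop (h 8 2))
    (fun i hi => absurd hi (Nat.not_lt_zero i)) (Nat.zero_le _) hs2
  refine ⟨_, ?_, ρ3, _, Run.seq r1 (Run.seq r2 r3)⟩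
  rw [hfl 9 (by decide), h4, pow_one] at ht3
  have hN : N ≤ L := by
    rw [← he.numN]
    exact hsm.input 2 (by norm_num)
  have h5 : (∑ x, 3 ^ (D.bag x).card) + 1 ≤ 3 ^ D.width * (3 * L + 1) := by
    have := (sum_bag_le D).trans (Nat.mul_le_mul_left (3 ^ D.width) (Nat.mul_le_mul_left 3 hN))
    rw [mul_add]
    omega
  have h6 := ht3.trans (Nat.mul_le_mul_right _ h5)
  have h7 : t1 + t2 ≤ 3 ^ D.width * (qs.eval L + qf.eval (qs.eval L)) :=
    (Nat.add_le_add ht1 ht2).trans (Nat.le_mul_of_pos_left _ hpos)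
  calc t1 + (t2 + t3) = t1 + t2 + t3 := by ring
    _ ≤ 3 ^ D.width * (qs.eval L + qf.eval (qs.eval L)) +
        3 ^ D.width * (3 * L + 1) * qr.eval (qs.eval L + 1) := Nat.add_le_add h7 h6
    _ = _ := by ring

theorem output_withStack (n : ℕ) (h : Mem) (ρ : ℕ → ℕ) (cs : List Bool) :
    output n ⟨withStack h ρ, cs⟩ = output n ⟨h, []⟩ := by
  rw [output, output]
  simp only [withStack_of_ne (show (0 : ℕ) ≠ 20 by decide)]

/-! ### Inputs -/

theorem mem_le_inputSize {x : List (List ℕ)} {t : List ℕ} (ht : t ∈ x) :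
    (t.map fun a => a.size + 1).sum ≤ inputSize x :=
  List.le_sum_of_mem (List.mem_map_of_mem ht)

theorem length_le_inputSize {x : List (List ℕ)} {t : List ℕ} (ht : t ∈ x) :
    t.length ≤ inputSize x := by
  refine le_trans ?_ (mem_le_inputSize ht)
  have := List.length_le_sum_of_one_le (t.map fun a => a.size + 1) (by
    intro i hi
    obtain ⟨a, -, rfl⟩ := List.mem_map.1 hi
    omega)
  rw [List.length_map] at this
  exact this

theorem size_le_inputSize (x : List (List ℕ)) (y i : ℕ) : (inputMem x y i).size ≤ inputSize x := by
  cases y with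
  | zero => simp [inputMem]
  | succ j =>
    change ((x.getD j []).getD i 0).size ≤ _
    by_cases hj : j < x.length
    · rw [List.getD_eq_getElem _ _ hj]
      by_cases hi : i < x[j].length
      · rw [List.getD_eq_getElem _ _ hi]
        refine le_trans ?_ (mem_le_inputSize (List.getElem_mem hj))
        exact (Nat.le_succ _).trans (List.le_sum_of_mem (List.mem_map_of_mem (f := fun a : ℕ =>
          a.size + 1) (List.getElem_mem hi)))
      · rw [List.getD_eq_default _ _ (not_lt.1 hi)]
        simp
    · rw [List.getD_eq_default _ _ (not_lt.1 hj)]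
      simp

theorem getD_ofFn {n : ℕ} (f : Fin n → ℕ) (i : Fin n) : (List.ofFn f).getD i 0 = f i := by
  rw [List.getD_eq_getElem _ _ (by simp)]
  simp

theorem getD_ofFn_mul {N n : ℕ} (f : Fin N → Fin n → ℕ) (x : Fin N) (v : Fin n) :
    (List.ofFn fun i : Fin (N * n) => f i.divNat i.modNat).getD (x * n + v) 0 = f x v := by
  have hlt : (x : ℕ) * n + v < N * n := by
    calc (x : ℕ) * n + v < x * n + n := by omega
      _ = (x + 1) * n := by ring
      _ ≤ N * n := Nat.mul_le_mul_right _ x.2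
  have := getD_ofFn (fun i : Fin (N * n) => f i.divNat i.modNat) ⟨x * n + v, hlt⟩
  dsimp only at this
  rw [this]
  have h1 : (⟨x * n + v, hlt⟩ : Fin (N * n)).divNat = x := by
    ext
    rw [Fin.coe_divNat]
    dsimp only
    rw [mul_comm, Nat.mul_add_div v.pos, Nat.div_eq_of_lt v.2, add_zero]
  have h2 : (⟨x * n + v, hlt⟩ : Fin (N * n)).modNat = v := by
    ext
    rw [Fin.coe_modNat]
    dsimp only
    rw [mul_comm, Nat.mul_add_mod, Nat.mod_eq_of_lt v.2]
  rw [h1, h2]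

theorem sum_size_ofFn_le {n c : ℕ} (f : Fin n → ℕ) (hf : ∀ i, (f i).size + 1 ≤ c) :
    ((List.ofFn f).map fun a => a.size + 1).sum ≤ n * c := by
  have := List.sum_le_card_nsmul ((List.ofFn f).map fun a => a.size + 1) c (by
    intro a ha
    obtain ⟨b, hb, rfl⟩ := List.mem_map.1 ha
    obtain ⟨i, rfl⟩ := (List.mem_ofFn).1 hb
    exact hf i)
  simpa using this

section
variable {n m N : ℕ} (ends : Fin m → Fin n × Fin n) (D : TreeDecomposition (graphOf ends) N)

theorem enc_encodeGraph {o : ℕ} {x : List (List ℕ)} (hV : inputMem x 1 0 = n)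
    (hE : inputMem x 1 1 = m) (hN : inputMem x 1 2 = N)
    (hx : ∀ j, inputMem x (o + j) = fun i => ((encodeGraph ends D).getD j []).getD i 0) :
    Enc o ends D.tree D.bag (inputMem x) where
  numV := hV
  numE := hE
  numN := hN
  fst := fun e => by
    rw [← Nat.add_zero o, hx 0]
    exact getD_ofFn (fun e => ((ends e).1 : ℕ)) e
  snd := fun e => by
    rw [hx 1]
    exact getD_ofFn (fun e => ((ends e).2 : ℕ)) e
  adj := fun a b => by
    classical
    rw [hx 2]
    have := getD_ofFn_mul (fun a b => if D.tree.Adj a b then 1 else 0) a b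
    rw [encodeGraph]
    change (List.getD _ _ 0) ≠ 0 ↔ _
    have h2 : (List.ofFn fun i : Fin (N * N) =>
      if D.tree.Adj i.divNat i.modNat then 1 else 0).getD (a * N + b) 0 ≠ 0 ↔ D.tree.Adj a b := by
      rw [this]
      simp
    convert h2
    rfl
  bag := fun a b => by
    classical
    rw [hx 3]
    have := getD_ofFn_mul (fun a b => if b ∈ D.bag a then 1 else 0) a b
    rw [encodeGraph]
    change (List.getD _ _ 0) ≠ 0 ↔ _
    have h2 : (List.ofFn fun i : Fin (N * n) =>
      if i.modNat ∈ D.bag i.divNat then 1 else 0).getD (a * n + b) 0 ≠ 0 ↔ b ∈ D.bag a := by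
      rw [this]
      simp
    convert h2
    rfl

theorem inputSize_encodeGraph_le : inputSize (encodeGraph ends D) ≤
    2 * (m * (n.size + 1)) + 2 * (N * N) + 2 * (N * n) := by
  have h1 := sum_size_ofFn_le (c := n.size + 1) (fun e => ((ends e).1 : ℕ)) fun e =>
    Nat.succ_le_succ (Nat.size_le_size (ends e).1.2.le)
  have h2 := sum_size_ofFn_le (c := n.size + 1) (fun e => ((ends e).2 : ℕ)) fun e =>
    Nat.succ_le_succ (Nat.size_le_size (ends e).2.2.le)
  classical
  have h3 := sum_size_ofFn_le (n := N * N) (c := 2)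
    (fun i => if D.tree.Adj i.divNat i.modNat then 1 else 0) fun i => by split_ifs <;> simp
  have h4 := sum_size_ofFn_le (n := N * n) (c := 2)
    (fun i => if i.modNat ∈ D.bag i.divNat then 1 else 0) fun i => by split_ifs <;> simp
  rw [encodeGraph, inputSize]
  simp only [List.map_cons, List.map_nil, List.sum_cons, List.sum_nil, add_zero]
  refine le_trans (b := m * (n.size + 1) + (m * (n.size + 1) + (N * N * 2 + N * n * 2)))
    (Nat.add_le_add h1 (Nat.add_le_add h2 (Nat.add_le_add ?_ ?_))) (by omega)
  · convert h3
  · convert h4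

/-- The tables have `m`, `N * N` and `N * n` entries, and `N ≥ 1` because a tree has a node. So `n`,
`m`, `N` are bounded by the length of the input although they are written in binary. Array `8` is
beyond the tables and initially zero. -/
theorem small_encode {x : List (List ℕ)} (hsub : encodeGraph ends D ⊆ x) (hV : inputMem x 1 0 = n)
    (hE : inputMem x 1 1 = m) (hN : inputMem x 1 2 = N) (hx : x.length ≤ 7) :
    Small (inputSize x) () (inputMem x) := by
  have hN1 : 1 ≤ N := D.isTree.1.nonempty.elim fun a => a.pos
  have l1 : m ≤ inputSize x := by
    have := length_le_inputSize (hsub (List.mem_cons_self (a := List.ofFn fun e => ((ends e).1 : ℕ))))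
    simpa using this
  have l2 : N * N ≤ inputSize x := by
    have := length_le_inputSize (hsub (List.mem_cons_of_mem _ (List.mem_cons_of_mem _
      List.mem_cons_self)))
    simpa using this
  have l3 : N * n ≤ inputSize x := by
    have := length_le_inputSize (hsub (List.mem_cons_of_mem _ (List.mem_cons_of_mem _
      (List.mem_cons_of_mem _ List.mem_cons_self))))
    simpa using this
  refine ⟨size_le_inputSize x, fun i hi => absurd hi (Nat.not_lt_zero i), fun i hi => ?_, fun i => ?_⟩
  · have l4 := Nat.le_mul_of_pos_left N hN1
    have l5 := Nat.le_mul_of_pos_left n hN1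
    interval_cases i <;> omega
  · change (x.getD 7 []).getD i 0 ≤ _
    rw [List.getD_eq_default _ _ hx]
    exact Nat.zero_le _

end
end CutCount

/-! ### The memory before the rounds -/

namespace CutCount
open Finset

section
variable {o n m N : ℕ} {ends : Fin m → Fin n × Fin n} {D : TreeDecomposition (graphOf ends) N}

theorem Params.congr {h h' : Mem} (hp : Params n m h) (h8 : h' 8 = h 8) (h9 : h' 9 = h 9) :
    Params n m h' where
  weights := by rw [h8]; exact hp.weights
  digits := by rw [h8]; exact hp.digits
  indices := by rw [h8]; exact hp.indices
  base := by rw [h8, h9]; exact hp.base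
  modulus := by rw [h8, h9]; exact hp.modulus

theorem prepared_spec {h : Mem} (he : Enc o ends D.tree D.bag h) (ho : o ≤ 3) (cs : List Bool)
    (C : ℕ) : SameOff {8, 9, 10} h (flipped (setup o h) cs C) ∧
      Params n m (flipped (setup o h) cs C) ∧
      Enc o ends D.tree D.bag (flipped (setup o h) cs C) ∧
      (∀ z, 3 ^ (D.bag z).card ≤ flipped (setup o h) cs C 9 1) ∧
      flipped (setup o h) cs C 8 0 = (2 * n).size ∧
      flipped (setup o h) cs C 8 1 = roundCount h := by
  obtain ⟨h1, h2, h3, h4, -, h5⟩ := setup_spec he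
  have hf := flipped_sameOff (setup o h) cs C
  have hs : SameOff {8, 9, 10} h (flipped (setup o h) cs C) :=
    (h1.mono (by decide)).trans (hf.mono (by decide))
  refine ⟨hs, h2.congr (hf 8 (by decide)) (hf 9 (by decide)),
    he.of_sameOff ho hs (by decide), fun z => ?_, ?_, ?_⟩
  · rw [hf 9 (by decide), h5]
    exact single_le_sum (f := fun z => 3 ^ (D.bag z).card) (fun _ _ => Nat.zero_le _) (mem_univ z)
  · rw [hf 8 (by decide), h3]
  · rw [hf 8 (by decide), h4]

end

/-! ### Success probability -/

-- With as many bits as the binary length of `2 * n`, there are more than `2 * n` weights, as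
-- `isolation` requires.
open Classical in
theorem isolation_bits (n : ℕ) {F : Set (Finset (Fin n))} (hF : F.Nonempty) :
    2 * ({ω : Fin n × Fin (2 * n).size → Bool |
        Isolates bitsVal F fun v j => ω (v, j)}ᶜ).ncard ≤
      2 ^ Fintype.card (Fin n × Fin (2 * n).size) := by
  have h1 := isolation (bitsVal_injective (2 * n).size)
    (by simpa using (Nat.lt_size_self (2 * n)).le) hF
  have h2 : ({ω : Fin n × Fin (2 * n).size → Bool |
      Isolates bitsVal F fun v j => ω (v, j)}ᶜ).ncard =
      (univ.filter fun w : Fin n → Fin (2 * n).size → Bool => ¬ Isolates bitsVal F w).card := by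
    rw [Set.ncard_eq_toFinset_card']
    refine card_equiv (Equiv.curry _ _ _) fun ω => ?_
    rw [Set.mem_toFinset, mem_filter]
    simp only [mem_univ, true_and]
    exact Iff.rfl
  have h3 : Fintype.card (Fin n → Fin (2 * n).size → Bool) =
      2 ^ Fintype.card (Fin n × Fin (2 * n).size) := by
    rw [Fintype.card_congr (Equiv.curry _ _ _).symm, Fintype.card_fun, Fintype.card_bool]
  rw [h2, ← h3]
  exact h1

theorem index_lt {r n b i v j : ℕ} (hi : i < r) (hv : v < n) (hj : j < b) :
    (i * n + v) * b + j < r * n * b := by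
  have h1 : i * n + v + 1 ≤ r * n := by
    calc i * n + v + 1 ≤ i * n + n := by omega
      _ = (i + 1) * n := by ring
      _ ≤ _ := Nat.mul_le_mul_right _ hi
  calc (i * n + v) * b + j < (i * n + v) * b + b := by omega
    _ = (i * n + v + 1) * b := by ring
    _ ≤ _ := Nat.mul_le_mul_right _ h1

/-- Different rounds, vertices and binary places read different coins; this is the independence of
the rounds. -/
theorem index_injective {n b : ℕ} {i i' : ℕ} {v v' : Fin n} {j j' : Fin b}
    (h : (i * n + v) * b + j = (i' * n + v') * b + j') : i = i' ∧ v = v' ∧ j = j' := by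
  have key : ∀ {c x y x' y' : ℕ}, y < c → y' < c → x * c + y = x' * c + y' → x = x' ∧ y = y' := by
    intro c x y x' y' hy hy' h
    have h1 := congrArg (· / c) h
    have h2 := congrArg (· % c) h
    have hc : 0 < c := by omega
    simpa [Nat.mul_comm _ c, Nat.mul_add_div hc, Nat.mul_add_mod, Nat.div_eq_of_lt hy,
      Nat.div_eq_of_lt hy', Nat.mod_eq_of_lt hy, Nat.mod_eq_of_lt hy'] using And.intro h1 h2
  obtain ⟨h1, h2⟩ := key j.2 j'.2 h
  obtain ⟨h3, h4⟩ := key v.2 v'.2 h1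
  exact ⟨h3, Fin.ext h4, Fin.ext h2⟩

theorem vertexWeight_flipped {h : Mem} {n T r i : ℕ} {v : Fin n} {cs : Fin T → Bool} {b : ℕ}
    (hn : h 1 0 = n) (hb : h 8 0 = b) (hw : h 8 5 = 2 ^ b) (hi : i < r)
    (e : Fin n × Fin b → Fin T) (he : ∀ u j, (e (u, j) : ℕ) = (i * n + u) * b + j) :
    vertexWeight i v (flipped h (List.ofFn cs) (r * n * b)) = bitsVal fun j => cs (e (v, j)) := by
  have hs := flipped_sameOff h (List.ofFn cs) (r * n * b)
  have h1 : coinValue i v (flipped h (List.ofFn cs) (r * n * b)) =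
      bitsVal fun j => cs (e (v, j)) := by
    rw [coinValue, hs 8 (by decide), hs 1 (by decide), hn, hb, sum_range, bitsVal]
    refine sum_congr rfl fun j _ => ?_
    rw [flipped, if_pos ⟨rfl, index_lt hi v.2 j.2⟩, ← he v j, List.getD_eq_getElem _ _ (by simp)]
    simp
  rw [vertexWeight, h1, hs 8 (by decide), hw, if_pos (bitsVal_lt _)]

/-! ### Restricted Independent Almost Forest Deletion -/

theorem findsWithin_riafd : ∃ (p : Prog) (P : Polynomial ℕ),
    ∀ (n m N : ℕ) (ends : Fin m → Fin n × Fin n) (R : Finset (Fin n)) (k l : ℕ)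
      (D : TreeDecomposition (graphOf ends) N), FindsWithin p (encodeRIAFD ends R k l D)
        (3 ^ D.width * P.eval (inputSize (encodeRIAFD ends R k l D))) n
        (riafdSolutions (graphOf ends) R k l) := by
  obtain ⟨p, P, hp⟩ := exists_program (o := 3) (by norm_num) compFun_riafdV compFun_riafdE
    compFun_riafdT numFun_riafdT
  refine ⟨p, P, fun n m N ends R k l D => ?_⟩
  set x := encodeRIAFD ends R k l D with hx
  have he : Enc 3 ends D.tree D.bag (inputMem x) := enc_encodeGraph ends D rfl rfl rfl fun j => by
    rw [Nat.add_comm]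
    rfl
  have hsm : Small (inputSize x) () (inputMem x) :=
    small_encode ends D (fun a ha => List.mem_cons_of_mem _ (List.mem_cons_of_mem _ ha)) rfl rfl rfl
      (by simp [hx, encodeRIAFD, encodeGraph])
  -- Having at least `|x|` rounds brings the probability of failure down to `2 ^ (-|x|)`.
  have hsize : inputSize x ≤ roundCount (inputMem x) := by
    have h1 := inputSize_encodeGraph_le ends D
    have h2 := sum_size_ofFn_le (n := n) (c := 2)
      (fun v => if v ∈ R then 1 else 0) fun i => by split_ifs <;> simp
    change (n.size + 1 + (m.size + 1 + (N.size + 1 + (k.size + 1 + (l.size + 1 + 0))))) +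
      (((List.ofFn fun v => if v ∈ R then 1 else 0).map fun a => a.size + 1).sum +
        inputSize (encodeGraph ends D)) ≤ n.size + m.size + N.size + k.size + l.size + 5 +
      2 * n + 2 * (m * (n.size + 1)) + 2 * (N * N) + 2 * (N * n)
    omega
  obtain ⟨hT, hrun⟩ := hp D x (by simp [hx, encodeRIAFD, encodeGraph]) he hsm
  set T := 3 ^ D.width * P.eval (inputSize x)
  set C := setup 3 (inputMem x) 8 2 with hC
  have hR : ∀ v : Fin n, inputMem x 2 v = 0 ↔ v ∉ R := fun v => by
    have := getD_ofFn (fun v => if v ∈ R then 1 else 0) v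
    change (List.ofFn fun v => if v ∈ R then 1 else 0).getD v 0 = 0 ↔ _
    rw [this]
    simp
  have main : ∀ cs, _ := fun cs => by
    obtain ⟨h1, h2, h3, h4, -, -⟩ := prepared_spec he (by norm_num) cs C
    exact rounds_riafd (k := k) (l := l) h2 h3 (fun v => by rw [h1 2 (by decide)]; exact hR v)
      (by rw [h1 1 (by decide)]; rfl) (by rw [h1 1 (by decide)]; rfl) h4
      (by rw [h1 0 (by decide)]; rfl)
  refine ⟨fun cs => ?_, fun hne => ?_⟩
  · obtain ⟨t, ht, ρ, cs', r⟩ := hrun (List.ofFn cs) (List.length_ofFn)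
    refine ⟨t, ht, _, r, fun S hS => ?_⟩
    rw [output_withStack] at hS
    exact (main _).1 S hS
  · obtain ⟨S₀, hS₀⟩ := hne
    obtain ⟨hoff, hpar, hb, -, hCeq, -⟩ := setup_spec he
    rw [← hC] at hCeq
    have hT' : roundCount (inputMem x) * n * (2 * n).size ≤ T := hCeq ▸ hT
    -- A solution `S₀` is fixed for the analysis. A round is good if its weights isolate a member
    -- among the solutions with the same size and the same number of remaining edges as `S₀`.
    refine le_coinProb (r := roundCount (inputMem x)) (κ := Fin n × Fin (2 * n).size)
      (emb := fun q => ⟨((q.1 : ℕ) * n + q.2.1) * (2 * n).size + q.2.2,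
        (index_lt q.1.2 q.2.1.2 q.2.2.2).trans_le hT'⟩) ?_ _
      (isolation_bits n (F := {S | S ∈ riafdSolutions (graphOf ends) R k l ∧ S.card = S₀.card ∧
        (edgesOff ends S).card = (edgesOff ends S₀).card}) ⟨S₀, hS₀, rfl, rfl⟩)
      (fun cs i hg => ?_) hsize
    · rintro ⟨i, v, j⟩ ⟨i', v', j'⟩ h
      obtain ⟨h1, h2, h3⟩ := index_injective (congrArg Fin.val h)
      exact Prod.ext (Fin.ext h1) (Prod.ext h2 h3)
    · obtain ⟨t, ht, ρ, cs', r⟩ := hrun (List.ofFn cs) (List.length_ofFn)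
      have hw : ∀ v : Fin n, vertexWeight i v (flipped (setup 3 (inputMem x)) (List.ofFn cs) C) =
          bitsVal fun j => cs ⟨((i : ℕ) * n + v) * (2 * n).size + j,
            (index_lt i.2 v.2 j.2).trans_le hT'⟩ := fun v => by
        rw [hCeq]
        exact vertexWeight_flipped (by rw [hoff 1 (by decide)]; rfl) hb (by rw [hpar.weights, hb])
          i.2 (fun q => ⟨((i : ℕ) * n + q.1) * (2 * n).size + q.2,
            (index_lt i.2 q.1.2 q.2.2).trans_le hT'⟩) fun u j => rfl
      obtain ⟨S, hS, hout⟩ := (main (List.ofFn cs)).2 ⟨i, by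
        rw [(prepared_spec he (by norm_num) (List.ofFn cs) C).2.2.2.2.2]
        exact i.2, _, bitsVal, _, S₀, hw, hg⟩
      exact ⟨t, ht, _, r, S, hS, by rw [output_withStack]; exact hout⟩

/-! ### Pseudoforest Deletion -/

theorem findsWithin_pd : ∃ (p : Prog) (P : Polynomial ℕ),
    ∀ (n m N : ℕ) (ends : Fin m → Fin n × Fin n) (k : ℕ)
      (D : TreeDecomposition (graphOf ends) N), FindsWithin p (encodePD ends k D)
        (3 ^ D.width * P.eval (inputSize (encodePD ends k D))) n
        (pdSolutions (graphOf ends) k) := by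
  obtain ⟨p, P, hp⟩ := exists_program (o := 2) (by norm_num) compFun_pdV compFun_pdE
    compFun_pdT numFun_pdT
  refine ⟨p, P, fun n m N ends k D => ?_⟩
  set x := encodePD ends k D with hx
  have he : Enc 2 ends D.tree D.bag (inputMem x) := enc_encodeGraph ends D rfl rfl rfl fun j => by
    rw [Nat.add_comm]
    rfl
  have hsm : Small (inputSize x) () (inputMem x) :=
    small_encode ends D (fun a ha => List.mem_cons_of_mem _ ha) rfl rfl rfl
      (by simp [hx, encodePD, encodeGraph])
  obtain ⟨-, hrun⟩ := hp D x (by simp [hx, encodePD, encodeGraph]) he hsm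
  set T := 3 ^ D.width * P.eval (inputSize x)
  set C := setup 2 (inputMem x) 8 2
  have main : ∀ cs, _ := fun cs => by
    obtain ⟨h1, h2, h3, h4, -, h5⟩ := prepared_spec he (by norm_num) cs C
    exact rounds_pd (k := k) h2 h3 (by rw [h1 1 (by decide)]; rfl) h4
      (by rw [h1 0 (by decide)]; rfl) (by rw [h5, roundCount]; omega)
  refine ⟨fun cs => ?_, fun hne => ?_⟩
  · obtain ⟨t, ht, ρ, cs', r⟩ := hrun (List.ofFn cs) (List.length_ofFn)
    refine ⟨t, ht, _, r, fun S hS => ?_⟩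
    rw [output_withStack] at hS
    exact (main _).1 S hS
  -- Every outcome of the coins leads to a solution, so the probability is 1.
  · rw [Set.eq_univ_of_forall (s := {r | _}) fun cs => ?_]
    · rw [coinProb, Set.ncard_univ, Nat.card_fun, Nat.card_eq_fintype_card,
        Nat.card_eq_fintype_card, Fintype.card_bool, Fintype.card_fin, Nat.cast_pow, Nat.cast_ofNat,
        div_self (by positivity), sub_le_self_iff]
      positivity
    · obtain ⟨t, ht, ρ, cs', r⟩ := hrun (List.ofFn cs) (List.length_ofFn)
      obtain ⟨S, hS, hout⟩ := (main (List.ofFn cs)).2 hne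
      exact ⟨t, ht, _, r, S, hS, by rw [output_withStack]; exact hout⟩

end CutCount

theorem theorem1 :
    (∃ (p : CutCount.Prog) (P : Polynomial ℕ),
      ∀ (n m N : ℕ) (ends : Fin m → Fin n × Fin n) (R : Finset (Fin n)) (k l : ℕ)
        (D : CutCount.TreeDecomposition (CutCount.graphOf ends) N),
        CutCount.FindsWithin p (CutCount.encodeRIAFD ends R k l D)
          (3 ^ D.width * P.eval (CutCount.inputSize (CutCount.encodeRIAFD ends R k l D))) n
          (CutCount.riafdSolutions (CutCount.graphOf ends) R k l)) ∧
    (∃ (p : CutCount.Prog) (P : Polynomial ℕ),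
      ∀ (n m N : ℕ) (ends : Fin m → Fin n × Fin n) (k : ℕ)
        (D : CutCount.TreeDecomposition (CutCount.graphOf ends) N),
        CutCount.FindsWithin p (CutCount.encodePD ends k D)
          (3 ^ D.width * P.eval (CutCount.inputSize (CutCount.encodePD ends k D))) n
          (CutCount.pdSolutions (CutCount.graphOf ends) k)) := by
  exact ⟨CutCount.findsWithin_riafd, CutCount.findsWithin_pd⟩
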